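/- Fix an integer $n\ge 1$ and real numbers $0<q<1$, $\alpha>0$. Write $(a;q^2)_n=\prod_{j=0}^{n-1}(1-aq^{2j})$. **The Hopf algebra.** Let $(a_{ij})$ be the Cartan matrix of type $A_n$. $U_q=U_q\mathfrak{sl}_{n+1}$ is the unital complex algebra with generators $E_i,F_i,K_i^{\pm1}$ ($1\le i\le n$) and relations $K_iK_j=K_jK_i$, $K_iK_i^{-1}=K_i^{-1}K_i=1$, $K_iE_j=q^{a_{ij}}E_jK_i$, $K_iF_j=q^{-a_{ij}}F_jK_i$, $E_iF_j-F_jE_i=\delta_{ij}(K_i-K_i^{-1})/(q-q^{-1})$; $E_i^2E_j-(q+q^{-1})E_iE_jE_i+E_jE_i^2=0$ and $F_i^2F_j-(q+q^{-1})F_iF_jF_i+F_jF_i^2=0$ if $|i-j|=1$; $[E_i,E_j]=[F_i,F_j]=0$ if $|i-j|\ne1$. Its comultiplication and antipode are given by $\Delta(E_i)=E_i\otimes1+K_i\otimes E_i$, $\Delta(F_i)=F_i\otimes K_i^{-1}+1\otimes F_i$, $\Delta(K_i)=K_i\otimes K_i$, $S(E_i)=-K_i^{-1}E_i$, $S(F_i)=-F_iK_i$,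 $S(K_i)=K_i^{-1}$. With the involution $E_n^*=-K_nF_n$, $F_n^*=-E_nK_n^{-1}$, and $E_j^*=K_jF_j$, $F_j^*=E_jK_j^{-1}$ for $j\ne n$, $(K_j^{\pm1})^*=K_j^{\pm1}$ for all $j$, it is denoted $U_q\mathfrak{su}_{n,1}$; a $U_q\mathfrak{su}_{n,1}$-module is a module over $U_q$. If $V$ is a $U_q$-module, $U_q$ acts on $\mathrm{End}(V)$ by $\xi(T)=\sum\xi'\,T\,S(\xi'')$, where $\Delta(\xi)=\sum\xi'\otimes\xi''$. **Functions.** $\mathcal F$ is the involutive unital complex algebra generated by $z_1,\dots,z_n$ and $f_0$ with relations $z_iz_j=qz_jz_i$ ($i<j$), $z_i^*z_j=qz_jz_i^*$ ($i\ne j$), $z_j^*z_j=q^2z_jz_j^*+(1-q^2)\bigl(1-\sum_{k>j}z_kz_k^*\bigr)$, $f_0^*=f_0^2=f_0$, $z_i^*f_0=f_0z_i=0$. It carries the $U_q\mathfrak{su}_{n,1}$-module algebra structure (compatible with the involutions: $(\xi f)^*=S(\xi)^*f^*$) in which, for $k\ne n$: $K_kz_k=qz_k$, $K_kz_{k+1}=q^{-1}z_{k+1}$,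 $K_kz_i=z_i$ otherwise; $F_kz_k=q^{1/2}z_{k+1}$, $F_kz_i=0$ otherwise; $E_kz_{k+1}=q^{-1/2}z_k$, $E_kz_i=0$ otherwise; $K_kf_0=f_0$, $E_kf_0=F_kf_0=0$; and $K_nz_n=q^2z_n$, $K_nz_i=qz_i$ ($i\ne n$), $F_nz_n=q^{1/2}$, $F_nz_i=0$ ($i\neq n$), $E_nz_i=-q^{1/2}z_nz_i$ (all $i$), $K_nf_0=f_0$, $F_nf_0=-\frac{q^{1/2}}{q^{-2}-1}f_0z_n^*$, $E_nf_0=-\frac{q^{1/2}}{1-q^2}z_nf_0$. Let $\mathbb C[z]\subset\mathcal F$ be the unital subalgebra generated by $z_1,\dots,z_n$, with the monomials $z^m=z_n^{m_n}\cdots z_1^{m_1}$, and let $\mathcal D=\mathcal Ff_0\mathcal F$ be the two-sided ideal of finite functions, a submodule of $\mathcal F$. **Twisted action.** $\mathcal F$ has a second action $\pi_\alpha$ of $U_q$: $\pi_\alpha(X_j)=X_j$ for $X\in\{E,F,K^{\pm1}\}$, $j\ne n$, and $\pi_\alpha(E_n)f=E_nf-q^{1/2}\frac{1-q^{2\alpha+2n+2}}{1-q^2}(K_nf)z_n$,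 $\pi_\alpha(F_n)f=q^{-\alpha-n-1}F_nf$, $\pi_\alpha(K_n^{\pm1})f=q^{\pm(\alpha+n+1)}K_n^{\pm1}f$. It preserves $\mathbb C[z]$; $\mathbb C[z]$ with this action is denoted $\mathbb C[z]_\alpha$, and $\mathrm{End}(\mathbb C[z]_\alpha)$ carries the resulting action of $U_q$. **Integrals.** Let $T$ be the Fock representation of $\mathcal F$, in the space $H$ with basis $e_m=z^me_0$ ($m\in\mathbb Z_{\ge0}^n$), where $z_i^*e_0=0$ and $T(f_0)$ is the projection onto $\mathbb Ce_0$ annihilating $e_m$, $m\neq0$. Let $T(f)_{p,r}$ be the coefficient of $e_p$ in $T(f)e_r$. For $\xi$ in the subalgebra generated by the $K_j^{\pm1}$ put $\Gamma(\xi)e_m=\xi(z^m)e_0$. For $f\in\mathcal D$ let $$\int f\,d\nu=(q^2;q^2)_n\,\mathrm{tr}\Bigl(T(f)\,\Gamma\Bigl(\prod_{j=1}^nK_j^{-j(n+1-j)}\Bigr)\Bigr).$$ For $f\in\mathcal F$ let $$\int f\,dm_\alpha=(q^{2\alpha+2};q^2)_n\sum_{m\in\mathbb Z_{\ge0}^n}T(f)_{m,m}\,q^{2k_1(\alpha+1)}q^{2k_2}\cdots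 q^{2k_n},\qquad k_i=\sum_{j\ge i}m_j,$$ and $(\varphi_1,\varphi_2)_\alpha=\int\varphi_2^*\varphi_1\,dm_\alpha$. **Toeplitz operators.** For $f\in\mathcal F$, $T_f:\mathbb C[z]_\alpha\to\mathbb C[z]_\alpha$ sends $\psi$ to the orthogonal projection of $f\psi$ to $\mathbb C[z]$, i.e. to the element $T_f\psi\in\mathbb C[z]$ with $(f\psi-T_f\psi,g)_\alpha=0$ for all $g\in\mathbb C[z]$ (with convergent sums). **Distributions.** Equip $\mathcal D$ with the weakest topology in which all $f\mapsto T(f)_{p,r}$ are continuous, and let $\mathcal D'$ be the completion of $\mathcal D$. The action of $U_q$ on $\mathcal D$ extends by continuity to $\mathcal D'$. For $\psi\in\mathcal D'$, $f\in\mathcal D$ let $\int\psi f\,d\nu$ be the limit of $\int\chi f\,d\nu$ as $\chi\to\psi$, $\chi\in\mathcal D$. **Covariant symbols.** For $A\in\mathrm{End}(\mathbb C[z]_\alpha)$ whose matrix in the basis $\{z^m\}$ has finitely many nonzero entries put $$\mathrm{Tr}_q(A)=q^{n(n+\alpha+1)}\frac{(q^2;q^2)_n}{(q^{2+2\alpha};q^2)_n}\,\mathrm{tr}\Bigl(A\,\pi_\alpha\Bigl(\prod_{j=1}^nK_j^{-j(n+1-j)}\Bigr)\Bigr).$$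 A distribution $\sigma(A)\in\mathcal D'$ is the covariant symbol of $A\in\mathrm{End}(\mathbb C[z]_\alpha)$ if $\int\sigma(A)f\,d\nu=\mathrm{Tr}_q(A\,T_f)$ for all $f\in\mathcal D$. **Proposition.** The action of $U_q$ on $\mathcal D$ extends to an action on $\mathcal D'$ by continuous linear maps. For every $f\in\mathcal F$ the operator $T_f$ exists and is unique, and every $A\in\mathrm{End}(\mathbb C[z]_\alpha)$ has a unique covariant symbol $\sigma(A)$; the maps $f\mapsto T_f$ and $A\mapsto\sigma(A)$ are linear. The maps $$\mathcal F\to\mathrm{End}(\mathbb C[z]_\alpha),\ f\mapsto T_f;\qquad \mathrm{End}(\mathbb C[z]_\alpha)\to\mathcal D',\ A\mapsto\sigma(A);\qquad \mathcal D\to\mathcal D',\ f\mapsto B(f)=\sigma(T_f)$$ (the Toeplitz map, the covariant symbol map and the $q$-Berezin transform) are morphisms of $U_q\mathfrak{su}_{n,1}$-modules: for all $\xi\in U_q$, $T_{\xi(f)}=\xi(T_f)$ for $f\in\mathcal F$, $\sigma(\xi(A))=\xi(\sigma(A))$ for $A\in\mathrm{End}(\mathbb C[z]_\alpha)$, and $B(\xi(f))=\xi(B(f))$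 for $f\in\mathcal D$. -/

import Mathlib

namespace QBall

open scoped TensorProduct

set_option linter.unusedSimpArgs false
set_option linter.unusedSectionVars false
set_option linter.unnecessarySeqFocus false

/-- The range of the deformation parameter: real numbers `q` with `0 < q < 1`. -/
abbrev QParam := Set.Ioo (0 : ℝ) 1

/-- The deformation parameter as a complex number. -/
noncomputable def qc (q : QParam) : ℂ := ((q : ℝ) : ℂ)

theorem qc_ne_zero (q : QParam) : qc q ≠ 0 := by
  have := q.2.1.ne'
  simpa [qc] using this

theorem one_sub_qc_sq_ne_zero (q : QParam) : 1 - qc q ^ 2 ≠ 0 := by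
  have h : (1 : ℝ) - (q : ℝ) ^ 2 ≠ 0 := by nlinarith [q.2.1, q.2.2]
  unfold qc
  exact_mod_cast h

theorem star_qc (q : QParam) : starRingEnd ℂ (qc q) = qc q := Complex.conj_ofReal _

/-! ### The Hopf algebra `U_q sl_{n+1}` -/

/-- Generators of `U_q sl_{n+1}`; `L i` stands for `K i ^ (-1)`. The index `i : Fin n`
corresponds to `i + 1` in the usual numbering `1, …, n`. -/
inductive UGen (n : ℕ)
  | E (i : Fin n)
  | F (i : Fin n)
  | K (i : Fin n)
  | L (i : Fin n)

/-- The nodes `i`, `j` of the Dynkin diagram `A_n` are adjacent. -/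
def Adj {n : ℕ} (i j : Fin n) : Prop := (i : ℕ) + 1 = j ∨ (j : ℕ) + 1 = i

open UGen FreeAlgebra in
/-- The defining relations of `U_q sl_{n+1}`. -/
inductive URel (n : ℕ) (q : QParam) :
    FreeAlgebra ℂ (UGen n) → FreeAlgebra ℂ (UGen n) → Prop
  | KK (i j) : URel n q (ι ℂ (K i) * ι ℂ (K j)) (ι ℂ (K j) * ι ℂ (K i))
  | KL (i) : URel n q (ι ℂ (K i) * ι ℂ (L i)) 1
  | LK (i) : URel n q (ι ℂ (L i) * ι ℂ (K i)) 1
  | KE (i j) : URel n q (ι ℂ (K i) * ι ℂ (E j))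
      (qc q ^ CartanMatrix.A n i j • (ι ℂ (E j) * ι ℂ (K i)))
  | KF (i j) : URel n q (ι ℂ (K i) * ι ℂ (F j))
      (qc q ^ (-CartanMatrix.A n i j) • (ι ℂ (F j) * ι ℂ (K i)))
  | EF (i) : URel n q (ι ℂ (E i) * ι ℂ (F i) - ι ℂ (F i) * ι ℂ (E i))
      ((qc q - (qc q)⁻¹)⁻¹ • (ι ℂ (K i) - ι ℂ (L i)))
  | EF' (i j) : i ≠ j → URel n q (ι ℂ (E i) * ι ℂ (F j) - ι ℂ (F j) * ι ℂ (E i)) 0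
  | SE (i j) : Adj i j → URel n q
      (ι ℂ (E i) * ι ℂ (E i) * ι ℂ (E j)
        - (qc q + (qc q)⁻¹) • (ι ℂ (E i) * ι ℂ (E j) * ι ℂ (E i))
        + ι ℂ (E j) * ι ℂ (E i) * ι ℂ (E i)) 0
  | SF (i j) : Adj i j → URel n q
      (ι ℂ (F i) * ι ℂ (F i) * ι ℂ (F j)
        - (qc q + (qc q)⁻¹) • (ι ℂ (F i) * ι ℂ (F j) * ι ℂ (F i))
        + ι ℂ (F j) * ι ℂ (F i) * ι ℂ (F i)) 0
  | EE (i j) : ¬ Adj i j → URel n q (ι ℂ (E i) * ι ℂ (E j)) (ι ℂ (E j) * ι ℂ (E i))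
  | FF (i j) : ¬ Adj i j → URel n q (ι ℂ (F i) * ι ℂ (F j)) (ι ℂ (F j) * ι ℂ (F i))

/-- The quantum universal enveloping algebra `U_q sl_{n+1}` (with its standard `*`-structure
it is denoted by `U_q su_{n,1}`; a `U_q su_{n,1}`-module is a module over this algebra). -/
abbrev Uq (n : ℕ) (q : QParam) := RingQuot (URel n q)

/-- The class of a generator in `U_q sl_{n+1}`. -/
noncomputable def Uq.gen {n : ℕ} (q : QParam) (x : UGen n) : Uq n q :=
  RingQuot.mkAlgHom ℂ (URel n q) (FreeAlgebra.ι ℂ x)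

/-- The elements `E i`, `F i`, `K i`, `L i` of an algebra satisfy the defining relations. -/
structure URelations {n : ℕ} (q : QParam) {A : Type*} [Ring A] [Algebra ℂ A]
    (E F K L : Fin n → A) : Prop where
  KK : ∀ i j, K i * K j = K j * K i
  KL : ∀ i, K i * L i = 1
  LK : ∀ i, L i * K i = 1
  KE : ∀ i j, K i * E j = qc q ^ CartanMatrix.A n i j • (E j * K i)
  KF : ∀ i j, K i * F j = qc q ^ (-CartanMatrix.A n i j) • (F j * K i)
  EF : ∀ i, E i * F i - F i * E i = (qc q - (qc q)⁻¹)⁻¹ • (K i - L i)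
  EF' : ∀ i j, i ≠ j → E i * F j - F j * E i = 0
  SE : ∀ i j, Adj i j →
    E i * E i * E j - (qc q + (qc q)⁻¹) • (E i * E j * E i) + E j * E i * E i = 0
  SF : ∀ i j, Adj i j →
    F i * F i * F j - (qc q + (qc q)⁻¹) • (F i * F j * F i) + F j * F i * F i = 0
  EE : ∀ i j, ¬ Adj i j → E i * E j = E j * E i
  FF : ∀ i j, ¬ Adj i j → F i * F j = F j * F i

/-- The assignment of values to generators given by four families. -/
def UGen.elim {n : ℕ} {A : Type*} (E F K L : Fin n → A) : UGen n → A
  | .E i => E i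
  | .F i => F i
  | .K i => K i
  | .L i => L i

/-- The homomorphism from `U_q sl_{n+1}` with prescribed values on generators. -/
noncomputable def Uq.lift {n : ℕ} {q : QParam} {A : Type*} [Ring A] [Algebra ℂ A]
    {E F K L : Fin n → A} (h : URelations q E F K L) : Uq n q →ₐ[ℂ] A :=
  RingQuot.liftAlgHom ℂ ⟨FreeAlgebra.lift ℂ (UGen.elim E F K L), by
    intro x y hxy
    cases hxy <;> simp only [map_mul, map_sub, map_add, map_smul, map_one, map_zero,
      FreeAlgebra.lift_ι_apply, UGen.elim]
    · exact h.KK _ _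
    · exact h.KL _
    · exact h.LK _
    · exact h.KE _ _
    · exact h.KF _ _
    · exact h.EF _
    · exact h.EF' _ _ ‹_›
    · exact h.SE _ _ ‹_›
    · exact h.SF _ _ ‹_›
    · exact h.EE _ _ ‹_›
    · exact h.FF _ _ ‹_›⟩

theorem Uq.lift_gen {n : ℕ} {q : QParam} {A : Type*} [Ring A] [Algebra ℂ A]
    {E F K L : Fin n → A} (h : URelations q E F K L) (x : UGen n) :
    Uq.lift h (Uq.gen q x) = UGen.elim E F K L x := by
  simp [Uq.lift, Uq.gen]

/-- The generators of `U_q sl_{n+1}` satisfy the defining relations. -/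
theorem Uq.relations (n : ℕ) (q : QParam) :
    URelations q (fun i : Fin n => gen q (.E i)) (fun i => gen q (.F i))
      (fun i => gen q (.K i)) (fun i => gen q (.L i)) := by
  have key := fun {x y} (h : URel n q x y) => RingQuot.mkAlgHom_rel ℂ h
  constructor <;> intros <;> simp only [Uq.gen, ← map_mul, ← map_smul, ← map_sub, ← map_add]
  · exact key (.KK _ _)
  · rw [key (.KL _), map_one]
  · rw [key (.LK _), map_one]
  · exact key (.KE _ _)
  · exact key (.KF _ _)
  · exact key (.EF _)
  · rw [key (.EF' _ _ ‹_›), map_zero]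
  · rw [key (.SE _ _ ‹_›), map_zero]
  · rw [key (.SF _ _ ‹_›), map_zero]
  · exact key (.EE _ _ ‹_›)
  · exact key (.FF _ _ ‹_›)

section aux
variable {n : ℕ} {q : QParam} {A : Type*} [Ring A] [Algebra ℂ A] {E F K L : Fin n → A}

theorem URelations.LE (h : URelations q E F K L) (i j : Fin n) :
    L i * E j = qc q ^ (-CartanMatrix.A n i j) • (E j * L i) := by
  have h1 : L i * (K i * E j) * L i = E j * L i := by
    rw [← mul_assoc, h.LK, one_mul]
  rw [h.KE, mul_smul_comm, smul_mul_assoc, mul_assoc, mul_assoc, h.KL, mul_one] at h1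
  rw [← h1, smul_smul, ← zpow_add₀ (qc_ne_zero q)]
  simp

theorem URelations.LF (h : URelations q E F K L) (i j : Fin n) :
    L i * F j = qc q ^ (CartanMatrix.A n i j) • (F j * L i) := by
  have h1 : L i * (K i * F j) * L i = F j * L i := by
    rw [← mul_assoc, h.LK, one_mul]
  rw [h.KF, mul_smul_comm, smul_mul_assoc, mul_assoc, mul_assoc, h.KL, mul_one] at h1
  rw [← h1, smul_smul, ← zpow_add₀ (qc_ne_zero q)]
  simp

theorem URelations.KL' (h : URelations q E F K L) (i j : Fin n) :
    L i * K j = K j * L i := by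
  have : L i * (K i * K j) * L i = K j * L i := by rw [← mul_assoc, h.LK, one_mul]
  rw [← this, h.KK, mul_assoc, mul_assoc, h.KL, mul_one]

theorem URelations.LL (h : URelations q E F K L) (i j : Fin n) :
    L i * L j = L j * L i := by
  have : L i * (L j * K i) * L i = L j * L i := by
    rw [h.KL', ← mul_assoc, h.LK, one_mul]
  rw [← this, mul_assoc, mul_assoc, h.KL, mul_one]

end aux

theorem cartan_self {n : ℕ} (i : Fin n) : CartanMatrix.A n i i = 2 := by
  simp [CartanMatrix.A]

theorem cartan_adj {n : ℕ} {i j : Fin n} (h : Adj i j) : CartanMatrix.A n i j = -1 := by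
  have : i ≠ j := by rintro rfl; simp [Adj] at h
  simp only [CartanMatrix.A, Matrix.of_apply, if_neg this]
  exact if_pos h

theorem cartan_symm {n : ℕ} (i j : Fin n) :
    CartanMatrix.A n i j = CartanMatrix.A n j i := by
  simp only [CartanMatrix.A, Matrix.of_apply, eq_comm (a := i), or_comm]

theorem Adj.symm {n : ℕ} {i j : Fin n} (h : Adj i j) : Adj j i := Or.symm h

/-- The relations for the values of the comultiplication on the generators. -/
theorem URelations.tmul {n : ℕ} {q : QParam} {A : Type*} [Ring A] [Algebra ℂ A]
    {E F K L : Fin n → A} (h : URelations q E F K L) :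
    URelations (A := A ⊗[ℂ] A) q
      (fun i => E i ⊗ₜ 1 + K i ⊗ₜ E i) (fun i => F i ⊗ₜ L i + 1 ⊗ₜ F i)
      (fun i => K i ⊗ₜ K i) (fun i => L i ⊗ₜ L i) := by
  have hq := qc_ne_zero q
  have hKE2 : ∀ i, K i * E i = (qc q * qc q) • (E i * K i) := fun i => by
    rw [h.KE, cartan_self, zpow_two]
  have hLF2 : ∀ i, L i * F i = (qc q * qc q) • (F i * L i) := fun i => by
    rw [h.LF, cartan_self, zpow_two]
  have hKE1 : ∀ {i j}, Adj i j → K i * E j = (qc q)⁻¹ • (E j * K i) := fun {i j} a => by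
    rw [h.KE, cartan_adj a, zpow_neg_one]
  have hLF1 : ∀ {i j}, Adj i j → L i * F j = (qc q)⁻¹ • (F j * L i) := fun {i j} a => by
    rw [h.LF, cartan_adj a, zpow_neg_one]
  have asc : ∀ {x y z w : A} {c : ℂ}, x * y = c • (z * w) →
      ∀ t, x * (y * t) = c • (z * (w * t)) := fun {x y z w c} e t => by
    rw [← mul_assoc, e, smul_mul_assoc, mul_assoc]
  have asc' : ∀ {x y z w : A}, x * y = z * w →
      ∀ t, x * (y * t) = z * (w * t) := fun {x y z w} e t => by
    rw [← mul_assoc, e, mul_assoc]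
  constructor
  · intro i j; simp only [Algebra.TensorProduct.tmul_mul_tmul, h.KK i j]
  · intro i; simp only [Algebra.TensorProduct.tmul_mul_tmul, h.KL i]; rfl
  · intro i; simp only [Algebra.TensorProduct.tmul_mul_tmul, h.LK i]; rfl
  · intro i j
    simp only [mul_add, add_mul, Algebra.TensorProduct.tmul_mul_tmul, h.KE i j, h.KK i j, one_mul,
      mul_one, smul_add, TensorProduct.tmul_smul, TensorProduct.smul_tmul']
  · intro i j
    simp only [mul_add, add_mul, Algebra.TensorProduct.tmul_mul_tmul, h.KF i j, h.KL' j i, one_mul,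
      mul_one, smul_add, TensorProduct.tmul_smul, TensorProduct.smul_tmul']
  · intro i
    have e1 : E i * F i = F i * E i + (qc q - (qc q)⁻¹)⁻¹ • (K i - L i) := by
      rw [← h.EF]; abel
    have e2 : K i * F i = (qc q * qc q)⁻¹ • (F i * K i) := by
      rw [h.KF, cartan_self, zpow_neg, zpow_two]
    have e3 : L i * E i = (qc q * qc q)⁻¹ • (E i * L i) := by
      rw [h.LE, cartan_self, zpow_neg, zpow_two]
    simp only [mul_add, add_mul, Algebra.TensorProduct.tmul_mul_tmul, e1, e2, e3, one_mul,
      mul_one, TensorProduct.tmul_add, TensorProduct.add_tmul, TensorProduct.tmul_sub,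
      TensorProduct.sub_tmul, ← TensorProduct.smul_tmul', TensorProduct.tmul_smul]
    module
  · intro i j hij
    have e1 : E i * F j = F j * E i := by
      rw [← sub_eq_zero]; exact h.EF' i j hij
    have e2 : K i * F j = _ := h.KF i j
    have e3 : L j * E i = _ := h.LE j i
    rw [cartan_symm j i] at e3
    simp only [mul_add, add_mul, Algebra.TensorProduct.tmul_mul_tmul, e1, e2, e3, one_mul,
      mul_one, ← TensorProduct.smul_tmul', TensorProduct.tmul_smul]
    module
  · intro i j a
    have s : E i * (E i * E j) = (qc q + (qc q)⁻¹) • (E i * (E j * E i)) - E j * (E i * E i) := by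
      rw [eq_sub_iff_add_eq, ← sub_eq_zero, ← h.SE i j a]; simp only [mul_assoc]; abel
    have k1 := hKE2 i
    have k2 := hKE1 a
    have k3 := hKE1 a.symm
    have k4 := h.KK j i
    simp only [mul_add, add_mul, mul_assoc, Algebra.TensorProduct.tmul_mul_tmul, one_mul, mul_one,
      k1, k2, k3, k4, asc k1, asc k2, asc k3, asc' k4, s,
      smul_mul_assoc, mul_smul_comm, smul_smul, smul_add, smul_sub,
      TensorProduct.tmul_add, TensorProduct.add_tmul, TensorProduct.tmul_sub,
      TensorProduct.sub_tmul, ← TensorProduct.smul_tmul', TensorProduct.tmul_smul]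
    match_scalars <;> field_simp <;> ring
  · intro i j a
    have s : F i * (F i * F j) = (qc q + (qc q)⁻¹) • (F i * (F j * F i)) - F j * (F i * F i) := by
      rw [eq_sub_iff_add_eq, ← sub_eq_zero, ← h.SF i j a]; simp only [mul_assoc]; abel
    have k1 := hLF2 i
    have k2 := hLF1 a
    have k3 := hLF1 a.symm
    have k4 := h.LL j i
    simp only [mul_add, add_mul, mul_assoc, Algebra.TensorProduct.tmul_mul_tmul, one_mul, mul_one,
      k1, k2, k3, k4, asc k1, asc k2, asc k3, asc' k4, s,
      smul_mul_assoc, mul_smul_comm, smul_smul, smul_add, smul_sub,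
      TensorProduct.tmul_add, TensorProduct.add_tmul, TensorProduct.tmul_sub,
      TensorProduct.sub_tmul, ← TensorProduct.smul_tmul', TensorProduct.tmul_smul]
    match_scalars <;> field_simp <;> ring
  · intro i j a
    by_cases hij : i = j
    · rw [hij]
    have a0 : CartanMatrix.A n i j = 0 := by
      simp only [CartanMatrix.A, Matrix.of_apply, if_neg hij]; exact if_neg a
    have k1 : K i * E j = E j * K i := by rw [h.KE, a0]; simp
    have k2 : K j * E i = E i * K j := by rw [h.KE, cartan_symm, a0]; simp
    simp only [mul_add, add_mul, Algebra.TensorProduct.tmul_mul_tmul, one_mul, mul_one,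
      k1, k2, h.EE i j a, h.KK i j]
    abel
  · intro i j a
    by_cases hij : i = j
    · rw [hij]
    have a0 : CartanMatrix.A n i j = 0 := by
      simp only [CartanMatrix.A, Matrix.of_apply, if_neg hij]; exact if_neg a
    have k1 : L i * F j = F j * L i := by rw [h.LF, a0]; simp
    have k2 : L j * F i = F i * L j := by rw [h.LF, cartan_symm, a0]; simp
    simp only [mul_add, add_mul, Algebra.TensorProduct.tmul_mul_tmul, one_mul, mul_one,
      k1, k2, h.FF i j a, h.LL i j]
    abel

/-- The comultiplication of `U_q sl_{n+1}`. -/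
noncomputable def Uq.comul (n : ℕ) (q : QParam) : Uq n q →ₐ[ℂ] Uq n q ⊗[ℂ] Uq n q :=
  Uq.lift (Uq.relations n q).tmul

/-- The relations for the values of the antipode on the generators. -/
theorem URelations.op {n : ℕ} {q : QParam} {A : Type*} [Ring A] [Algebra ℂ A]
    {E F K L : Fin n → A} (h : URelations q E F K L) :
    URelations (A := Aᵐᵒᵖ) q
      (fun i => MulOpposite.op (-(L i * E i))) (fun i => MulOpposite.op (-(F i * K i)))
      (fun i => MulOpposite.op (L i)) (fun i => MulOpposite.op (K i)) := by
  have hq := qc_ne_zero q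
  have asc : ∀ {x y z w : A} {c : ℂ}, x * y = c • (z * w) →
      ∀ t, x * (y * t) = c • (z * (w * t)) := fun {x y z w c} e t => by
    rw [← mul_assoc, e, smul_mul_assoc, mul_assoc]
  have asc' : ∀ {x y z w : A}, x * y = z * w →
      ∀ t, x * (y * t) = z * (w * t) := fun {x y z w} e t => by
    rw [← mul_assoc, e, mul_assoc]
  have asc1 : ∀ {x y : A}, x * y = 1 → ∀ t, x * (y * t) = t := fun {x y} e t => by
    rw [← mul_assoc, e, one_mul]
  constructor
  · intro i j; rw [← MulOpposite.op_mul, ← MulOpposite.op_mul, h.LL]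
  · intro i; rw [← MulOpposite.op_mul, h.KL]; rfl
  · intro i; rw [← MulOpposite.op_mul, h.LK]; rfl
  · intro i j
    have k1 := h.LE i j
    have : E j * L i = qc q ^ CartanMatrix.A n i j • (L i * E j) := by
      rw [k1, smul_smul, ← zpow_add₀ hq]; simp
    refine MulOpposite.unop_injective ?_
    simp only [MulOpposite.unop_mul, MulOpposite.unop_op, MulOpposite.unop_sub, MulOpposite.unop_add,
      MulOpposite.unop_smul, MulOpposite.unop_zero]
    simp only [neg_mul, mul_neg, mul_assoc, this, mul_smul_comm, smul_neg, asc' (h.LL j i)]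
  · intro i j
    have k1 := h.LF i j
    refine MulOpposite.unop_injective ?_
    simp only [MulOpposite.unop_mul, MulOpposite.unop_op, MulOpposite.unop_sub, MulOpposite.unop_add,
      MulOpposite.unop_smul, MulOpposite.unop_zero]
    simp only [neg_mul, mul_neg, mul_assoc, asc k1, smul_neg, smul_smul, ← zpow_add₀ hq,
      neg_add_cancel, zpow_zero, one_smul, h.KL' i j]
  · intro i
    refine MulOpposite.unop_injective ?_
    simp only [MulOpposite.unop_mul, MulOpposite.unop_op, MulOpposite.unop_sub, MulOpposite.unop_add,
      MulOpposite.unop_smul, MulOpposite.unop_zero]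
    have e1 : E i * F i = F i * E i + (qc q - (qc q)⁻¹)⁻¹ • (K i - L i) := by
      rw [← h.EF]; abel
    have l1 := h.LE i i
    have l2 := h.LF i i
    have l3 := h.KL' i i
    have e1' : ∀ t, E i * (F i * t) = F i * (E i * t) + (qc q - (qc q)⁻¹)⁻¹ • (K i * t - L i * t) := by
      intro t
      rw [← mul_assoc, e1, add_mul, smul_mul_assoc, sub_mul, mul_assoc]
    simp only [neg_mul, mul_neg, mul_assoc, neg_neg, asc1 (h.KL i), e1', mul_add, mul_sub,
      mul_smul_comm, h.KL, h.LK, mul_one, asc l1, asc l2, asc1 (h.LK i), smul_smul, ← zpow_add₀ hq,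
      neg_add_cancel, add_neg_cancel, zpow_zero, one_smul]
    module
  · intro i j hij
    refine MulOpposite.unop_injective ?_
    simp only [MulOpposite.unop_mul, MulOpposite.unop_op, MulOpposite.unop_sub, MulOpposite.unop_add,
      MulOpposite.unop_smul, MulOpposite.unop_zero]
    have e1 : E i * F j = F j * E i := by
      rw [← sub_eq_zero]; exact h.EF' i j hij
    have k1 := h.LF i j
    have k2 := h.KE j i
    have k3 := h.KL' i j
    rw [cartan_symm j i] at k2
    simp only [neg_mul, mul_neg, mul_assoc, neg_neg, asc' e1, asc k1, asc' k3.symm, k2, mul_smul_comm,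
      sub_self]
  · intro i j a
    have s : E i * (E i * E j) = (qc q + (qc q)⁻¹) • (E i * (E j * E i)) - E j * (E i * E i) := by
      rw [eq_sub_iff_add_eq, ← sub_eq_zero, ← h.SE i j a]; simp only [mul_assoc]; abel
    have s' : ∀ t, E i * (E i * (E j * t)) =
        (qc q + (qc q)⁻¹) • (E i * (E j * (E i * t))) - E j * (E i * (E i * t)) := by
      intro t
      have := congrArg (· * t) s
      simpa only [mul_assoc, sub_mul, smul_mul_assoc] using this
    have k1 := h.LE i i
    have k2 := h.LE i j
    have k3 := h.LE j i
    have k5 := h.LE j j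
    rw [cartan_self, zpow_neg, zpow_two] at k1 k5
    rw [cartan_adj a, neg_neg, zpow_one] at k2
    rw [cartan_adj a.symm, neg_neg, zpow_one] at k3
    have k4 := h.LL j i
    refine MulOpposite.unop_injective ?_
    simp only [MulOpposite.unop_mul, MulOpposite.unop_op, MulOpposite.unop_sub, MulOpposite.unop_add,
      MulOpposite.unop_smul, MulOpposite.unop_zero]
    simp only [neg_mul, mul_neg, neg_neg, mul_assoc, k1, k2, k3, k4, k5, asc k1, asc k2, asc k3,
      asc k5, asc' k4, s', smul_mul_assoc, mul_smul_comm, smul_smul, smul_neg, mul_sub, smul_sub]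
    match_scalars <;> field_simp <;> ring
  · intro i j a
    have s : F i * (F i * F j) = (qc q + (qc q)⁻¹) • (F i * (F j * F i)) - F j * (F i * F i) := by
      rw [eq_sub_iff_add_eq, ← sub_eq_zero, ← h.SF i j a]; simp only [mul_assoc]; abel
    have s' : ∀ t, F i * (F i * (F j * t)) =
        (qc q + (qc q)⁻¹) • (F i * (F j * (F i * t))) - F j * (F i * (F i * t)) := by
      intro t
      have := congrArg (· * t) s
      simpa only [mul_assoc, sub_mul, smul_mul_assoc] using this
    have k1 := h.KF i i
    have k2 := h.KF i j
    have k3 := h.KF j i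
    rw [cartan_self, zpow_neg, zpow_two] at k1
    rw [cartan_adj a, neg_neg, zpow_one] at k2
    rw [cartan_adj a.symm, neg_neg, zpow_one] at k3
    have k4 := h.KK j i
    refine MulOpposite.unop_injective ?_
    simp only [MulOpposite.unop_mul, MulOpposite.unop_op, MulOpposite.unop_sub, MulOpposite.unop_add,
      MulOpposite.unop_smul, MulOpposite.unop_zero]
    simp only [neg_mul, mul_neg, neg_neg, mul_assoc, k1, k2, k3, k4, asc k1, asc k2, asc k3,
      asc' k4, s', smul_mul_assoc, mul_smul_comm, smul_smul, smul_neg, mul_sub, smul_sub]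
    match_scalars <;> field_simp <;> ring
  · intro i j a
    by_cases hij : i = j
    · rw [hij]
    have a0 : CartanMatrix.A n i j = 0 := by
      simp only [CartanMatrix.A, Matrix.of_apply, if_neg hij]; exact if_neg a
    have k1 : L i * E j = E j * L i := by rw [h.LE, a0]; simp
    have k2 : L j * E i = E i * L j := by rw [h.LE, cartan_symm, a0]; simp
    refine MulOpposite.unop_injective ?_
    simp only [MulOpposite.unop_mul, MulOpposite.unop_op, MulOpposite.unop_sub, MulOpposite.unop_add,
      MulOpposite.unop_smul, MulOpposite.unop_zero]
    simp only [neg_mul, mul_neg, neg_neg, mul_assoc, asc' k1.symm, asc' k2.symm, h.EE i j a,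
      asc' (h.LL j i)]
  · intro i j a
    by_cases hij : i = j
    · rw [hij]
    have a0 : CartanMatrix.A n i j = 0 := by
      simp only [CartanMatrix.A, Matrix.of_apply, if_neg hij]; exact if_neg a
    have k1 : K i * F j = F j * K i := by rw [h.KF, a0]; simp
    have k2 : K j * F i = F i * K j := by rw [h.KF, cartan_symm, a0]; simp
    refine MulOpposite.unop_injective ?_
    simp only [MulOpposite.unop_mul, MulOpposite.unop_op, MulOpposite.unop_sub, MulOpposite.unop_add,
      MulOpposite.unop_smul, MulOpposite.unop_zero]
    simp only [neg_mul, mul_neg, neg_neg, mul_assoc, asc' k1, asc' k2, h.KK i j,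
      asc' (h.FF i j a)]

/-- The antipode of `U_q sl_{n+1}`, as a homomorphism to the opposite algebra. -/
noncomputable def Uq.antipode (n : ℕ) (q : QParam) : Uq n q →ₐ[ℂ] (Uq n q)ᵐᵒᵖ :=
  Uq.lift (Uq.relations n q).op

/-- The canonical action of `U_q sl_{n+1}` on `End V`, for a representation `ρ` in `V`:
`ξ(T) = ∑ ρ(ξ') T ρ(S(ξ''))`, where `Δ(ξ) = ∑ ξ' ⊗ ξ''`. -/
noncomputable def Uq.endAction {n : ℕ} {q : QParam} {V : Type*} [AddCommGroup V] [Module ℂ V]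
    (ρ : Uq n q →ₐ[ℂ] Module.End ℂ V) : Uq n q →ₗ[ℂ] Module.End ℂ (Module.End ℂ V) :=
  (TensorProduct.lift
    (((LinearMap.mul ℂ (Module.End ℂ (Module.End ℂ V))).compl₁₂
      ((LinearMap.mul ℂ (Module.End ℂ V)).comp ρ.toLinearMap))
      ((LinearMap.mul ℂ (Module.End ℂ V)).flip.comp
        (ρ.toLinearMap.comp ((MulOpposite.opLinearEquiv ℂ).symm.toLinearMap.comp
          (Uq.antipode n q).toLinearMap))))).comp (Uq.comul n q).toLinearMap

/-! ### The algebra `F(U_n)_q` and its involution -/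

/-- Generators of `F(U_n)_q`: `z i`, `zs i = (z i)^*` and the distinguished element `f0`. -/
inductive FGen (n : ℕ)
  | z (i : Fin n)
  | zs (i : Fin n)
  | f0

open FGen FreeAlgebra in
/-- The defining relations of the involutive algebra `F(U_n)_q` (the relations for `z i`, the
commutation relations of `zs i` with `z j`, the adjoint relations for `zs i`, and the relations
for `f0`). -/
inductive FRel (n : ℕ) (q : QParam) :
    FreeAlgebra ℂ (FGen n) → FreeAlgebra ℂ (FGen n) → Prop
  | zz (i j) : i < j → FRel n q (ι ℂ (z i) * ι ℂ (z j)) (qc q • (ι ℂ (z j) * ι ℂ (z i)))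
  | ss (i j) : i < j → FRel n q (ι ℂ (zs j) * ι ℂ (zs i)) (qc q • (ι ℂ (zs i) * ι ℂ (zs j)))
  | sz (i j) : i ≠ j → FRel n q (ι ℂ (zs i) * ι ℂ (z j)) (qc q • (ι ℂ (z j) * ι ℂ (zs i)))
  | sz' (j) : FRel n q (ι ℂ (zs j) * ι ℂ (z j))
      (qc q ^ 2 • (ι ℂ (z j) * ι ℂ (zs j))
        + (1 - qc q ^ 2) • (1 - ∑ k ∈ Finset.Ioi j, ι ℂ (z k) * ι ℂ (zs k)))
  | ff : FRel n q (ι ℂ f0 * ι ℂ f0) (ι ℂ f0)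
  | sf (i) : FRel n q (ι ℂ (zs i) * ι ℂ f0) 0
  | fz (i) : FRel n q (ι ℂ f0 * ι ℂ (z i)) 0

/-- The algebra `F(U_n)_q`. -/
abbrev BallAlg (n : ℕ) (q : QParam) := RingQuot (FRel n q)

/-- The class of a generator in `F(U_n)_q`. -/
noncomputable def BallAlg.gen {n : ℕ} (q : QParam) (x : FGen n) : BallAlg n q :=
  RingQuot.mkAlgHom ℂ (FRel n q) (FreeAlgebra.ι ℂ x)

/-- The elements `z i`, `zs i`, `f0` of an algebra satisfy the defining relations. -/
structure FRelations {n : ℕ} (q : QParam) {A : Type*} [Ring A] [Algebra ℂ A]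
    (z zs : Fin n → A) (f0 : A) : Prop where
  zz : ∀ i j, i < j → z i * z j = qc q • (z j * z i)
  ss : ∀ i j, i < j → zs j * zs i = qc q • (zs i * zs j)
  sz : ∀ i j, i ≠ j → zs i * z j = qc q • (z j * zs i)
  sz' : ∀ j, zs j * z j = qc q ^ 2 • (z j * zs j)
    + (1 - qc q ^ 2) • (1 - ∑ k ∈ Finset.Ioi j, z k * zs k)
  ff : f0 * f0 = f0
  sf : ∀ i, zs i * f0 = 0
  fz : ∀ i, f0 * z i = 0

/-- The assignment of values to generators. -/
def FGen.elim {n : ℕ} {A : Type*} (z zs : Fin n → A) (f0 : A) : FGen n → A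
  | .z i => z i
  | .zs i => zs i
  | .f0 => f0

/-- The homomorphism from `F(U_n)_q` with prescribed values on generators. -/
noncomputable def BallAlg.lift {n : ℕ} {q : QParam} {A : Type*} [Ring A] [Algebra ℂ A]
    {z zs : Fin n → A} {f0 : A} (h : FRelations q z zs f0) : BallAlg n q →ₐ[ℂ] A :=
  RingQuot.liftAlgHom ℂ ⟨FreeAlgebra.lift ℂ (FGen.elim z zs f0), by
    intro x y hxy
    cases hxy <;> simp only [map_mul, map_sub, map_add, map_smul, map_one, map_zero, map_sum,
      FreeAlgebra.lift_ι_apply, FGen.elim]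
    · exact h.zz _ _ ‹_›
    · exact h.ss _ _ ‹_›
    · exact h.sz _ _ ‹_›
    · exact h.sz' _
    · exact h.ff
    · exact h.sf _
    · exact h.fz _⟩

theorem BallAlg.lift_gen {n : ℕ} {q : QParam} {A : Type*} [Ring A] [Algebra ℂ A]
    {z zs : Fin n → A} {f0 : A} (h : FRelations q z zs f0) (x : FGen n) :
    BallAlg.lift h (BallAlg.gen q x) = FGen.elim z zs f0 x := by
  simp [BallAlg.lift, BallAlg.gen]

theorem BallAlg.relations (n : ℕ) (q : QParam) :
    FRelations q (fun i : Fin n => gen q (.z i)) (fun i => gen q (.zs i)) (gen q .f0) := by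
  have key := fun {x y} (h : FRel n q x y) => RingQuot.mkAlgHom_rel ℂ h
  constructor <;> intros <;>
    simp only [BallAlg.gen, ← map_mul, ← map_smul, ← map_sub, ← map_add, ← map_sum]
  · exact key (.zz _ _ ‹_›)
  · exact key (.ss _ _ ‹_›)
  · exact key (.sz _ _ ‹_›)
  · rw [key (.sz' _)]; simp only [map_add, map_smul, map_sub, map_one]
  · exact key .ff
  · rw [key (.sf _), map_zero]
  · rw [key (.fz _), map_zero]

theorem BallAlg.induction {n : ℕ} {q : QParam} {P : BallAlg n q → Prop}
    (hgen : ∀ x, P (BallAlg.gen q x)) (hc : ∀ c : ℂ, P (algebraMap ℂ _ c))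
    (hadd : ∀ x y, P x → P y → P (x + y)) (hmul : ∀ x y, P x → P y → P (x * y))
    (x : BallAlg n q) : P x := by
  obtain ⟨y, rfl⟩ := RingQuot.mkAlgHom_surjective ℂ (FRel n q) x
  induction y using FreeAlgebra.induction with
  | grade0 c => rw [AlgHom.commutes]; exact hc c
  | grade1 x => exact hgen x
  | mul a b ha hb => rw [map_mul]; exact hmul _ _ ha hb
  | add a b ha hb => rw [map_add]; exact hadd _ _ ha hb

/-- The opposite algebra with the complex conjugate action of scalars: a conjugate linear
antihomomorphism to `A` is the same as a homomorphism to `ConjOp A`. -/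
def ConjOp (A : Type*) := Aᵐᵒᵖ

noncomputable instance (A : Type*) [Ring A] : Ring (ConjOp A) := inferInstanceAs (Ring Aᵐᵒᵖ)

noncomputable instance (A : Type*) [Ring A] [Algebra ℂ A] : Algebra ℂ (ConjOp A) :=
  RingHom.toAlgebra' ((algebraMap ℂ Aᵐᵒᵖ).comp (starRingEnd ℂ)) fun c x =>
    Algebra.commutes (A := Aᵐᵒᵖ) (starRingEnd ℂ c) x

/-- An element of `A` as an element of `ConjOp A`. -/
def ConjOp.mk {A : Type*} (x : A) : ConjOp A := (MulOpposite.op x : Aᵐᵒᵖ)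

/-- An element of `ConjOp A` as an element of `A`. -/
def ConjOp.out {A : Type*} (x : ConjOp A) : A := MulOpposite.unop (show Aᵐᵒᵖ from x)

section
variable {A : Type*} [Ring A] [Algebra ℂ A]

theorem ConjOp.mk_mul (a b : A) : mk (a * b) = mk b * mk a := rfl

theorem ConjOp.mk_add (a b : A) : mk (a + b) = mk a + mk b := rfl

theorem ConjOp.mk_sub (a b : A) : mk (a - b) = mk a - mk b := rfl

theorem ConjOp.mk_one : mk (1 : A) = 1 := rfl

theorem ConjOp.mk_zero : mk (0 : A) = 0 := rfl

theorem ConjOp.mk_sum {ι : Type*} (s : Finset ι) (g : ι → A) :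
    mk (∑ k ∈ s, g k) = ∑ k ∈ s, mk (g k) :=
  map_sum (AddMonoidHom.mk' (ConjOp.mk (A := A)) fun _ _ => rfl) g s

theorem ConjOp.mk_smul (c : ℂ) (x : A) : mk (c • x) = starRingEnd ℂ c • mk x := by
  rw [Algebra.smul_def c x, Algebra.commutes, mk_mul, Algebra.smul_def]
  congr 1
  change mk (algebraMap ℂ A c) = mk (algebraMap ℂ A (starRingEnd ℂ (starRingEnd ℂ c)))
  rw [Complex.conj_conj]

end

/-- The values of the involution on the generators satisfy the defining relations. -/
theorem BallAlg.star_relations (n : ℕ) (q : QParam) :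
    FRelations (A := ConjOp (BallAlg n q)) q (fun i => .mk (gen q (.zs i)))
      (fun i => .mk (gen q (.z i))) (.mk (gen q .f0)) := by
  have h := BallAlg.relations n q
  have hcq := star_qc q
  constructor
  · intro i j hij
    rw [← ConjOp.mk_mul, ← ConjOp.mk_mul, h.ss i j hij, ConjOp.mk_smul, hcq]
  · intro i j hij
    rw [← ConjOp.mk_mul, ← ConjOp.mk_mul, h.zz i j hij, ConjOp.mk_smul, hcq]
  · intro i j hij
    rw [← ConjOp.mk_mul, ← ConjOp.mk_mul, h.sz j i hij.symm, ConjOp.mk_smul, hcq]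
  · intro j
    rw [← ConjOp.mk_mul, h.sz' j]
    simp only [ConjOp.mk_add, ConjOp.mk_smul, ConjOp.mk_mul, ConjOp.mk_sub, ConjOp.mk_one,
      ConjOp.mk_sum, map_sub, map_pow, map_one, hcq]
  · rw [← ConjOp.mk_mul, h.ff]
  · intro i; rw [← ConjOp.mk_mul, h.fz, ConjOp.mk_zero]
  · intro i; rw [← ConjOp.mk_mul, h.sf, ConjOp.mk_zero]

/-- The involution of `F(U_n)_q` as a homomorphism. -/
noncomputable def BallAlg.starHom (n : ℕ) (q : QParam) :
    BallAlg n q →ₐ[ℂ] ConjOp (BallAlg n q) :=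
  BallAlg.lift (BallAlg.star_relations n q)

/-- The involution of `F(U_n)_q`: the conjugate linear antiautomorphism with
`(z i)^* = zs i` and `f0^* = f0`. -/
noncomputable def BallAlg.conj {n : ℕ} {q : QParam} (x : BallAlg n q) : BallAlg n q :=
  (BallAlg.starHom n q x).out

namespace BallAlg
variable {n : ℕ} {q : QParam}

theorem conj_gen (x : FGen n) : conj (gen q x) =
    FGen.elim (fun i => gen q (.zs i)) (fun i => gen q (.z i)) (gen q .f0) x := by
  unfold conj starHom
  rw [lift_gen]
  cases x <;> rfl

theorem conj_add (x y : BallAlg n q) : conj (x + y) = conj x + conj y := by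
  unfold conj; rw [map_add]; rfl

theorem conj_mul (x y : BallAlg n q) : conj (x * y) = conj y * conj x := by
  unfold conj; rw [map_mul]; rfl

theorem conj_smul (c : ℂ) (x : BallAlg n q) :
    conj (c • x) = starRingEnd ℂ c • conj x := by
  have := ConjOp.mk_smul (starRingEnd ℂ c) (conj x)
  rw [Complex.conj_conj] at this
  unfold conj; rw [map_smul]
  exact (congrArg ConjOp.out this).symm

theorem conj_one : conj (1 : BallAlg n q) = 1 := by
  unfold conj; rw [map_one]; rfl

theorem conj_conj (x : BallAlg n q) : conj (conj x) = x := by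
  induction x using BallAlg.induction with
  | hgen x => cases x <;> simp only [conj_gen, FGen.elim]
  | hc c => simp only [Algebra.algebraMap_eq_smul_one, conj_smul, conj_one, Complex.conj_conj]
  | hadd x y hx hy => rw [conj_add, conj_add, hx, hy]
  | hmul x y hx hy => rw [conj_mul, conj_mul, hx, hy]

end BallAlg

/-! ### The action of the generators on `F(U_n)_q` -/

/-- `K k z i = q ^ (wt k i) z i`. -/
def wt {n : ℕ} (k i : Fin n) : ℤ :=
  if (k : ℕ) + 1 = n then (if i = k then 2 else 1)
  else if i = k then 1 else if (i : ℕ) = k + 1 then -1 else 0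

namespace BallAlg
variable {n : ℕ} {q : QParam}

/-- The generator `z i`. -/
noncomputable abbrev z (q : QParam) (i : Fin n) : BallAlg n q := gen q (.z i)

/-- The generator `zs i = (z i)^*`. -/
noncomputable abbrev zs (q : QParam) (i : Fin n) : BallAlg n q := gen q (.zs i)

/-- The generator `f0`. -/
noncomputable abbrev f0 (n : ℕ) (q : QParam) : BallAlg n q := gen q .f0

theorem scale_relations (w : Fin n → ℂˣ) :
    FRelations (A := BallAlg n q) q (fun i => (w i : ℂ) • z q i)
      (fun i => ((w i)⁻¹ : ℂ) • zs q i) (f0 n q) := by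
  have h := BallAlg.relations n q
  constructor
  · intro i j hij
    simp only [smul_mul_smul_comm, h.zz i j hij, smul_smul]; congr 1; ring
  · intro i j hij
    simp only [smul_mul_smul_comm, h.ss i j hij, smul_smul]; congr 1; ring
  · intro i j hij
    simp only [smul_mul_smul_comm, h.sz i j hij, smul_smul]; congr 1; ring
  · intro j
    simp only [smul_mul_smul_comm, ne_eq, Units.ne_zero, not_false_eq_true, inv_mul_cancel₀,
      mul_inv_cancel₀, one_smul, h.sz' j]
  · exact h.ff
  · intro i; simp only [smul_mul_assoc, h.sf, smul_zero]
  · intro i; simp only [mul_smul_comm, h.fz, smul_zero]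

/-- The automorphism of `F(U_n)_q` scaling `z i` by `w i`, `zs i` by `(w i)⁻¹` and fixing `f0`. -/
noncomputable def scale (w : Fin n → ℂˣ) : BallAlg n q →ₐ[ℂ] BallAlg n q :=
  lift (scale_relations w)

/-- The weights of `K k`. -/
noncomputable def weight (q : QParam) (k i : Fin n) : ℂˣ :=
  Units.mk0 (qc q) (qc_ne_zero q) ^ wt k i

/-- The action of `K k` on `F(U_n)_q`: the automorphism with `K k z i = q ^ (wt k i) z i`,
`K k zs i = q ^ (- wt k i) zs i`, `K k f0 = f0`. -/
noncomputable def actK (q : QParam) (k : Fin n) : BallAlg n q →ₐ[ℂ] BallAlg n q :=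
  scale (weight q k)

/-- The action of `(K k)⁻¹`. -/
noncomputable def actL (q : QParam) (k : Fin n) : BallAlg n q →ₐ[ℂ] BallAlg n q :=
  scale (weight q k)⁻¹

theorem scale_gen (w : Fin n → ℂˣ) (x : FGen n) : scale w (gen q x) =
    FGen.elim (fun i => (w i : ℂ) • z q i) (fun i => ((w i)⁻¹ : ℂ) • zs q i) (f0 n q) x :=
  lift_gen _ x

theorem scale_scale (w w' : Fin n → ℂˣ) (x : BallAlg n q) :
    scale w (scale w' x) = scale (w * w') x := by
  induction x using BallAlg.induction with
  | hgen x =>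
    cases x <;> simp only [scale_gen, FGen.elim, map_smul, smul_smul, Pi.mul_apply, Units.val_mul,
      mul_inv, mul_comm]
  | hc c => simp only [AlgHom.commutes]
  | hadd x y hx hy => simp only [map_add, hx, hy]
  | hmul x y hx hy => simp only [map_mul, hx, hy]

theorem scale_one (x : BallAlg n q) : scale 1 x = x := by
  induction x using BallAlg.induction with
  | hgen x => cases x <;> simp [scale_gen, FGen.elim]
  | hc c => simp only [AlgHom.commutes]
  | hadd x y hx hy => simp only [map_add, hx, hy]
  | hmul x y hx hy => simp only [map_mul, hx, hy]

theorem weight_val (k i : Fin n) : (weight q k i : ℂ) = qc q ^ wt k i := by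
  simp [weight]

theorem actK_gen (k : Fin n) (x : FGen n) : actK q k (gen q x) =
    FGen.elim (fun i => qc q ^ wt k i • z q i) (fun i => qc q ^ (-wt k i) • zs q i) (f0 n q) x := by
  unfold actK; rw [scale_gen]; cases x <;> simp only [FGen.elim, weight_val, zpow_neg]

theorem actL_gen (k : Fin n) (x : FGen n) : actL q k (gen q x) =
    FGen.elim (fun i => qc q ^ (-wt k i) • z q i) (fun i => qc q ^ wt k i • zs q i) (f0 n q) x := by
  unfold actL; rw [scale_gen]
  cases x <;> simp only [FGen.elim, weight_val, zpow_neg, Pi.inv_apply, Units.val_inv_eq_inv_val,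
    inv_inv]

theorem actK_actK (i j : Fin n) (x : BallAlg n q) :
    actK q i (actK q j x) = actK q j (actK q i x) := by
  unfold actK; rw [scale_scale, scale_scale, mul_comm]

theorem actK_actL (i j : Fin n) (x : BallAlg n q) :
    actK q i (actL q j x) = actL q j (actK q i x) := by
  unfold actK actL; rw [scale_scale, scale_scale, mul_comm]

theorem actL_actK_self (i : Fin n) (x : BallAlg n q) : actL q i (actK q i x) = x := by
  unfold actK actL; rw [scale_scale, inv_mul_cancel, scale_one]

/-- `q ^ (1/2)`. -/
noncomputable def sq (q : QParam) : ℂ := ((Real.sqrt q : ℝ) : ℂ)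

theorem sq_mul_sq (q : QParam) : sq q * sq q = qc q := by
  unfold sq qc
  rw [← Complex.ofReal_mul, Real.mul_self_sqrt q.2.1.le]

theorem sq_ne_zero (q : QParam) : sq q ≠ 0 := by
  intro h
  have := sq_mul_sq q
  rw [h, mul_zero] at this
  exact qc_ne_zero q this.symm

theorem wt_self_of_lt {k k' : Fin n} (h : (k : ℕ) + 1 = k') : wt k k = 1 := by
  have := k'.2
  unfold wt; rw [if_neg (by lia), if_pos rfl]

theorem wt_succ {k k' : Fin n} (h : (k : ℕ) + 1 = k') : wt k k' = -1 := by
  have := k'.2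
  unfold wt; rw [if_neg (by lia), if_neg (by rintro rfl; lia), if_pos h.symm]

theorem wt_other {k k' i : Fin n} (h : (k : ℕ) + 1 = k') (h1 : i ≠ k) (h2 : i ≠ k') :
    wt k i = 0 := by
  have := k'.2
  have h2' : (i : ℕ) ≠ k' := fun e => h2 (Fin.ext e)
  unfold wt; rw [if_neg (by lia), if_neg h1, if_neg (by lia)]

/-- The value of `E k` on `z i`, where `k` is not the last index and `k'` is the next one. -/
noncomputable def Ez (q : QParam) (k k' i : Fin n) : BallAlg n q :=
  if i = k' then (sq q)⁻¹ • z q k else 0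

/-- The value of `E k` on `zs i`, where `k` is not the last index and `k'` is the next one. -/
noncomputable def Ezs (q : QParam) (k k' i : Fin n) : BallAlg n q :=
  if i = k then (-(sq q)⁻¹ ^ 3) • zs q k' else 0

theorem skew_relations (k k' : Fin n) (hk : (k : ℕ) + 1 = k') :
    FRelations (A := Matrix (Fin 2) (Fin 2) (BallAlg n q)) q
      (fun i => !![actK q k (z q i), Ez q k k' i; 0, z q i])
      (fun i => !![actK q k (zs q i), Ezs q k k' i; 0, zs q i])
      (!![f0 n q, 0; 0, f0 n q]) := by
  have h := BallAlg.relations n q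
  have hq := qc_ne_zero q
  have hs := sq_ne_zero q
  have hss : qc q = sq q * sq q := (sq_mul_sq q).symm
  have hK : ∀ x, actK q k (gen q x) = _ := actK_gen (q := q) k
  have kk' : k < k' := Fin.lt_def.2 (by lia)
  have ne : k ≠ k' := kk'.ne
  have w1 := wt_self_of_lt hk
  have w2 := wt_succ hk
  have between : ∀ {i : Fin n}, k < i → i ≠ k' → k' < i := fun {i} a b => by
    rw [Fin.lt_def] at *; have : (i : ℕ) ≠ k' := fun e => b (Fin.ext e); lia
  have between' : ∀ {i : Fin n}, i < k' → i ≠ k → i < k := fun {i} a b => by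
    rw [Fin.lt_def] at *; have : (i : ℕ) ≠ k := fun e => b (Fin.ext e); lia
  have ext2 : ∀ {a b d a' b' d' : BallAlg n q}, a = a' → b = b' → d = d' →
      (!![a, b; 0, d] : Matrix (Fin 2) (Fin 2) (BallAlg n q)) = !![a', b'; 0, d'] := by
    rintro _ _ _ _ _ _ rfl rfl rfl; rfl
  have mul2 : ∀ a b d a' b' d' : BallAlg n q,
      (!![a, b; 0, d] : Matrix (Fin 2) (Fin 2) (BallAlg n q)) * !![a', b'; 0, d'] =
        !![a * a', a * b' + b * d'; 0, d * d'] := fun _ _ _ _ _ _ => by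
    simp [Matrix.mul_fin_two]
  have smul2 : ∀ (c : ℂ) (a b d : BallAlg n q),
      c • (!![a, b; 0, d] : Matrix (Fin 2) (Fin 2) (BallAlg n q)) = !![c • a, c • b; 0, c • d] :=
    fun c a b d => by simp [Matrix.smul_of]
  have add2 : ∀ a b d a' b' d' : BallAlg n q,
      (!![a, b; 0, d] : Matrix (Fin 2) (Fin 2) (BallAlg n q)) + !![a', b'; 0, d'] =
        !![a + a', b + b'; 0, d + d'] := fun _ _ _ _ _ _ => by simp [Matrix.of_add_of]
  have sub2 : ∀ a b d a' b' d' : BallAlg n q,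
      (!![a, b; 0, d] : Matrix (Fin 2) (Fin 2) (BallAlg n q)) - !![a', b'; 0, d'] =
        !![a - a', b - b'; 0, d - d'] := fun _ _ _ _ _ _ => by simp [Matrix.of_sub_of]
  have one2 : (1 : Matrix (Fin 2) (Fin 2) (BallAlg n q)) = !![1, 0; 0, 1] := Matrix.one_fin_two
  have sum2 : ∀ (s : Finset (Fin n)) (a b d : Fin n → BallAlg n q),
      ∑ i ∈ s, (!![a i, b i; 0, d i] : Matrix (Fin 2) (Fin 2) (BallAlg n q)) =
        !![∑ i ∈ s, a i, ∑ i ∈ s, b i; 0, ∑ i ∈ s, d i] := fun s a b d => by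
    induction s using Finset.induction with
    | empty => ext i j; fin_cases i <;> fin_cases j <;> rfl
    | insert x s hx ih =>
      rw [Finset.sum_insert hx, Finset.sum_insert hx, Finset.sum_insert hx, Finset.sum_insert hx,
        ih, add2]
  constructor
  · intro i j hij
    rw [mul2, mul2, smul2]
    refine ext2 ?_ ?_ (h.zz i j hij)
    · rw [← map_mul, ← map_mul, ← map_smul, h.zz i j hij]
    · unfold Ez
      simp only [hK, FGen.elim]
      by_cases hj : j = k'
      · by_cases hi : i = k
        · subst hi hj
          simp only [if_pos, if_neg ne, w1, w2, zpow_one, zpow_neg, mul_zero, zero_mul, zero_add,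
            add_zero, smul_mul_assoc, mul_smul_comm, smul_smul]
          match_scalars; field_simp
        · have hi' : i ≠ k' := fun e => (e ▸ hj ▸ hij).ne rfl
          have := h.zz i k (between' (hj ▸ hij) hi)
          subst hj
          simp only [if_pos, if_neg hi', wt_other hk hi hi', zpow_zero, one_smul, mul_zero,
            zero_mul, zero_add, add_zero, smul_mul_assoc, mul_smul_comm, smul_smul, this]
          match_scalars; ring
      · by_cases hi : i = k'
        · have hj' : j ≠ k := fun e => by subst hi e; exact absurd hij kk'.not_gt
          have := h.zz k j (kk'.trans (hi ▸ hij))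
          subst hi
          simp only [if_pos, if_neg hj, wt_other hk hj' hj, zpow_zero, one_smul, mul_zero,
            zero_mul, zero_add, add_zero, smul_mul_assoc, mul_smul_comm, smul_smul, this]
          match_scalars; ring
        · simp only [if_neg hi, if_neg hj, mul_zero, zero_mul, add_zero, smul_zero]
  · intro i j hij
    rw [mul2, mul2, smul2]
    refine ext2 ?_ ?_ (h.ss i j hij)
    · rw [← map_mul, ← map_mul, ← map_smul, h.ss i j hij]
    · unfold Ezs
      simp only [hK, FGen.elim]
      by_cases hi : i = k
      · by_cases hj : j = k'
        · subst hi hj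
          simp only [if_pos, if_neg ne.symm, w1, w2, zpow_one, zpow_neg, mul_zero, zero_mul,
            zero_add, add_zero, smul_mul_assoc, mul_smul_comm, smul_smul, neg_neg]
          match_scalars; field_simp
        · have hj' : j ≠ k := fun e => (hi ▸ e ▸ hij).ne rfl
          have := h.ss k' j (between (hi ▸ hij) hj)
          subst hi
          simp only [if_pos, if_neg hj', wt_other hk hj' hj, zpow_zero, one_smul, mul_zero,
            zero_mul, zero_add, add_zero, smul_mul_assoc, mul_smul_comm, smul_smul, this, neg_zero]
          match_scalars; ring
      · by_cases hj : j = k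
        · have hi' : i ≠ k' := fun e => by subst hj e; exact absurd hij kk'.not_gt
          have := h.ss i k' ((hj ▸ hij).trans kk')
          subst hj
          simp only [if_pos, if_neg hi, wt_other hk hi hi', zpow_zero, one_smul, mul_zero,
            zero_mul, zero_add, add_zero, smul_mul_assoc, mul_smul_comm, smul_smul, this, neg_zero]
          match_scalars; ring
        · simp only [if_neg hi, if_neg hj, mul_zero, zero_mul, add_zero, smul_zero]
  · intro i j hij
    rw [mul2, mul2, smul2]
    refine ext2 ?_ ?_ (h.sz i j hij)
    · rw [← map_mul, ← map_mul, ← map_smul, h.sz i j hij]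
    · unfold Ez Ezs
      simp only [hK, FGen.elim]
      by_cases hi : i = k
      · by_cases hj : j = k'
        · subst hi hj
          have e1 := h.sz' i
          have e2 := h.sz' j
          have e3 : ∑ l ∈ Finset.Ioi i, z q l * zs q l =
              z q j * zs q j + ∑ l ∈ Finset.Ioi j, z q l * zs q l := by
            have : Finset.Ioi i = insert j (Finset.Ioi j) := by
              ext l
              simp only [Finset.mem_Ioi, Finset.mem_insert]
              constructor
              · intro a; by_cases b : l = j
                · exact Or.inl b
                · exact Or.inr (between a b)
              · rintro (rfl | a)
                · exact kk'
                · exact kk'.trans a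
            rw [this, Finset.sum_insert (by simp)]
          rw [e3] at e1
          simp only [if_pos, w1, w2, zpow_one, zpow_neg, neg_neg, smul_mul_assoc, mul_smul_comm,
            smul_smul, e1, e2, hss]
          match_scalars <;> field_simp <;> ring
        · have hj' : j ≠ k := fun e => hij (hi.trans e.symm)
          have := h.sz k' j (Ne.symm hj)
          subst hi
          simp only [if_pos, if_neg hj, wt_other hk hj' hj, zpow_zero, one_smul, mul_zero,
            zero_mul, zero_add, add_zero, smul_mul_assoc, mul_smul_comm, smul_smul, this]
          match_scalars; ring
      · by_cases hj : j = k'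
        · have hi' : i ≠ k' := fun e => hij (e.trans hj.symm)
          have := h.sz i k hi
          subst hj
          simp only [if_pos, if_neg hi, wt_other hk hi hi', zpow_zero, neg_zero, one_smul, mul_zero,
            zero_mul, zero_add, add_zero, smul_mul_assoc, mul_smul_comm, smul_smul, this]
          match_scalars; ring
        · simp only [if_neg hi, if_neg hj, mul_zero, zero_mul, add_zero, smul_zero]
  · intro j
    simp only [mul2, one2, sum2, sub2, smul2, add2]
    refine ext2 ?_ ?_ (h.sz' j)
    · simp only [← map_mul, ← map_sum, h.sz' j, map_add, map_smul, map_sub, map_one]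
    · unfold Ez Ezs
      simp only [hK, FGen.elim, mul_ite, ite_mul, mul_zero, zero_mul, Finset.sum_add_distrib,
        Finset.sum_ite_eq', Finset.mem_Ioi]
      by_cases hj : j = k
      · subst hj
        have := h.sz k' j (Ne.symm ne)
        simp only [if_pos, if_neg ne, if_pos kk', lt_irrefl, if_false, w1, zpow_one, zpow_neg,
          smul_mul_assoc, mul_smul_comm, smul_smul, this, hss, zero_add, add_zero, smul_sub,
          smul_zero]
        match_scalars <;> field_simp <;> ring
      · by_cases hj' : j = k'
        · subst hj'
          have := h.sz j k (Ne.symm ne)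
          simp only [if_pos, if_neg (Ne.symm ne), kk'.not_gt, lt_irrefl, if_false, w2, zpow_one,
            zpow_neg, neg_neg, smul_mul_assoc, mul_smul_comm, smul_smul, zero_add, add_zero,
            smul_sub, smul_zero, this, sub_zero]
          match_scalars; ring
        · simp only [if_neg hj, if_neg hj']
          by_cases hlt : j < k
          · have a2 : j < k' := hlt.trans kk'
            simp only [if_pos hlt, if_pos a2, w1, zpow_one, smul_mul_assoc, mul_smul_comm,
              smul_smul, hss, zero_add, add_zero, smul_zero]
            match_scalars <;> field_simp <;> ring
          · have a2 : ¬ j < k' := fun a => hlt (between' a hj)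
            simp only [if_neg hlt, if_neg a2, add_zero, smul_zero, sub_zero]
  · rw [mul2, mul_zero, zero_mul, add_zero, h.ff]
  · intro i
    rw [mul2, hK]
    unfold Ezs
    simp only [FGen.elim, smul_mul_assoc, h.sf, mul_zero, smul_zero, zero_add, ite_mul, zero_mul,
      ite_self]
    ext a b; fin_cases a <;> fin_cases b <;> rfl
  · intro i
    rw [mul2, hK]
    unfold Ez
    simp only [FGen.elim, mul_smul_comm, h.fz, mul_ite, mul_zero, smul_zero, zero_mul, add_zero,
      ite_self]
    ext a b; fin_cases a <;> fin_cases b <;> rfl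

/-- The action of `E k` on `F(U_n)_q`. For `k` not the last index it is the twisted derivation,
`E k (x y) = E k x * y + K k x * E k y`, vanishing on `f0` and with the values `Ez`, `Ezs` on the
generators `z i`, `zs i`; for the last index it is the inner twisted derivation displayed here. -/
noncomputable def actE (q : QParam) (k : Fin n) : BallAlg n q →ₗ[ℂ] BallAlg n q :=
  if h : (k : ℕ) + 1 < n then
    (Matrix.entryLinearMap ℂ (BallAlg n q) 0 1).comp
      (lift (skew_relations k ⟨k + 1, h⟩ rfl)).toLinearMap
  else
    (-(sq q / (1 - qc q ^ 2))) •
      (LinearMap.mulLeft ℂ (z q k) - (LinearMap.mulRight ℂ (z q k)).comp (actK q k).toLinearMap)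

/-- The action of `F k` on `F(U_n)_q`, obtained from the action of `E k` by the compatibility
`(ξ x)^* = S(ξ)^* x^*` of the action with the involutions. -/
noncomputable def actF (q : QParam) (k : Fin n) : BallAlg n q →ₗ[ℂ] BallAlg n q where
  toFun x := (if (k : ℕ) + 1 < n then -qc q ^ 2 else qc q ^ 2) • conj (actE q k (conj x))
  map_add' x y := by rw [conj_add, map_add, conj_add, smul_add]
  map_smul' c x := by
    rw [conj_smul, map_smul, conj_smul, Complex.conj_conj, smul_comm, RingHom.id_apply]

theorem conj_zero : conj (0 : BallAlg n q) = 0 := by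
  have := conj_smul (0 : ℂ) (0 : BallAlg n q)
  rwa [map_zero, zero_smul, zero_smul] at this

theorem lift_skew (k k' : Fin n) (hk : (k : ℕ) + 1 = k') (x : BallAlg n q) :
    lift (skew_relations k k' hk) x =
      !![actK q k x, lift (skew_relations k k' hk) x 0 1; 0, x] := by
  induction x using BallAlg.induction with
  | hgen x =>
    rw [lift_gen]
    cases x <;> simp only [FGen.elim] <;> try rfl
    ext i j; fin_cases i <;> fin_cases j <;> simp [actK_gen, FGen.elim]
  | hc c => ext i j; fin_cases i <;> fin_cases j <;> simp [Matrix.algebraMap_matrix_apply]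
  | hadd x y hx hy =>
    rw [map_add, hx, hy]
    ext i j; fin_cases i <;> fin_cases j <;> simp
  | hmul x y hx hy =>
    rw [map_mul, hx, hy]
    ext i j; fin_cases i <;> fin_cases j <;> simp [Matrix.mul_apply]

theorem actE_low {k k' : Fin n} (hk : (k : ℕ) + 1 = k') (x : BallAlg n q) :
    actE q k x = lift (skew_relations k k' hk) x 0 1 := by
  have h : (k : ℕ) + 1 < n := hk ▸ k'.2
  obtain rfl : k' = ⟨k + 1, h⟩ := Fin.ext hk.symm
  unfold actE
  rw [dif_pos h]; rfl

theorem actE_last {k : Fin n} (hk : (k : ℕ) + 1 = n) (x : BallAlg n q) :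
    actE q k x = (-(sq q / (1 - qc q ^ 2))) • (z q k * x - actK q k x * z q k) := by
  unfold actE
  rw [dif_neg (by lia)]; rfl

theorem actE_mul (k : Fin n) (x y : BallAlg n q) :
    actE q k (x * y) = actE q k x * y + actK q k x * actE q k y := by
  by_cases hk : (k : ℕ) + 1 < n
  · have e := fun x => actE_low (q := q) (k := k) (k' := ⟨k + 1, hk⟩) rfl x
    rw [e, map_mul, lift_skew _ _ rfl x, lift_skew _ _ rfl y, ← e, ← e]
    simp [Matrix.mul_apply, add_comm]
  · have hk' : (k : ℕ) + 1 = n := by have := k.2; lia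
    rw [actE_last hk', actE_last hk', actE_last hk', map_mul]
    simp only [smul_mul_assoc, mul_smul_comm, ← smul_add, sub_mul, mul_sub, mul_assoc]
    congr 1
    abel

theorem actE_gen_low {k k' : Fin n} (hk : (k : ℕ) + 1 = k') (x : FGen n) :
    actE q k (gen q x) = FGen.elim (Ez q k k') (Ezs q k k') 0 x := by
  rw [actE_low hk, lift_gen]
  cases x <;> simp [FGen.elim]

theorem conj_scale (k : Fin n) (x : BallAlg n q) : conj (actK q k x) = actL q k (conj x) := by
  induction x using BallAlg.induction with
  | hgen x =>
    cases x <;> simp only [actK_gen, actL_gen, FGen.elim, conj_smul, conj_gen, map_zpow₀, star_qc]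
  | hc c =>
    simp only [AlgHom.commutes, Algebra.algebraMap_eq_smul_one, conj_smul, conj_one, map_smul,
      map_one]
  | hadd x y hx hy => simp only [map_add, conj_add, hx, hy]
  | hmul x y hx hy => simp only [map_mul, conj_mul, hx, hy]

theorem actF_apply (k : Fin n) (x : BallAlg n q) : actF q k x =
    (if (k : ℕ) + 1 < n then -qc q ^ 2 else qc q ^ 2) • conj (actE q k (conj x)) := rfl

theorem actF_mul (k : Fin n) (x y : BallAlg n q) :
    actF q k (x * y) = actF q k x * actL q k y + x * actF q k y := by
  simp only [actF_apply, conj_mul, actE_mul, conj_add, conj_scale, conj_conj, smul_add,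
    smul_mul_assoc, mul_smul_comm]
  rw [add_comm]

theorem wt_sub (i : Fin n) {k k' : Fin n} (hk : (k : ℕ) + 1 = k') :
    wt i k = CartanMatrix.A n i k + wt i k' := by
  have := k'.2
  have := i.2
  simp only [wt, CartanMatrix.A, Matrix.of_apply, Fin.ext_iff]
  split_ifs <;> lia

theorem wt_last (i : Fin n) {k : Fin n} (hk : (k : ℕ) + 1 = n) :
    wt i k = CartanMatrix.A n i k := by
  have := i.2
  simp only [wt, CartanMatrix.A, Matrix.of_apply, Fin.ext_iff]
  split_ifs <;> lia

theorem actE_algebraMap (k : Fin n) (c : ℂ) : actE q k (algebraMap ℂ _ c) = 0 := by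
  have h : actE q k (1 : BallAlg n q) = 0 := by
    have := actE_mul k (1 : BallAlg n q) 1
    simp only [mul_one, map_one, one_mul] at this
    simpa using this
  rw [Algebra.algebraMap_eq_smul_one, map_smul, h, smul_zero]

theorem actK_actE (i j : Fin n) (x : BallAlg n q) :
    actK q i (actE q j x) = qc q ^ CartanMatrix.A n i j • actE q j (actK q i x) := by
  have hq := qc_ne_zero q
  by_cases hj : (j : ℕ) + 1 < n
  · set j' : Fin n := ⟨j + 1, hj⟩ with hj'
    have hjj : (j : ℕ) + 1 = j' := rfl
    have w := wt_sub i hjj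
    induction x using BallAlg.induction with
    | hgen x =>
      rw [actE_gen_low hjj]
      cases x with
      | z l =>
        simp only [FGen.elim, Ez, actK_gen, map_smul, actE_gen_low hjj]
        split_ifs with h
        · subst h
          rw [map_smul, actK_gen, FGen.elim, w, zpow_add₀ hq]; module
        · simp
      | zs l =>
        simp only [FGen.elim, Ezs, actK_gen, map_smul, actE_gen_low hjj]
        split_ifs with h
        · subst h
          rw [map_smul, actK_gen, FGen.elim, w, neg_add, zpow_add₀ hq, zpow_neg, zpow_neg]
          match_scalars; field_simp
        · simp
      | f0 => simp [FGen.elim, actK_gen, actE_gen_low hjj]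
    | hc c => simp only [AlgHom.commutes, actE_algebraMap, map_zero, smul_zero]
    | hadd x y hx hy => simp only [map_add, hx, hy, smul_add]
    | hmul x y hx hy =>
      simp only [map_mul, map_add, actE_mul, hx, hy, actK_actK i j, smul_mul_assoc, mul_smul_comm,
        smul_add]
  · have hj' : (j : ℕ) + 1 = n := by have := j.2; lia
    rw [actE_last hj', actE_last hj', map_smul, map_sub, map_mul, map_mul, actK_gen, FGen.elim,
      wt_last i hj', actK_actK i j, smul_mul_assoc, mul_smul_comm]
    module

theorem actE_actK (i j : Fin n) (x : BallAlg n q) :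
    actE q j (actK q i x) = qc q ^ (-CartanMatrix.A n i j) • actK q i (actE q j x) := by
  rw [actK_actE, smul_smul, ← zpow_add₀ (qc_ne_zero q)]; simp

theorem actE_actL (i j : Fin n) (x : BallAlg n q) :
    actE q j (actL q i x) = qc q ^ CartanMatrix.A n i j • actL q i (actE q j x) := by
  have h := congrArg (actL q i) (actK_actE i j (actL q i x))
  rw [map_smul, actL_actK_self] at h
  rw [h]
  congr 2
  rw [actK_actL, actL_actK_self]

theorem conj_actL (k : Fin n) (x : BallAlg n q) : conj (actL q k x) = actK q k (conj x) := by
  rw [← conj_conj x, ← conj_scale, conj_conj, conj_conj]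

theorem actK_actF (i j : Fin n) (x : BallAlg n q) :
    actK q i (actF q j x) = qc q ^ (-CartanMatrix.A n i j) • actF q j (actK q i x) := by
  simp only [actF_apply, conj_scale, actE_actL, conj_smul, conj_actL, map_zpow₀, star_qc, map_smul,
    smul_smul]
  rw [mul_left_comm, mul_comm (qc q ^ (-_)), ← zpow_add₀ (qc_ne_zero q), add_neg_cancel, zpow_zero,
    mul_one]

theorem actL_actF (i j : Fin n) (x : BallAlg n q) :
    actL q i (actF q j x) = qc q ^ (CartanMatrix.A n i j) • actF q j (actL q i x) := by
  have h := congrArg (actL q i) (actK_actF i j (actL q i x))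
  have e : actK q i (actL q i x) = x := by rw [actK_actL, actL_actK_self]
  rw [map_smul, actL_actK_self, e] at h
  rw [h, smul_smul, ← zpow_add₀ (qc_ne_zero q)]; simp

theorem actF_gen_low {k k' : Fin n} (hk : (k : ℕ) + 1 = k') (x : FGen n) :
    actF q k (gen q x) = FGen.elim
      (fun i => if i = k then sq q • z q k' else 0)
      (fun i => if i = k' then (-sq q ^ 3) • zs q k else 0) 0 x := by
  have hs := sq_ne_zero q
  have hss := (sq_mul_sq q).symm
  rw [actF_apply, if_pos (by have := k'.2; lia), conj_gen]
  have hreal : starRingEnd ℂ (sq q) = sq q := Complex.conj_ofReal _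
  cases x with
  | z i =>
    simp only [FGen.elim, actE_gen_low hk, Ezs]
    split_ifs
    · simp only [conj_smul, conj_gen, FGen.elim, map_neg, map_pow, map_inv₀, hreal, hss]
      match_scalars; field_simp
    · rw [conj_zero, smul_zero]
  | zs i =>
    simp only [FGen.elim, actE_gen_low hk, Ez]
    split_ifs
    · simp only [conj_smul, conj_gen, FGen.elim, map_inv₀, hreal, hss]
      match_scalars; field_simp
    · rw [conj_zero, smul_zero]
  | f0 => simp only [FGen.elim, actE_gen_low hk]; rw [conj_zero, smul_zero]

theorem conj_sub (x y : BallAlg n q) : conj (x - y) = conj x - conj y := by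
  rw [eq_sub_iff_add_eq, ← conj_add, sub_add_cancel]

theorem actF_last {k : Fin n} (hk : (k : ℕ) + 1 = n) (x : BallAlg n q) :
    actF q k x = (sq q / (qc q ^ (-2 : ℤ) - 1)) • (zs q k * actL q k x - x * zs q k) := by
  have hq := qc_ne_zero q
  have hq2 := one_sub_qc_sq_ne_zero q
  have hreal : starRingEnd ℂ (sq q) = sq q := Complex.conj_ofReal _
  rw [actF_apply, if_neg (by lia), actE_last hk, conj_smul, conj_sub, conj_mul, conj_mul,
    conj_gen, FGen.elim, conj_scale, conj_conj]
  simp only [map_neg, map_div₀, map_sub, map_one, map_pow, hreal, star_qc, zpow_neg]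
  have : (qc q ^ (2:ℤ))⁻¹ - 1 = (1 - qc q ^ 2) / qc q ^ 2 := by field_simp
  rw [this]
  match_scalars <;> field_simp

theorem actF_algebraMap (k : Fin n) (c : ℂ) : actF q k (algebraMap ℂ _ c) = 0 := by
  have h : actF q k (1 : BallAlg n q) = 0 := by
    have := actF_mul k (1 : BallAlg n q) 1
    simp only [mul_one, map_one, one_mul] at this
    simpa using this
  rw [Algebra.algebraMap_eq_smul_one, map_smul, h, smul_zero]

/-- The operators `E k` twisted by a nonzero scalar `c`: for the last index,
`E x - q^{1/2} (1 - c²) / (1 - q²) (K x) z`. For `c = 1` these are the operators `actE`. -/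
noncomputable def twE (q : QParam) (c : ℂˣ) (k : Fin n) : BallAlg n q →ₗ[ℂ] BallAlg n q :=
  if (k : ℕ) + 1 < n then actE q k
  else actE q k - (sq q * ((1 - (c : ℂ) ^ 2) / (1 - qc q ^ 2))) •
    (LinearMap.mulRight ℂ (z q k)).comp (actK q k).toLinearMap

/-- The scalar `c` for the last index, and `1` for the other ones. -/
def lastScalar (c : ℂˣ) (k : Fin n) : ℂˣ := if (k : ℕ) + 1 < n then 1 else c

/-- The operators `F k` twisted by `c`. -/
noncomputable def twF (q : QParam) (c : ℂˣ) (k : Fin n) : BallAlg n q →ₗ[ℂ] BallAlg n q :=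
  ((lastScalar c k)⁻¹ : ℂ) • actF q k

/-- The operators `K k` twisted by `c`. -/
noncomputable def twK (q : QParam) (c : ℂˣ) (k : Fin n) : BallAlg n q →ₗ[ℂ] BallAlg n q :=
  (lastScalar c k : ℂ) • (actK q k).toLinearMap

/-- The operators `(K k)⁻¹` twisted by `c`. -/
noncomputable def twL (q : QParam) (c : ℂˣ) (k : Fin n) : BallAlg n q →ₗ[ℂ] BallAlg n q :=
  ((lastScalar c k)⁻¹ : ℂ) • (actL q k).toLinearMap

theorem twE_low (c : ℂˣ) {k : Fin n} (hk : (k : ℕ) + 1 < n) (x : BallAlg n q) :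
    twE q c k x = actE q k x := by
  unfold twE; rw [if_pos hk]

theorem twE_last (c : ℂˣ) {k : Fin n} (hk : (k : ℕ) + 1 = n) (x : BallAlg n q) :
    twE q c k x = (-(sq q / (1 - qc q ^ 2))) •
      (z q k * x - (c : ℂ) ^ 2 • (actK q k x * z q k)) := by
  unfold twE; rw [if_neg (by lia)]
  rw [LinearMap.sub_apply, actE_last hk]
  simp only [LinearMap.smul_apply, LinearMap.comp_apply, LinearMap.mulRight_apply,
    AlgHom.toLinearMap_apply]
  module

theorem twE_one (k : Fin n) : twE q 1 k = actE q k := by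
  refine LinearMap.ext fun x => ?_
  by_cases hk : (k : ℕ) + 1 < n
  · rw [twE_low _ hk]
  · have hk' : (k : ℕ) + 1 = n := by have := k.2; lia
    rw [twE_last _ hk', actE_last hk', Units.val_one, one_pow, one_smul]

/-- The Serre relation away from the last index. -/
theorem serre_low {a b : Fin n} (hab : Adj a b) (ha : (a : ℕ) + 1 < n) (hb : (b : ℕ) + 1 < n)
    (x : BallAlg n q) :
    actE q a (actE q a (actE q b x)) = (qc q + (qc q)⁻¹) • actE q a (actE q b (actE q a x))
      - actE q b (actE q a (actE q a x)) := by
  have hq := qc_ne_zero q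
  set a' : Fin n := ⟨a + 1, ha⟩
  set b' : Fin n := ⟨b + 1, hb⟩
  have haa : (a : ℕ) + 1 = a' := rfl
  have hbb : (b : ℕ) + 1 = b' := rfl
  have e1 : ∀ y, actE q a (actK q a y) = (qc q * qc q)⁻¹ • actK q a (actE q a y) := fun y => by
    rw [actE_actK, cartan_self, zpow_neg, zpow_two]
  have e2 : ∀ y, actE q a (actK q b y) = qc q • actK q b (actE q a y) := fun y => by
    rw [actE_actK, cartan_adj hab.symm, neg_neg, zpow_one]
  have e3 : ∀ y, actE q b (actK q a y) = qc q • actK q a (actE q b y) := fun y => by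
    rw [actE_actK, cartan_adj hab, neg_neg, zpow_one]
  have e4 : ∀ y : BallAlg n q, actK q b (actK q a y) = actK q a (actK q b y) := actK_actK b a
  induction x using BallAlg.induction with
  | hgen x =>
    have hx : (a' = b ∧ b' ≠ a) ∨ (b' = a ∧ a' ≠ b) := by
      rcases hab with h | h
      · exact Or.inl ⟨Fin.ext h, fun e => by have := congrArg Fin.val e; lia⟩
      · exact Or.inr ⟨Fin.ext h, fun e => by have := congrArg Fin.val e; lia⟩
    have n1 : a ≠ a' := fun e => by have := congrArg Fin.val e; lia
    have n2 : b ≠ b' := fun e => by have := congrArg Fin.val e; lia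
    clear_value a' b'
    cases x with
    | z l =>
      have hA := fun i => actE_gen_low (q := q) haa (.z i)
      have hB := fun i => actE_gen_low (q := q) hbb (.z i)
      simp only [FGen.elim, Ez] at hA hB
      simp only [hA, hB]
      rcases hx with ⟨rfl, h2⟩ | ⟨rfl, h2⟩
      all_goals
        split_ifs <;> simp only [map_smul, map_zero, hA, hB, smul_zero, sub_zero, if_neg n1,
          if_neg n2, if_neg h2, if_neg n1.symm, if_neg n2.symm, if_neg h2.symm, if_pos]
    | zs l =>
      have hA := fun i => actE_gen_low (q := q) haa (.zs i)
      have hB := fun i => actE_gen_low (q := q) hbb (.zs i)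
      simp only [FGen.elim, Ezs] at hA hB
      simp only [hA, hB]
      rcases hx with ⟨rfl, h2⟩ | ⟨rfl, h2⟩
      all_goals
        split_ifs <;> simp only [map_smul, map_zero, hA, hB, smul_zero, sub_zero, if_neg n1,
          if_neg n2, if_neg h2, if_neg n1.symm, if_neg n2.symm, if_neg h2.symm, if_pos]
    | f0 => simp only [actE_gen_low haa, actE_gen_low hbb, FGen.elim, map_zero, smul_zero, sub_zero]
  | hc c => simp only [actE_algebraMap, map_zero, smul_zero, sub_zero]
  | hadd x y hx hy => simp only [map_add, hx, hy]; module
  | hmul x y hx hy =>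
    simp only [actE_mul, map_add, map_mul, map_smul, map_sub, e1, e2, e3, e4, hx, hy,
      smul_mul_assoc, mul_smul_comm, smul_smul, smul_add, sub_mul, mul_sub]
    match_scalars <;> field_simp <;> ring

theorem comm_low {a b : Fin n} (hab : ¬ Adj a b) (ha : (a : ℕ) + 1 < n) (hb : (b : ℕ) + 1 < n)
    (x : BallAlg n q) : actE q a (actE q b x) = actE q b (actE q a x) := by
  by_cases hne : a = b
  · rw [hne]
  have hq := qc_ne_zero q
  have a0 : CartanMatrix.A n a b = 0 := by
    simp only [CartanMatrix.A, Matrix.of_apply, if_neg hne]; exact if_neg hab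
  set a' : Fin n := ⟨a + 1, ha⟩ with ha'
  set b' : Fin n := ⟨b + 1, hb⟩ with hb'
  have haa : (a : ℕ) + 1 = a' := rfl
  have hbb : (b : ℕ) + 1 = b' := rfl
  have e2 : ∀ y, actE q a (actK q b y) = actK q b (actE q a y) := fun y => by
    rw [actE_actK, cartan_symm, a0, neg_zero, zpow_zero, one_smul]
  have e3 : ∀ y, actE q b (actK q a y) = actK q a (actE q b y) := fun y => by
    rw [actE_actK, a0, neg_zero, zpow_zero, one_smul]
  have hab' : a ≠ b' := fun e => hab (Or.inr (congrArg Fin.val e).symm)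
  have hba' : b ≠ a' := fun e => hab (Or.inl (congrArg Fin.val e).symm)
  induction x using BallAlg.induction with
  | hgen x =>
    cases x with
    | z l =>
      have hA := fun i => actE_gen_low (q := q) haa (.z i)
      have hB := fun i => actE_gen_low (q := q) hbb (.z i)
      simp only [FGen.elim, Ez] at hA hB
      simp only [hA, hB]
      split_ifs <;> simp only [map_smul, map_zero, hA, hB, if_neg hab', if_neg hba', smul_zero]
    | zs l =>
      have hA := fun i => actE_gen_low (q := q) haa (.zs i)
      have hB := fun i => actE_gen_low (q := q) hbb (.zs i)
      simp only [FGen.elim, Ezs] at hA hB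
      simp only [hA, hB]
      split_ifs <;>
        simp only [map_smul, map_zero, hA, hB, if_neg hab'.symm, if_neg hba'.symm, smul_zero]
    | f0 => simp only [actE_gen_low haa, actE_gen_low hbb, FGen.elim, map_zero]
  | hc c => simp only [actE_algebraMap, map_zero]
  | hadd x y hx hy => simp only [map_add, hx, hy]
  | hmul x y hx hy =>
    simp only [actE_mul, map_add, map_mul, e2, e3, hx, hy, actK_actK b a]
    abel

/-- `[E a, F b] = 0` for `a ≠ b`, away from the last index. -/
theorem EF_low_ne {a b : Fin n} (hab : a ≠ b) (ha : (a : ℕ) + 1 < n) (hb : (b : ℕ) + 1 < n)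
    (x : BallAlg n q) : actE q a (actF q b x) = actF q b (actE q a x) := by
  have hq := qc_ne_zero q
  set a' : Fin n := ⟨a + 1, ha⟩ with ha'
  set b' : Fin n := ⟨b + 1, hb⟩ with hb'
  have haa : (a : ℕ) + 1 = a' := rfl
  have hbb : (b : ℕ) + 1 = b' := rfl
  have hab' : a' ≠ b' := fun e => hab (by
    have := congrArg Fin.val e; exact Fin.ext (by simpa [a', b'] using this))
  have e1 : ∀ y, actE q a (actL q b y) = qc q ^ CartanMatrix.A n a b • actL q b (actE q a y) :=
    fun y => by rw [actE_actL, cartan_symm]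
  have e2 : ∀ y, actF q b (actK q a y) = qc q ^ CartanMatrix.A n a b • actK q a (actF q b y) :=
    fun y => by rw [actK_actF, smul_smul, ← zpow_add₀ hq]; simp
  induction x using BallAlg.induction with
  | hgen x =>
    cases x with
    | z l =>
      have hA := fun i => actE_gen_low (q := q) haa (.z i)
      have hB := fun i => actF_gen_low (q := q) hbb (.z i)
      simp only [FGen.elim, Ez] at hA hB
      simp only [hA, hB]
      split_ifs <;>
        simp only [map_smul, map_zero, hA, hB, if_neg hab, if_neg hab'.symm, smul_zero]
    | zs l =>
      have hA := fun i => actE_gen_low (q := q) haa (.zs i)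
      have hB := fun i => actF_gen_low (q := q) hbb (.zs i)
      simp only [FGen.elim, Ezs] at hA hB
      simp only [hA, hB]
      split_ifs <;>
        simp only [map_smul, map_zero, hA, hB, if_neg hab.symm, if_neg hab', smul_zero]
    | f0 => simp only [actE_gen_low haa, actF_gen_low hbb, FGen.elim, map_zero]
  | hc c => simp only [actE_algebraMap, actF_algebraMap, map_zero]
  | hadd x y hx hy => simp only [map_add, hx, hy]
  | hmul x y hx hy =>
    simp only [actE_mul, actF_mul, map_add, map_mul, e1, e2, hx, hy, smul_mul_assoc,
      mul_smul_comm]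
    abel

theorem EF_low {a : Fin n} (ha : (a : ℕ) + 1 < n) (x : BallAlg n q) :
    actE q a (actF q a x) = actF q a (actE q a x)
      + (qc q - (qc q)⁻¹)⁻¹ • (actK q a x - actL q a x) := by
  have hq := qc_ne_zero q
  have hs := sq_ne_zero q
  have hss := (sq_mul_sq q).symm
  have hq2 := one_sub_qc_sq_ne_zero q
  have hd : qc q - (qc q)⁻¹ ≠ 0 := by
    intro h; apply hq2; field_simp at h; linear_combination -h
  have hq3 : qc q ^ 2 - 1 ≠ 0 := fun h => hq2 (by linear_combination -h)
  have hq4 : -1 + qc q ^ 2 ≠ 0 := fun h => hq2 (by linear_combination -h)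
  set a' : Fin n := ⟨a + 1, ha⟩ with ha'
  have haa : (a : ℕ) + 1 = a' := rfl
  have ne : a ≠ a' := fun e => by have := congrArg Fin.val e; simp [a'] at this
  have w1 := wt_self_of_lt haa
  have w2 := wt_succ haa
  have e1 : ∀ y, actE q a (actL q a y) = (qc q * qc q) • actL q a (actE q a y) :=
    fun y => by rw [actE_actL, cartan_self, zpow_two]
  have e2 : ∀ y, actF q a (actK q a y) = (qc q * qc q) • actK q a (actF q a y) :=
    fun y => by rw [actK_actF, smul_smul, cartan_self, ← zpow_two, ← zpow_add₀ hq]; simp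
  induction x using BallAlg.induction with
  | hgen x =>
    cases x with
    | z l =>
      have hA := fun i => actE_gen_low (q := q) haa (.z i)
      have hB := fun i => actF_gen_low (q := q) haa (.z i)
      simp only [FGen.elim, Ez] at hA hB
      simp only [hA, hB, actK_gen, actL_gen, FGen.elim]
      by_cases h1 : l = a
      · subst h1
        simp only [if_pos, if_neg ne, map_smul, hA, map_zero, zero_add, w1, zpow_neg, zpow_one]
        match_scalars; field_simp
      · by_cases h2 : l = a'
        · subst h2
          simp only [if_pos, if_neg h1, map_smul, hB, map_zero, w2, zpow_neg, zpow_one, inv_inv]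
          match_scalars; field_simp; ring
        · simp [h1, h2, wt_other haa h1 h2]
    | zs l =>
      have hA := fun i => actE_gen_low (q := q) haa (.zs i)
      have hB := fun i => actF_gen_low (q := q) haa (.zs i)
      simp only [FGen.elim, Ezs] at hA hB
      simp only [hA, hB, actK_gen, actL_gen, FGen.elim]
      by_cases h1 : l = a
      · subst h1
        simp only [if_pos, if_neg ne, map_smul, hB, map_zero, w1, zpow_neg, zpow_one]
        match_scalars; field_simp; ring
      · by_cases h2 : l = a'
        · subst h2
          simp only [if_pos, if_neg h1, map_smul, hA, map_zero, zero_add, w2, zpow_neg, zpow_one,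
            inv_inv]
          match_scalars; field_simp
        · simp [h1, h2, wt_other haa h1 h2]
    | f0 =>
      simp [actE_gen_low haa, actF_gen_low haa, FGen.elim, actK_gen, actL_gen]
  | hc c => simp [actE_algebraMap, actF_algebraMap]
  | hadd x y hx hy => simp only [map_add, hx, hy]; module
  | hmul x y hx hy =>
    simp only [actE_mul, actF_mul, map_add, map_mul, e1, e2, hx, hy, smul_mul_assoc,
      mul_smul_comm, add_mul, mul_add, sub_mul, mul_sub]
    module

theorem actE_z_last {k N : Fin n} (hk : (k : ℕ) + 1 = N) (c : ℂˣ) (hN : (N : ℕ) + 1 = n)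
    (x : BallAlg n q) : actE q k (twE q c N x) = (-(sq q / (1 - qc q ^ 2))) •
      ((sq q)⁻¹ • (z q k * x) + (qc q)⁻¹ • (z q N * actE q k x)
        - (c : ℂ) ^ 2 • (qc q • (actK q N (actE q k x) * z q N)
          + (sq q)⁻¹ • (actK q k (actK q N x) * z q k))) := by
  have hA := actE_gen_low (q := q) hk (.z N)
  simp only [FGen.elim, Ez, if_pos] at hA
  have ha : Adj N k := Or.inr hk
  rw [twE_last c hN]
  simp only [map_smul, map_sub, actE_mul, hA, actK_gen, FGen.elim, wt_succ hk, actE_actK N k,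
    cartan_adj ha, neg_neg, zpow_one, zpow_neg, smul_mul_assoc, mul_smul_comm]

theorem serre_last {k N : Fin n} (hk : (k : ℕ) + 1 = N) (c : ℂˣ) (hN : (N : ℕ) + 1 = n)
    (x : BallAlg n q) :
    actE q k (actE q k (twE q c N x)) = (qc q + (qc q)⁻¹) • actE q k (twE q c N (actE q k x))
      - twE q c N (actE q k (actE q k x)) := by
  have hq := qc_ne_zero q
  have hA := actE_gen_low (q := q) hk (.z N)
  have hB := actE_gen_low (q := q) hk (.z k)
  have ne : k ≠ N := fun e => by have := congrArg Fin.val e; lia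
  simp only [FGen.elim, Ez, if_pos, if_neg ne] at hA hB
  have ha : Adj N k := Or.inr hk
  have e1 : ∀ y, actE q k (actK q N y) = qc q • actK q N (actE q k y) := fun y => by
    rw [actE_actK, cartan_adj ha, neg_neg, zpow_one]
  have e2 : ∀ y, actE q k (actK q k y) = (qc q * qc q)⁻¹ • actK q k (actE q k y) := fun y => by
    rw [actE_actK, cartan_self, zpow_neg, zpow_two]
  rw [actE_z_last hk c hN, actE_z_last hk c hN, twE_last c hN]
  simp only [map_smul, map_sub, map_add, actE_mul, hA, hB, actK_gen, FGen.elim, wt_succ hk,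
    wt_self_of_lt hk, e1, e2, zpow_neg, zpow_one, smul_mul_assoc, mul_smul_comm, mul_zero,
    zero_mul, smul_zero, add_zero, zero_add, actK_actK N k, smul_smul, smul_add, smul_sub]
  match_scalars <;> field_simp <;> ring

theorem serre_last' {k N : Fin n} (hk : (k : ℕ) + 1 = N) (c : ℂˣ) (hN : (N : ℕ) + 1 = n)
    (x : BallAlg n q) :
    twE q c N (twE q c N (actE q k x)) = (qc q + (qc q)⁻¹) • twE q c N (actE q k (twE q c N x))
      - actE q k (twE q c N (twE q c N x)) := by
  have hq := qc_ne_zero q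
  have h := (BallAlg.relations n q).zz k N (Fin.lt_def.2 (by lia))
  have ha : Adj N k := Or.inr hk
  have e1 : ∀ y, actE q k (actK q N y) = qc q • actK q N (actE q k y) := fun y => by
    rw [actE_actK, cartan_adj ha, neg_neg, zpow_one]
  have w1 : wt N N = 2 := by unfold wt; rw [if_pos hN, if_pos rfl]
  have w2 : wt N k = 1 := by
    unfold wt; rw [if_pos hN, if_neg]; intro e; have := congrArg Fin.val e; lia
  have h' : ∀ t, z q k * (z q N * t) = qc q • (z q N * (z q k * t)) := fun t => by
    rw [← mul_assoc, h, smul_mul_assoc, mul_assoc]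
  rw [actE_z_last hk c hN x, actE_z_last hk c hN]
  have k1 : ∀ y, twE q c N y = _ := fun y => twE_last c hN y
  simp only [k1, map_smul, map_sub, map_add, map_mul, actE_mul, actK_gen, FGen.elim, wt_succ hk,
    wt_self_of_lt hk, w1, w2, e1, h, h', zpow_neg, zpow_one, zpow_two, smul_mul_assoc,
    mul_smul_comm, mul_assoc, actK_actK N k, smul_smul, smul_add, smul_sub, add_mul, mul_add,
    sub_mul, mul_sub, actE_gen_low hk, Ez, if_pos]
  match_scalars <;> field_simp <;> ring

theorem comm_last {k N : Fin n} (hk : (k : ℕ) + 1 < N) (c : ℂˣ) (hN : (N : ℕ) + 1 = n)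
    (x : BallAlg n q) : actE q k (twE q c N x) = twE q c N (actE q k x) := by
  set k' : Fin n := ⟨k + 1, by lia⟩
  have hkk : (k : ℕ) + 1 = k' := rfl
  have n1 : N ≠ k := fun e => by have := congrArg Fin.val e; lia
  have n2 : N ≠ k' := fun e => by have := congrArg Fin.val e; lia
  have hA := actE_gen_low (q := q) hkk (.z N)
  simp only [FGen.elim, Ez, if_neg n2] at hA
  have a0 : CartanMatrix.A n N k = 0 := by
    simp only [CartanMatrix.A, Matrix.of_apply, if_neg n1]
    exact if_neg (by lia)
  rw [twE_last c hN, twE_last c hN]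
  simp only [map_smul, map_sub, actE_mul, hA, actK_gen, FGen.elim, wt_other hkk n1 n2, zpow_zero,
    one_smul, zero_mul, mul_zero, zero_add, add_zero, actE_actK N k, a0, neg_zero]

theorem EF_last_low {k N : Fin n} (hk : (k : ℕ) + 1 < n) (c : ℂˣ) (hN : (N : ℕ) + 1 = n)
    (x : BallAlg n q) : twE q c N (actF q k x) = actF q k (twE q c N x) := by
  set k' : Fin n := ⟨k + 1, hk⟩
  have hkk : (k : ℕ) + 1 = k' := rfl
  have n1 : N ≠ k := fun e => by have := congrArg Fin.val e; lia
  have hA := actF_gen_low (q := q) hkk (.z N)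
  simp only [FGen.elim, if_neg n1] at hA
  rw [twE_last c hN, twE_last c hN]
  simp only [map_smul, map_sub, actF_mul, hA, actL_gen, FGen.elim, zero_mul, mul_zero, zero_add,
    add_zero, actK_actF, wt_last k hN, cartan_symm N k, smul_mul_assoc, mul_smul_comm]

theorem EF_low_last {k N : Fin n} (hk : (k : ℕ) + 1 < n) (hN : (N : ℕ) + 1 = n)
    (x : BallAlg n q) : actE q k (actF q N x) = actF q N (actE q k x) := by
  set k' : Fin n := ⟨k + 1, hk⟩
  have hkk : (k : ℕ) + 1 = k' := rfl
  have n1 : N ≠ k := fun e => by have := congrArg Fin.val e; lia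
  have hA := actE_gen_low (q := q) hkk (.zs N)
  simp only [FGen.elim, Ezs, if_neg n1] at hA
  rw [actF_last hN, actF_last hN]
  simp only [map_smul, map_sub, actE_mul, hA, actK_gen, FGen.elim, zero_mul, mul_zero, zero_add,
    add_zero, actE_actL, wt_last k hN, cartan_symm N k, smul_mul_assoc, mul_smul_comm, smul_smul,
    ← zpow_add₀ (qc_ne_zero q), neg_add_cancel, add_neg_cancel, zpow_zero, one_smul]

theorem EF_last {N : Fin n} (c : ℂˣ) (hN : (N : ℕ) + 1 = n) (x : BallAlg n q) :
    twE q c N (actF q N x) = actF q N (twE q c N x)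
      + (qc q - (qc q)⁻¹)⁻¹ • ((c : ℂ) ^ 2 • actK q N x - actL q N x) := by
  have hq := qc_ne_zero q
  have hs := sq_ne_zero q
  have hss := (sq_mul_sq q).symm
  have hq2 := one_sub_qc_sq_ne_zero q
  have hq3 : qc q ^ 2 - 1 ≠ 0 := fun h => hq2 (by linear_combination -h)
  have hd : qc q - (qc q)⁻¹ ≠ 0 := by
    intro h; apply hq2; field_simp at h; linear_combination -h
  have w1 : wt N N = 2 := by unfold wt; rw [if_pos hN, if_pos rfl]
  have hz := (BallAlg.relations n q).sz' N
  have hI : Finset.Ioi N = ∅ := Finset.eq_empty_of_forall_notMem fun i hi => by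
    rw [Finset.mem_Ioi, Fin.lt_def] at hi
    have := i.2
    lia
  rw [hI, Finset.sum_empty, sub_zero] at hz
  have hz' : ∀ t, zs q N * (z q N * t) =
      qc q ^ 2 • (z q N * (zs q N * t)) + (1 - qc q ^ 2) • t := fun t => by
    rw [← mul_assoc, hz, add_mul, smul_mul_assoc, smul_mul_assoc, one_mul, mul_assoc]
  have k1 : ∀ y, twE q c N y = _ := fun y => twE_last c hN y
  have k2 : ∀ y : BallAlg n q, actF q N y = _ := fun y => actF_last hN y
  have e2 : ∀ y : BallAlg n q, actL q N (actK q N y) = y := actL_actK_self N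
  have e3 : ∀ y : BallAlg n q, actK q N (actL q N y) = y := fun y => by
    rw [actK_actL, actL_actK_self]
  have hm : qc q ^ (-2 : ℤ) - 1 = (1 - qc q ^ 2) / qc q ^ 2 := by
    rw [zpow_neg]; field_simp
  simp only [k1, k2, hm, map_smul, map_sub, map_mul, actK_gen, actL_gen, FGen.elim, w1, e2, e3,
    zpow_neg, zpow_two, smul_mul_assoc, mul_smul_comm, mul_assoc, hz, hz', smul_smul, smul_add,
    smul_sub, add_mul, mul_add, sub_mul, mul_sub, mul_one]
  have hs2 : sq q ^ 2 = qc q := by rw [pow_two, hss]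
  match_scalars <;> field_simp <;> first | ring1 | (ring_nf; rw [hs2]; ring1)

/-- `F` in terms of `E`, with a general scalar. -/
theorem actF_eq (k : Fin n) : ∃ s : ℂ, ∀ x : BallAlg n q,
    actF q k x = s • conj (actE q k (conj x)) := ⟨_, fun x => actF_apply k x⟩

/-- The twisted operators satisfy the defining relations of `U_q sl_{n+1}`. -/
theorem tw_relations (n : ℕ) (q : QParam) (c : ℂˣ) :
    URelations (A := Module.End ℂ (BallAlg n q)) q (twE q c) (twF q c) (twK q c) (twL q c) := by
  have hq := qc_ne_zero q
  have low : ∀ k : Fin n, ¬ (k : ℕ) + 1 < n → (k : ℕ) + 1 = n := fun k h => by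
    have := k.2; lia
  have eqlast : ∀ i j : Fin n, (i : ℕ) + 1 = n → (j : ℕ) + 1 = n → i = j := fun i j a b =>
    Fin.ext (by lia)
  -- the relations between the `E k`
  have SE : ∀ (c : ℂˣ) (i j : Fin n), Adj i j → ∀ x : BallAlg n q,
      twE q c i (twE q c i (twE q c j x)) =
        (qc q + (qc q)⁻¹) • twE q c i (twE q c j (twE q c i x))
        - twE q c j (twE q c i (twE q c i x)) := by
    intro c i j a x
    by_cases hi : (i : ℕ) + 1 < n
    · by_cases hj : (j : ℕ) + 1 < n
      · simp only [twE_low c hi, twE_low c hj]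
        exact serre_low a hi hj x
      · have hN := low j hj
        simp only [twE_low c hi]
        exact serre_last (by rcases a with h | h <;> lia) c hN x
    · have hN := low i hi
      have hj : (j : ℕ) + 1 < n := by have := j.2; rcases a with h | h <;> lia
      simp only [twE_low c hj]
      exact serre_last' (by rcases a with h | h <;> lia) c hN x
  have EE : ∀ (c : ℂˣ) (i j : Fin n), ¬ Adj i j → ∀ x : BallAlg n q,
      twE q c i (twE q c j x) = twE q c j (twE q c i x) := by
    intro c i j a x
    have b : ¬ ((i : ℕ) + 1 = j) ∧ ¬ ((j : ℕ) + 1 = i) := not_or.1 a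
    have := i.2
    have := j.2
    by_cases hi : (i : ℕ) + 1 < n
    · by_cases hj : (j : ℕ) + 1 < n
      · simp only [twE_low c hi, twE_low c hj]
        exact comm_low a hi hj x
      · have hN := low j hj
        simp only [twE_low c hi]
        exact comm_last (by lia) c hN x
    · have hN := low i hi
      by_cases hj : (j : ℕ) + 1 < n
      · simp only [twE_low c hj]
        exact (comm_last (by lia) c hN x).symm
      · rw [eqlast i j hN (low j hj)]
  constructor
  · intro i j
    refine LinearMap.ext fun x => ?_
    simp only [Module.End.mul_apply, twK, LinearMap.smul_apply, AlgHom.toLinearMap_apply, map_smul,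
      actK_actK i j]
    rw [smul_comm]
  · intro i
    refine LinearMap.ext fun x => ?_
    simp only [Module.End.mul_apply, twK, twL, LinearMap.smul_apply, AlgHom.toLinearMap_apply,
      map_smul, actK_actL, actL_actK_self, smul_smul, Module.End.one_apply]
    rw [inv_mul_cancel₀ (Units.ne_zero _), one_smul]
  · intro i
    refine LinearMap.ext fun x => ?_
    simp only [Module.End.mul_apply, twK, twL, LinearMap.smul_apply, AlgHom.toLinearMap_apply,
      map_smul, actL_actK_self, smul_smul, Module.End.one_apply]
    rw [mul_inv_cancel₀ (Units.ne_zero _), one_smul]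
  · intro i j
    refine LinearMap.ext fun x => ?_
    simp only [Module.End.mul_apply, twK, LinearMap.smul_apply, AlgHom.toLinearMap_apply, map_smul]
    rw [smul_comm (qc q ^ _)]
    congr 1
    by_cases hj : (j : ℕ) + 1 < n
    · rw [twE_low c hj, twE_low c hj, actK_actE]
    · have hj' := low j hj
      rw [twE_last c hj', twE_last c hj', map_smul, map_sub, map_mul, map_smul, map_mul, actK_gen,
        FGen.elim, wt_last i hj', actK_actK i j, smul_mul_assoc, mul_smul_comm]
      module
  · intro i j
    refine LinearMap.ext fun x => ?_
    simp only [Module.End.mul_apply, twK, twF, LinearMap.smul_apply, AlgHom.toLinearMap_apply,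
      map_smul, actK_actF i j]
    module
  · intro i
    refine LinearMap.ext fun x => ?_
    simp only [Module.End.mul_apply, twK, twL, twF, LinearMap.smul_apply, LinearMap.sub_apply,
      AlgHom.toLinearMap_apply, map_smul]
    by_cases hi : (i : ℕ) + 1 < n
    · simp only [twE_low c hi, lastScalar, if_pos hi, EF_low hi, Units.val_one, inv_one, one_smul,
        add_sub_cancel_left]
    · rw [EF_last c (low i hi)]
      simp only [lastScalar, if_neg hi]
      have := c.ne_zero
      match_scalars <;> field_simp <;> ring
  · intro i j hij
    refine LinearMap.ext fun x => ?_
    simp only [Module.End.mul_apply, twF, LinearMap.smul_apply, LinearMap.sub_apply,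
      map_smul, LinearMap.zero_apply]
    have : twE q c i (actF q j x) = actF q j (twE q c i x) := by
      by_cases hi : (i : ℕ) + 1 < n
      · rw [twE_low c hi, twE_low c hi]
        by_cases hj : (j : ℕ) + 1 < n
        · exact EF_low_ne hij hi hj x
        · exact EF_low_last hi (low j hj) x
      · by_cases hj : (j : ℕ) + 1 < n
        · exact EF_last_low hj c (low i hi) x
        · exact absurd (eqlast i j (low i hi) (low j hj)) hij
    rw [this, sub_self]
  · intro i j a
    refine LinearMap.ext fun x => ?_
    simp only [LinearMap.add_apply, LinearMap.sub_apply, LinearMap.smul_apply,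
      Module.End.mul_apply, LinearMap.zero_apply, SE c i j a x]
    abel
  · intro i j a
    refine LinearMap.ext fun x => ?_
    obtain ⟨s, hs⟩ := actF_eq (q := q) i
    obtain ⟨t, ht⟩ := actF_eq (q := q) j
    have key := congrArg conj (SE 1 i j a (conj x))
    have hr : starRingEnd ℂ (qc q + (qc q)⁻¹) = qc q + (qc q)⁻¹ := by
      rw [map_add, map_inv₀, star_qc]
    simp only [twE_one, conj_sub, conj_smul, hr] at key
    simp only [LinearMap.add_apply, LinearMap.sub_apply, LinearMap.smul_apply,
      Module.End.mul_apply, LinearMap.zero_apply, twF, map_smul, hs, ht, conj_smul, conj_conj,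
      Complex.conj_conj, key]
    module
  · intro i j a
    refine LinearMap.ext fun x => ?_
    simp only [Module.End.mul_apply, EE c i j a x]
  · intro i j a
    refine LinearMap.ext fun x => ?_
    obtain ⟨s, hs⟩ := actF_eq (q := q) i
    obtain ⟨t, ht⟩ := actF_eq (q := q) j
    have key := congrArg conj (EE 1 i j a (conj x))
    simp only [twE_one] at key
    simp only [LinearMap.smul_apply, Module.End.mul_apply, twF, map_smul, hs, ht, conj_smul,
      conj_conj, Complex.conj_conj, key]
    module

/-- The formulas for the action of the last generators on `z i` and `f0`. -/
theorem actE_gen_last {N : Fin n} (hN : (N : ℕ) + 1 = n) (i : Fin n) :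
    actE q N (z q i) = (-sq q) • (z q N * z q i) := by
  have hq2 := one_sub_qc_sq_ne_zero q
  rw [actE_last hN, actK_gen, FGen.elim, smul_mul_assoc]
  by_cases hi : i = N
  · subst hi
    rw [show wt i i = 2 by unfold wt; rw [if_pos hN, if_pos rfl]]
    match_scalars
    field_simp
  · have hlt : i < N := by
      have := i.2
      have : (i : ℕ) ≠ N := fun e => hi (Fin.ext e)
      rw [Fin.lt_def]; lia
    rw [show wt N i = 1 by unfold wt; rw [if_pos hN, if_neg hi],
      (BallAlg.relations n q).zz i N hlt]
    match_scalars
    field_simp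

theorem actF_gen_last {N : Fin n} (hN : (N : ℕ) + 1 = n) (i : Fin n) :
    actF q N (z q i) = if i = N then algebraMap ℂ _ (sq q) else 0 := by
  have hq := qc_ne_zero q
  have hq2 := one_sub_qc_sq_ne_zero q
  have hm : qc q ^ (-2 : ℤ) - 1 = (1 - qc q ^ 2) / qc q ^ 2 := by
    rw [zpow_neg]; field_simp
  rw [actF_last hN, actL_gen, FGen.elim, mul_smul_comm, hm]
  split_ifs with hi
  · subst hi
    have hI : Finset.Ioi i = ∅ := Finset.eq_empty_of_forall_notMem fun j hj => by
      rw [Finset.mem_Ioi, Fin.lt_def] at hj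
      have := j.2
      lia
    rw [show wt i i = 2 by unfold wt; rw [if_pos hN, if_pos rfl],
      (BallAlg.relations n q).sz' i, hI, Finset.sum_empty, sub_zero, Algebra.algebraMap_eq_smul_one,
      zpow_neg]
    match_scalars <;> field_simp <;> simp
  · rw [show wt N i = 1 by unfold wt; rw [if_pos hN, if_neg hi],
      (BallAlg.relations n q).sz N i (Ne.symm hi), zpow_neg, zpow_one, smul_smul,
      inv_mul_cancel₀ hq, one_smul, sub_self, smul_zero]

theorem actE_f0_last {N : Fin n} (hN : (N : ℕ) + 1 = n) :
    actE q N (f0 n q) = (-(sq q / (1 - qc q ^ 2))) • (z q N * f0 n q) := by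
  rw [actE_last hN, actK_gen, FGen.elim, (BallAlg.relations n q).fz, sub_zero]

theorem actF_f0_last {N : Fin n} (hN : (N : ℕ) + 1 = n) :
    actF q N (f0 n q) = (-(sq q / (qc q ^ (-2 : ℤ) - 1))) • (f0 n q * zs q N) := by
  rw [actF_last hN, actL_gen, FGen.elim, (BallAlg.relations n q).sf, zero_sub, smul_neg]
  exact (neg_smul _ _).symm

end BallAlg

/-- The twisted action of `U_q sl_{n+1}` on `F(U_n)_q` with a general scalar `c`. -/
noncomputable def twAct (n : ℕ) (q : QParam) (c : ℂˣ) :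
    Uq n q →ₐ[ℂ] Module.End ℂ (BallAlg n q) :=
  Uq.lift (BallAlg.tw_relations n q c)

/-- The action of `U_q sl_{n+1}` on `F(U_n)_q`. -/
noncomputable def act (n : ℕ) (q : QParam) : Uq n q →ₐ[ℂ] Module.End ℂ (BallAlg n q) :=
  twAct n q 1

/-- The generators act by the operators `actE`, `actF`, `actK`, `actL`. -/
theorem act_gen {n : ℕ} {q : QParam} (x : UGen n) : act n q (Uq.gen q x) =
    UGen.elim (BallAlg.actE q) (BallAlg.actF q) (fun k => (BallAlg.actK q k).toLinearMap)
      (fun k => (BallAlg.actL q k).toLinearMap) x := by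
  have h : ∀ k : Fin n, BallAlg.lastScalar 1 k = 1 := fun k => by unfold BallAlg.lastScalar; exact ite_self _
  unfold act twAct
  rw [Uq.lift_gen]
  cases x <;> simp only [UGen.elim, BallAlg.twE_one, BallAlg.twF, BallAlg.twK, BallAlg.twL, h,
    Units.val_one, inv_one, one_smul]

/-! ### The Fock representation -/

/-- Multi-indices. -/
abbrev Idx (n : ℕ) := Fin n → ℕ

/-- The space `H` of the Fock representation, with the basis `e m = Finsupp.single m 1`;
the vector `e m` stands for `z^m e 0`, where `z^m = z_n ^ m_n … z_1 ^ m_1`. -/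
abbrev Fock (n : ℕ) := Idx n →₀ ℂ

namespace Fock
variable {n : ℕ} (q : QParam)

/-- `∑ m j` over `j > i`. -/
def above (i : Fin n) (m : Idx n) : ℕ := ∑ j ∈ Finset.Ioi i, m j

/-- `z i e m = q ^ (above i m) e (m + δ i)`. -/
noncomputable def raise (i : Fin n) : Fock n →ₗ[ℂ] Fock n :=
  Finsupp.linearCombination ℂ fun m =>
    qc q ^ above i m • Finsupp.single (m + Pi.single i 1) (1 : ℂ)

/-- `zs i e m = q ^ (above i m) (1 - q ^ (2 m i)) e (m - δ i)`. -/
noncomputable def lower (i : Fin n) : Fock n →ₗ[ℂ] Fock n :=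
  Finsupp.linearCombination ℂ fun m =>
    (qc q ^ above i m * (1 - qc q ^ (2 * m i))) • Finsupp.single (m - Pi.single i 1) (1 : ℂ)

/-- The projection onto the line of the vacuum vector `e 0`. -/
noncomputable def vacuum (n : ℕ) : Fock n →ₗ[ℂ] Fock n :=
  Finsupp.linearCombination ℂ fun m => if m = 0 then Finsupp.single 0 (1 : ℂ) else 0

theorem above_add (i j : Fin n) (m : Idx n) :
    above i (m + Pi.single j 1) = above i m + if i < j then 1 else 0 := by
  simp only [above, Pi.add_apply, Finset.sum_add_distrib, Pi.single_apply, Finset.sum_ite_eq',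
    Finset.mem_Ioi]

theorem raise_single (i : Fin n) (m : Idx n) : raise q i (Finsupp.single m 1) =
    qc q ^ above i m • Finsupp.single (m + Pi.single i 1) (1 : ℂ) := by
  simp [raise]

theorem lower_zero {i : Fin n} {m : Idx n} (h : m i = 0) :
    lower q i (Finsupp.single m 1) = 0 := by
  simp [lower, h]

theorem lower_add (i : Fin n) (m : Idx n) :
    lower q i (Finsupp.single (m + Pi.single i 1) 1) =
      (qc q ^ above i m * (1 - qc q ^ (2 * (m i + 1)))) • Finsupp.single m (1 : ℂ) := by
  have h : m + Pi.single i 1 - Pi.single i 1 = m := add_tsub_cancel_right _ _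
  simp only [lower, Finsupp.linearCombination_single, one_smul, h, above_add, lt_irrefl, if_false,
    add_zero, Pi.add_apply, Pi.single_eq_same]

theorem vacuum_single (m : Idx n) : vacuum n (Finsupp.single m 1) =
    if m = 0 then Finsupp.single 0 1 else 0 := by
  simp [vacuum]

theorem exists_add {i : Fin n} {m : Idx n} (h : m i ≠ 0) : ∃ m' : Idx n, m = m' + (Pi.single i 1 : Idx n) := by
  refine ⟨m - Pi.single i 1, (tsub_add_cancel_of_le ?_).symm⟩
  intro j
  rw [Pi.single_apply]
  split_ifs with e
  · subst e; lia
  · exact Nat.zero_le _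

theorem number (i : Fin n) (m : Idx n) : raise q i (lower q i (Finsupp.single m 1)) =
    (qc q ^ (2 * above i m) * (1 - qc q ^ (2 * m i))) • Finsupp.single m (1 : ℂ) := by
  by_cases h : m i = 0
  · simp [lower_zero q h, h]
  · obtain ⟨m', rfl⟩ := exists_add h
    rw [lower_add, map_smul, raise_single, smul_smul]
    simp only [above_add, lt_irrefl, if_false, add_zero, Pi.add_apply, Pi.single_eq_same]
    congr 1; ring

theorem telescope (j : Fin n) (m : Idx n) :
    ∑ k ∈ Finset.Ioi j, qc q ^ (2 * above k m) * (1 - qc q ^ (2 * m k)) =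
      1 - qc q ^ (2 * above j m) := by
  have h := Finset.prod_add_ordered (Finset.Ioi j) (fun k => qc q ^ (2 * m k))
    (fun k => 1 - qc q ^ (2 * m k))
  simp only [add_sub_cancel, Finset.prod_const_one, mul_one] at h
  have e : ∀ k ∈ Finset.Ioi j, (Finset.Ioi j).filter (fun l => k < l) = Finset.Ioi k := by
    intro k hk
    ext l
    simp only [Finset.mem_filter, Finset.mem_Ioi] at hk ⊢
    exact ⟨fun a => a.2, fun a => ⟨hk.trans a, a⟩⟩
  have e' : ∀ k : Fin n, ∏ l ∈ Finset.Ioi k, qc q ^ (2 * m l) = qc q ^ (2 * above k m) := by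
    intro k
    rw [Finset.prod_pow_eq_pow_sum, above, Finset.mul_sum]
  rw [e' j] at h
  rw [eq_sub_iff_add_eq']
  refine Eq.trans (congrArg _ ?_) h.symm
  refine Finset.sum_congr rfl fun k hk => ?_
  rw [e k hk, e' k, mul_comm]

/-- The operators of the Fock representation satisfy the defining relations of `F(U_n)_q`. -/
theorem relations (n : ℕ) (q : QParam) :
    FRelations (A := Module.End ℂ (Fock n)) q (raise q) (lower q) (vacuum n) := by
  constructor
  · intro i j hij
    ext1 m; refine LinearMap.ext_ring ?_
    simp only [LinearMap.comp_apply, Finsupp.lsingle_apply, Module.End.mul_apply,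
      LinearMap.smul_apply, raise_single, map_smul, above_add, if_pos hij, if_neg hij.not_gt,
      add_right_comm m, smul_smul]
    congr 1; ring
  · intro i j hij
    ext1 m; refine LinearMap.ext_ring ?_
    simp only [LinearMap.comp_apply, Finsupp.lsingle_apply, Module.End.mul_apply,
      LinearMap.smul_apply]
    by_cases hj : m j = 0
    · rw [lower_zero q hj, map_zero, smul_zero]
      by_cases hi : m i = 0
      · rw [lower_zero q hi, map_zero]
      · obtain ⟨m', rfl⟩ := exists_add hi
        rw [lower_add, map_smul, lower_zero q (by simp_all), smul_zero]
    · obtain ⟨m', rfl⟩ := exists_add hj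
      by_cases hi : m' i = 0
      · have hi' : (m' + Pi.single j 1 : Idx n) i = 0 := by simp [hi, hij.ne]
        rw [lower_zero q hi', map_zero, lower_add, map_smul, lower_zero q hi, smul_zero, smul_zero]
      · obtain ⟨m, rfl⟩ := exists_add hi
        rw [lower_add, map_smul, lower_add, add_right_comm, lower_add, map_smul, lower_add]
        simp only [above_add, if_pos hij, if_neg hij.not_gt, add_zero, Pi.add_apply, smul_smul,
          Pi.single_eq_of_ne hij.ne, Pi.single_eq_of_ne hij.ne']
        congr 1; ring
  · intro i j hij
    ext1 m; refine LinearMap.ext_ring ?_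
    simp only [LinearMap.comp_apply, Finsupp.lsingle_apply, Module.End.mul_apply,
      LinearMap.smul_apply]
    by_cases hi : m i = 0
    · have hi' : (m + Pi.single j 1 : Idx n) i = 0 := by simp [hi, hij]
      rw [lower_zero q hi, raise_single, map_smul, lower_zero q hi', map_zero, smul_zero, smul_zero]
    · obtain ⟨m', rfl⟩ := exists_add hi
      rw [raise_single, map_smul, lower_add, add_right_comm, lower_add, map_smul, raise_single]
      simp only [above_add, Pi.add_apply, smul_smul, Pi.single_eq_of_ne hij, add_zero]
      congr 1
      rcases lt_or_gt_of_ne hij with h | h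
      · simp only [if_pos h, if_neg h.not_gt]; ring
      · simp only [if_pos h, if_neg h.not_gt]; ring
  · intro j
    ext1 m; refine LinearMap.ext_ring ?_
    simp only [LinearMap.comp_apply, Finsupp.lsingle_apply, Module.End.mul_apply,
      LinearMap.smul_apply, LinearMap.add_apply, LinearMap.sub_apply, LinearMap.sum_apply,
      Module.End.one_apply, number, ← Finset.sum_smul, telescope]
    rw [raise_single, map_smul, lower_add]
    match_scalars; ring
  · ext1 m; refine LinearMap.ext_ring ?_
    simp only [LinearMap.comp_apply, Finsupp.lsingle_apply, Module.End.mul_apply, vacuum_single]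
    split_ifs
    · rw [vacuum_single, if_pos rfl]
    · rw [map_zero]
  · intro i
    ext1 m; refine LinearMap.ext_ring ?_
    simp only [LinearMap.comp_apply, Finsupp.lsingle_apply, Module.End.mul_apply, vacuum_single]
    split_ifs
    · rw [lower_zero q (by rfl)]; rfl
    · rw [map_zero]; rfl
  · intro i
    ext1 m; refine LinearMap.ext_ring ?_
    simp only [LinearMap.comp_apply, Finsupp.lsingle_apply, Module.End.mul_apply, raise_single,
      map_smul, vacuum_single]
    rw [if_neg, smul_zero]; · rfl
    intro h
    have := congrFun h i
    simp at this

end Fock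

/-- The Fock representation `T` of `F(U_n)_q`. -/
noncomputable def fock (n : ℕ) (q : QParam) : BallAlg n q →ₐ[ℂ] Module.End ℂ (Fock n) :=
  BallAlg.lift (Fock.relations n q)

/-- A subspace stable under the generators is stable under `U_q sl_{n+1}`. -/
theorem Uq.stable {n : ℕ} {q : QParam} {V : Type*} [AddCommGroup V] [Module ℂ V]
    (ρ : Uq n q →ₐ[ℂ] Module.End ℂ V) (W : Submodule ℂ V)
    (h : ∀ x : UGen n, ∀ w ∈ W, ρ (Uq.gen q x) w ∈ W) (ξ : Uq n q) : ∀ w ∈ W, ρ ξ w ∈ W := by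
  obtain ⟨y, rfl⟩ := RingQuot.mkAlgHom_surjective ℂ (URel n q) ξ
  induction y using FreeAlgebra.induction with
  | grade0 c =>
    intro w hw
    rw [AlgHom.commutes, AlgHom.commutes, Module.algebraMap_end_apply]
    exact W.smul_mem c hw
  | grade1 x => exact h x
  | mul a b ha hb =>
    intro w hw
    rw [map_mul, map_mul]
    exact ha _ (hb _ hw)
  | add a b ha hb =>
    intro w hw
    rw [map_add, map_add]
    exact W.add_mem (ha _ hw) (hb _ hw)

/-- The restriction of a representation to a subspace stable under the generators. -/
noncomputable def Uq.restrict {n : ℕ} {q : QParam} {V : Type*} [AddCommGroup V] [Module ℂ V]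
    (ρ : Uq n q →ₐ[ℂ] Module.End ℂ V) (W : Submodule ℂ V)
    (h : ∀ x : UGen n, ∀ w ∈ W, ρ (Uq.gen q x) w ∈ W) : Uq n q →ₐ[ℂ] Module.End ℂ W where
  toFun ξ := (ρ ξ).restrict (Uq.stable ρ W h ξ)
  map_one' := by ext w; simp
  map_mul' a b := by ext w; simp
  map_zero' := by ext w; simp
  map_add' a b := by ext w; simp
  commutes' c := by ext w; simp [Module.algebraMap_end_apply]

namespace BallAlg
variable {n : ℕ} {q : QParam}

/-- The algebra `ℂ[ℂ^n]_q` of holomorphic polynomials: the unital subalgebra generated by the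
elements `z i`. -/
noncomputable def holoAlg (n : ℕ) (q : QParam) : Subalgebra ℂ (BallAlg n q) :=
  Algebra.adjoin ℂ (Set.range (z q))

/-- `ℂ[ℂ^n]_q` as a subspace. -/
noncomputable def holo (n : ℕ) (q : QParam) : Submodule ℂ (BallAlg n q) :=
  Subalgebra.toSubmodule (holoAlg n q)

/-- The space `D(U_n)_q` of finite functions: the two-sided ideal of `F(U_n)_q` generated
by `f0`. -/
noncomputable def finiteFun (n : ℕ) (q : QParam) : Submodule ℂ (BallAlg n q) :=
  Submodule.span ℂ {x | ∃ a b : BallAlg n q, x = a * f0 n q * b}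

theorem z_mem (i : Fin n) : z q i ∈ holoAlg n q := Algebra.subset_adjoin ⟨i, rfl⟩

theorem actK_mem (k : Fin n) {x : BallAlg n q} (hx : x ∈ holoAlg n q) :
    actK q k x ∈ holoAlg n q := by
  induction hx using Algebra.adjoin_induction with
  | mem x hx =>
    obtain ⟨i, rfl⟩ := hx
    rw [actK_gen]
    exact (holoAlg n q).smul_mem (z_mem i) _
  | algebraMap c => rw [AlgHom.commutes]; exact (holoAlg n q).algebraMap_mem c
  | add x y _ _ hx hy => rw [map_add]; exact add_mem hx hy
  | mul x y _ _ hx hy => rw [map_mul]; exact mul_mem hx hy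

theorem actL_mem (k : Fin n) {x : BallAlg n q} (hx : x ∈ holoAlg n q) :
    actL q k x ∈ holoAlg n q := by
  induction hx using Algebra.adjoin_induction with
  | mem x hx =>
    obtain ⟨i, rfl⟩ := hx
    rw [actL_gen]
    exact (holoAlg n q).smul_mem (z_mem i) _
  | algebraMap c => rw [AlgHom.commutes]; exact (holoAlg n q).algebraMap_mem c
  | add x y _ _ hx hy => rw [map_add]; exact add_mem hx hy
  | mul x y _ _ hx hy => rw [map_mul]; exact mul_mem hx hy

theorem actE_mem (k : Fin n) {x : BallAlg n q} (hx : x ∈ holoAlg n q) :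
    actE q k x ∈ holoAlg n q := by
  induction hx using Algebra.adjoin_induction with
  | mem x hx =>
    obtain ⟨i, rfl⟩ := hx
    by_cases hk : (k : ℕ) + 1 < n
    · rw [actE_gen_low (k' := ⟨k + 1, hk⟩) rfl, FGen.elim, Ez]
      split_ifs
      · exact (holoAlg n q).smul_mem (z_mem _) _
      · exact zero_mem _
    · rw [actE_gen_last (by have := k.2; lia)]
      exact (holoAlg n q).smul_mem (mul_mem (z_mem _) (z_mem _)) _
  | algebraMap c => rw [actE_algebraMap]; exact zero_mem _
  | add x y _ _ hx hy => rw [map_add]; exact add_mem hx hy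
  | mul x y hx' hy' hx hy =>
    rw [actE_mul]
    exact add_mem (mul_mem hx hy') (mul_mem (actK_mem k hx') hy)

theorem actF_mem (k : Fin n) {x : BallAlg n q} (hx : x ∈ holoAlg n q) :
    actF q k x ∈ holoAlg n q := by
  induction hx using Algebra.adjoin_induction with
  | mem x hx =>
    obtain ⟨i, rfl⟩ := hx
    by_cases hk : (k : ℕ) + 1 < n
    · rw [actF_gen_low (k' := ⟨k + 1, hk⟩) rfl, FGen.elim]
      split_ifs
      · exact (holoAlg n q).smul_mem (z_mem _) _
      · exact zero_mem _
    · rw [actF_gen_last (by have := k.2; lia)]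
      split_ifs
      · exact (holoAlg n q).algebraMap_mem _
      · exact zero_mem _
  | algebraMap c => rw [actF_algebraMap]; exact zero_mem _
  | add x y _ _ hx hy => rw [map_add]; exact add_mem hx hy
  | mul x y hx' hy' hx hy =>
    rw [actF_mul]
    exact add_mem (mul_mem hx (actL_mem k hy')) (mul_mem hx' hy)

theorem holo_stable (c : ℂˣ) (x : UGen n) :
    ∀ w ∈ holo n q, twAct n q c (Uq.gen q x) w ∈ holo n q := by
  intro w hw
  change _ ∈ holoAlg n q
  replace hw : w ∈ holoAlg n q := hw
  unfold twAct
  rw [Uq.lift_gen]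
  cases x with
  | E k =>
    by_cases hk : (k : ℕ) + 1 < n
    · rw [UGen.elim, twE_low c hk]; exact actE_mem k hw
    · rw [UGen.elim, twE_last c (by have := k.2; lia)]
      exact (holoAlg n q).smul_mem (sub_mem (mul_mem (z_mem _) hw)
        ((holoAlg n q).smul_mem (mul_mem (actK_mem k hw) (z_mem _)) _)) _
  | F k => exact (holoAlg n q).smul_mem (actF_mem k hw) _
  | K k => exact (holoAlg n q).smul_mem (actK_mem k hw) _
  | L k => exact (holoAlg n q).smul_mem (actL_mem k hw) _

theorem finiteFun_mul (a : BallAlg n q) {x : BallAlg n q} (hx : x ∈ finiteFun n q)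
    (b : BallAlg n q) : a * x * b ∈ finiteFun n q := by
  induction hx using Submodule.span_induction with
  | mem x hx =>
    obtain ⟨c, d, rfl⟩ := hx
    exact Submodule.subset_span ⟨a * c, d * b, by simp only [mul_assoc]⟩
  | zero => rw [mul_zero, zero_mul]; exact zero_mem _
  | add x y _ _ hx hy => rw [mul_add, add_mul]; exact add_mem hx hy
  | smul c x _ hx => rw [mul_smul_comm, smul_mul_assoc]; exact Submodule.smul_mem _ c hx

theorem f0_mem : f0 n q ∈ finiteFun n q :=
  Submodule.subset_span ⟨1, 1, by rw [one_mul, mul_one]⟩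

theorem finiteFun_stable (x : UGen n) :
    ∀ w ∈ finiteFun n q, act n q (Uq.gen q x) w ∈ finiteFun n q := by
  have hl : ∀ a {y : BallAlg n q}, y ∈ finiteFun n q → a * y ∈ finiteFun n q := fun a y hy => by
    simpa using finiteFun_mul a hy 1
  have hr : ∀ b {y : BallAlg n q}, y ∈ finiteFun n q → y * b ∈ finiteFun n q := fun b y hy => by
    simpa using finiteFun_mul 1 hy b
  have hE : ∀ k, actE q k (f0 n q) ∈ finiteFun n q := fun k => by
    by_cases hk : (k : ℕ) + 1 < n
    · rw [actE_gen_low (k' := ⟨k + 1, hk⟩) rfl]; exact zero_mem _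
    · rw [actE_f0_last (by have := k.2; lia)]; exact Submodule.smul_mem _ _ (hl _ f0_mem)
  have hF : ∀ k, actF q k (f0 n q) ∈ finiteFun n q := fun k => by
    by_cases hk : (k : ℕ) + 1 < n
    · rw [actF_gen_low (k' := ⟨k + 1, hk⟩) rfl]; exact zero_mem _
    · rw [actF_f0_last (by have := k.2; lia)]; exact Submodule.smul_mem _ _ (hr _ f0_mem)
  have hK : ∀ k, actK q k (f0 n q) = f0 n q := fun k => actK_gen k _
  have hL : ∀ k, actL q k (f0 n q) = f0 n q := fun k => actL_gen k _
  intro w hw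
  rw [act_gen]
  induction hw using Submodule.span_induction with
  | zero => rw [map_zero]; exact zero_mem _
  | add x y _ _ hx hy => rw [map_add]; exact add_mem hx hy
  | smul c x _ hx => rw [map_smul]; exact Submodule.smul_mem _ c hx
  | mem w hw =>
    obtain ⟨a, b, rfl⟩ := hw
    cases x with
    | E k =>
      simp only [UGen.elim, actE_mul, map_mul, hK, add_mul]
      exact add_mem (add_mem (hr _ (hl _ f0_mem)) (hr _ (hl _ (hE k)))) (hr _ (hl _ f0_mem))
    | F k =>
      simp only [UGen.elim, actF_mul, hL, add_mul]
      exact add_mem (add_mem (hr _ (hl _ f0_mem)) (hr _ (hl _ (hF k)))) (hr _ (hl _ f0_mem))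
    | K k =>
      simp only [UGen.elim, AlgHom.toLinearMap_apply, map_mul, hK]
      exact hr _ (hl _ f0_mem)
    | L k =>
      simp only [UGen.elim, AlgHom.toLinearMap_apply, map_mul, hL]
      exact hr _ (hl _ f0_mem)

/-- The monomial `z^m = z_n ^ m_n … z_1 ^ m_1`. -/
noncomputable def zmon (q : QParam) (m : Idx n) : BallAlg n q :=
  ((List.finRange n).map fun i => z q i ^ m i).reverse.prod

theorem zmon_mem (m : Idx n) : zmon q m ∈ holo n q := by
  refine Subalgebra.list_prod_mem (holoAlg n q) fun x hx => ?_
  rw [List.mem_reverse, List.mem_map] at hx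
  obtain ⟨i, -, rfl⟩ := hx
  exact pow_mem (z_mem i) _

/-- The matrix entries of the operator `T(f)` in the basis `e m` of the Fock space. -/
noncomputable def entry (f : BallAlg n q) (p r : Idx n) : ℂ :=
  fock n q f (Finsupp.single r 1) p

/-- The coordinates of `f e 0` in the basis `e m = z^m e 0`; for a holomorphic polynomial
`f = ∑ c m z^m` these are the coefficients `c m`. -/
noncomputable def coeff (m : Idx n) (f : BallAlg n q) : ℂ := entry f m 0

end BallAlg

open BallAlg

/-- `D(U_n)_q` as a type. -/
abbrev FiniteFun (n : ℕ) (q : QParam) := ↥(finiteFun n q)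

/-- The space `End(ℂ[ℂ^n]_q)`. -/
abbrev HoloEnd (n : ℕ) (q : QParam) := Module.End ℂ ↥(holo n q)

/-- The action of `U_q sl_{n+1}` on the space of finite functions. -/
noncomputable def finAct (n : ℕ) (q : QParam) :
    Uq n q →ₐ[ℂ] Module.End ℂ (finiteFun n q) :=
  Uq.restrict (act n q) (finiteFun n q) finiteFun_stable

/-- The scalar `q ^ (α + n + 1)`. -/
noncomputable def twist (n : ℕ) (q : QParam) (α : ℝ) : ℂˣ :=
  Units.mk0 (((q : ℝ) ^ (α + n + 1) : ℝ) : ℂ)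
    (Complex.ofReal_ne_zero.2 (Real.rpow_pos_of_pos q.2.1 _).ne')

/-- The twisted action `π_α` of `U_q sl_{n+1}` on `F(U_n)_q`. -/
noncomputable def piAct (n : ℕ) (q : QParam) (α : ℝ) :
    Uq n q →ₐ[ℂ] Module.End ℂ (BallAlg n q) :=
  twAct n q (twist n q α)

/-- The twisted action `π_α` of `U_q sl_{n+1}` on `ℂ[ℂ^n]_q`. -/
noncomputable def piHolo (n : ℕ) (q : QParam) (α : ℝ) :
    Uq n q →ₐ[ℂ] Module.End ℂ (holo n q) :=
  Uq.restrict (piAct n q α) (holo n q) (holo_stable _)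

/-- The canonical action of `U_q sl_{n+1}` on `End(ℂ[ℂ^n]_q)` for the twisted action `π_α`. -/
noncomputable def endAct (n : ℕ) (q : QParam) (α : ℝ) :
    Uq n q →ₗ[ℂ] Module.End ℂ (HoloEnd n q) :=
  Uq.endAction (V := ↥(holo n q)) (piHolo n q α)

/-! ### Integrals, Toeplitz operators, covariant symbols -/

/-- `(a; q²)_n = ∏ (1 - a q ^ (2 j))` over `0 ≤ j < n`. -/
noncomputable def qPoch (q : QParam) (a : ℝ) (n : ℕ) : ℝ :=
  ∏ j ∈ Finset.range n, (1 - a * (q : ℝ) ^ (2 * j))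

/-- The element `∏ K j ^ (- j (n + 1 - j))`, `j = 1, …, n`. -/
noncomputable def modular (n : ℕ) (q : QParam) : Uq n q :=
  ((List.finRange n).map fun i => Uq.gen q (.L i) ^ (((i : ℕ) + 1) * (n - i))).prod

/-- The invariant integral `∫ f dν_q = (q²; q²)_n tr (T(f) Γ(∏ K j ^ (- j (n + 1 - j))))` of a
finite function `f`, where `Γ(ξ) e m = ξ(z^m) e 0`. (For finite `f` only finitely many
diagonal entries are nonzero.) -/
noncomputable def invInt {n : ℕ} {q : QParam} (f : BallAlg n q) : ℂ :=
  (qPoch q ((q : ℝ) ^ 2) n : ℂ) * ∑ᶠ m : Idx n, coeff m (f * act n q (modular n q) (zmon q m))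

/-- The weight at the point `(q ^ (2 k_1), …, q ^ (2 k_n))` of the `q`-simplex, where
`k_i = ∑ m j` over `j ≥ i`, in the weighted integral `dm_α`:
`q ^ (2 k_1 (α + 1)) q ^ (2 k_2) … q ^ (2 k_n)`. -/
noncomputable def simplexWeight {n : ℕ} (q : QParam) (α : ℝ) (m : Idx n) : ℝ :=
  (q : ℝ) ^ (2 * α * (∑ j, m j : ℕ)) * ∏ i, (q : ℝ) ^ (2 * ∑ j ∈ Finset.Ici i, m j)

/-- The weighted integral `∫ f dm_α` exists and equals `I`. The value of the coefficient
`f_{0,0}` at the point `(q ^ (2 k_1), …, q ^ (2 k_n))`, `k_i = ∑ m j` over `j ≥ i`, is the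
diagonal entry of `T(f)` at `e m`, since `y_i e m = q ^ (2 k_i) e m`. -/
def HasWeightedIntegral {n : ℕ} {q : QParam} (α : ℝ) (f : BallAlg n q) (I : ℂ) : Prop :=
  HasSum (fun m : Idx n =>
    ((qPoch q ((q : ℝ) ^ (2 * α + 2)) n * simplexWeight q α m : ℝ) : ℂ) * entry f m m) I

/-- `A` is the Toeplitz operator `T_f`: for each `ψ` in `ℂ[ℂ^n]_q`, `A ψ` is the orthogonal
projection of `f ψ` to `ℂ[ℂ^n]_q`, i.e. `(f ψ - A ψ, g)_α = 0` for all `g` in `ℂ[ℂ^n]_q`, where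
`(φ₁, φ₂)_α = ∫ φ₂^* φ₁ dm_α`. -/
def IsToeplitz {n : ℕ} {q : QParam} (α : ℝ) (f : BallAlg n q)
    (A : HoloEnd n q) : Prop :=
  ∀ ψ g : holo n q,
    HasWeightedIntegral α (conj (g : BallAlg n q) * (f * (ψ : BallAlg n q) - (A ψ : BallAlg n q))) 0

/-- The `q`-trace `Tr_q A = q ^ (n (n + α + 1)) (q²; q²)_n / (q ^ (2 + 2 α); q²)_n tr_q A`, where
`tr_q A = tr (A π_α(∏ K j ^ (- j (n + 1 - j))))`, of an operator `A` in `ℂ[ℂ^n]_q` whose matrix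
in the basis of monomials has only finitely many nonzero entries. -/
noncomputable def qTrace {n : ℕ} {q : QParam} (α : ℝ) (A : HoloEnd n q) : ℂ :=
  ((((q : ℝ) ^ ((n : ℝ) * (n + α + 1)) * qPoch q ((q : ℝ) ^ 2) n) /
      qPoch q ((q : ℝ) ^ (2 + 2 * α)) n : ℝ) : ℂ) *
    ∑ᶠ m : Idx n,
      coeff m (A (piHolo n q α (modular n q) ⟨zmon q m, zmon_mem m⟩) : BallAlg n q)

/-- The entries of a finite function, as a linear map. -/
noncomputable def entries (n : ℕ) (q : QParam) :
    finiteFun n q →ₗ[ℂ] (Idx n × Idx n → ℂ) where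
  toFun f pr := entry (f : BallAlg n q) pr.1 pr.2
  map_add' f g := by ext; simp [entry]
  map_smul' c f := by ext; simp [entry]

/-- The weakest (uniform) topology on `D(U_n)_q` such that all the matrix entries are continuous.
Up to a nonzero factor, the entry at `(p, r)` is the value of the coefficient `f_{i,j}` of the
expansion `f = ∑ z^i f_{i,j}(y_1, …, y_n) z^{*j}` (over `i`, `j` with disjoint supports) at the
point `(q ^ (2 k_1), …, q ^ (2 k_n))`, where `s = min p r`, `i = p - s`, `j = r - s` and
`k_l = ∑ s t` over `t ≥ l`. -/
noncomputable instance (n : ℕ) (q : QParam) : UniformSpace (finiteFun n q) :=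
  UniformSpace.comap (entries n q) inferInstance

instance (n : ℕ) (q : QParam) : IsUniformAddGroup (finiteFun n q) :=
  IsUniformAddGroup.comap (entries n q)

instance (n : ℕ) (q : QParam) : UniformContinuousConstSMul ℂ (finiteFun n q) :=
  ⟨fun c => uniformContinuous_comap' (by
    have h : (entries n q) ∘ (fun f => c • f) = (fun v => c • v) ∘ entries n q := by
      ext1 f; exact map_smul _ c f
    rw [h]
    refine (uniformContinuous_pi.2 fun i => ?_).comp uniformContinuous_comap
    exact (uniformContinuous_const_smul c).comp (Pi.uniformContinuous_proj _ i))⟩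

/-- The space `D(U_n)'_q` of distributions: the completion of `D(U_n)_q`. -/
abbrev Dist (n : ℕ) (q : QParam) := UniformSpace.Completion (finiteFun n q)

/-- `δ` is the action of `U_q sl_{n+1}` on distributions: the extension by continuity of the
action on finite functions. -/
def IsDistAction {n : ℕ} {q : QParam} (δ : Uq n q →ₐ[ℂ] Module.End ℂ (Dist n q)) : Prop :=
  ∀ ξ, Continuous (δ ξ) ∧ ∀ f : finiteFun n q, δ ξ (f : Dist n q) = (finAct n q ξ f : Dist n q)

/-- The pairing `∫ ψ f dν_q` of a distribution `ψ` and a finite function `f` has the value `I`: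
it is the limit of `∫ χ f dν_q` over the finite functions `χ` tending to `ψ`. -/
def HasPairing {n : ℕ} {q : QParam} (ψ : Dist n q) (f : finiteFun n q) (I : ℂ) : Prop :=
  Filter.Tendsto (fun χ : finiteFun n q => invInt ((χ : BallAlg n q) * (f : BallAlg n q)))
    (Filter.comap (fun χ : finiteFun n q => (χ : Dist n q)) (nhds ψ)) (nhds I)

/-- `ψ` is the covariant symbol of `A`: `∫ ψ f dν_q = Tr_q (A T_f)` for all finite `f`. -/
def IsCovariantSymbol {n : ℕ} {q : QParam} (α : ℝ) (A : HoloEnd n q)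
    (ψ : Dist n q) : Prop :=
  ∀ (f : finiteFun n q) (Tf : HoloEnd n q), IsToeplitz α (f : BallAlg n q) Tf →
    HasPairing ψ f (qTrace α (A * Tf))


end QBall

/-! ### Weighted shifts and diagonal operators in the Fock space. -/

namespace QBall

open Finsupp (single)

namespace Fock
variable {n : ℕ} {q : QParam}

/-! Everything is transported to the Fock space with its basis `e m`. There the `K j` are diagonal
and the `E k`, `F k` are governed by weighted shifts `e (s + u) ↦ b s • e (s + v)` (`IsShift`). By
`fock_actE` and `fock_actF`, the action of `E k` on functions becomes a twisted commutator `X ↦ B X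
- κ X κ⁻¹ B`, and that of `F k` becomes `X ↦ (B X - X B) κ`, where `B` is such a shift and `κ` is
the diagonal operator of `K k`. A weighted trace `∑ W m * X m m` vanishes on these expressions as
soon as `W κ` takes the same value at `s + u` and at `s + v`, provided the sums converge
(`hasSum_commE`, `hasSum_commF`). All invariance statements reduce to this balance.

Toeplitz operators. In the product `(·,·)_α` the monomials are orthogonal with positive norms, and
`T(f)` is a band matrix (`exists_band`), so every element of `F` has a polynomial orthogonal
projection; this gives existence and uniqueness of `T_f`. The weight of `dm_α` is balanced at all
nodes but the last. At the last node `z n` and its adjoint can be moved cyclically under the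
integral at the price of a scalar, and the twist `q^(α+n+1)` in `π_α` is exactly what compensates
this scalar. Hence the orthogonal complement of `ℂ[z]` is stable under `π_α` (`Perp.twAct`), the
projection commutes with `π_α` (`proj_act`), and since `π_α(ξ)(f ψ) = ∑ ξ'(f) π_α(ξ'')(ψ)`, the
Toeplitz map is a morphism (`toeplitz_act`).

Symbols. Up to nonzero constants, `∫ dν` and `Tr_q` are both the trace with the weight of `∏ K j ^
(- j (n + 1 - j))`, that is `K` to the power minus the sum of the positive roots. This weight is
balanced at every node (`modWeight_balance`, from `sum_cartan`), and convergence is no issue because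
only finitely many columns are nonzero. Invariance together with the Leibniz rules moves `ξ` across
a product as `S(ξ)`: `∫ ξ(χ) f dν = ∫ χ S(ξ)(f) dν` and `Tr_q(ξ(A) T) = Tr_q(A S(ξ)(T))`
(`invInt_act_mul`, `qTrace_endHolo_mul`, on generators).

Finally, `D'` is the space of all infinite matrices (`denseRange_entries`), and pairing with a
matrix unit reads off one entry (`pairVal_munit`), so `σ(A)` exists, is unique, and can be written
down entry by entry. Pairing `ξ(σ(A))` with `f` gives `Tr_q(A T_{S(ξ)f}) = Tr_q(A S(ξ)(T_f)) =
Tr_q(ξ(A) T_f)`, which is equivariance of `σ` (`symbol_endHolo`); `B` is the composite. Faithfulness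
of `T` on `D` is never needed, because the traces depend on `f` through `T(f)` only. -/

theorem end_ext {A B : Module.End ℂ (Fock n)}
    (h : ∀ m, A (single m 1) = B (single m 1)) : A = B := by
  ext1 m
  exact LinearMap.ext_ring (h m)

/-- Coordinates of `A x` in terms of those of `x`. -/
theorem coord_eq_sum (A : Module.End ℂ (Fock n)) (x : Fock n) {S : Finset (Idx n)}
    (hS : x.support ⊆ S) (p : Idx n) : (A x) p = ∑ m ∈ S, x m * (A (single m 1)) p := by
  have h : x = ∑ m ∈ S, x m • single m (1 : ℂ) := by
    conv_lhs => rw [← Finsupp.sum_single x, Finsupp.sum_of_support_subset x hS _ (by simp)]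
    simp
  conv_lhs => rw [h]
  simp [Finsupp.finsetSum_apply, -Finsupp.smul_single]

/-- The operator `B` sends `e (s + u)` to `b s e (s + v)` and annihilates the other basis
vectors. -/
structure IsShift (u v : Idx n) (b : Idx n → ℂ) (B : Module.End ℂ (Fock n)) : Prop where
  apply_add : ∀ s, B (single (s + u) 1) = b s • single (s + v) 1
  apply_zero : ∀ m, ¬ u ≤ m → B (single m 1) = 0

namespace IsShift
variable {u v : Idx n} {b : Idx n → ℂ} {B : Module.End ℂ (Fock n)}

theorem coord_add (h : IsShift u v b B) (x : Fock n) (s : Idx n) :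
    (B x) (s + v) = b s * x (s + u) := by
  induction x using Finsupp.induction_linear with
  | zero => simp
  | add x y hx hy => simp [hx, hy, mul_add]
  | single m c =>
    rw [← mul_one c, ← smul_eq_mul, ← Finsupp.smul_single, map_smul]
    by_cases hm : u ≤ m
    · obtain ⟨t, rfl⟩ : ∃ t, m = t + u := ⟨m - u, (tsub_add_cancel_of_le hm).symm⟩
      rw [h.apply_add]
      by_cases hst : t = s
      · subst hst; simp [mul_comm]
      · simp [hst]
    · rw [h.apply_zero m hm]
      have : m ≠ s + u := fun e => hm (e ▸ le_add_self)
      simp [this]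

theorem coord_zero (h : IsShift u v b B) (x : Fock n) {p : Idx n} (hp : ¬ v ≤ p) :
    (B x) p = 0 := by
  induction x using Finsupp.induction_linear with
  | zero => simp
  | add x y hx hy => simp [hx, hy]
  | single m c =>
    rw [← mul_one c, ← smul_eq_mul, ← Finsupp.smul_single, map_smul]
    by_cases hm : u ≤ m
    · obtain ⟨t, rfl⟩ : ∃ t, m = t + u := ⟨m - u, (tsub_add_cancel_of_le hm).symm⟩
      have : t + v ≠ p := fun e => hp (e ▸ le_add_self)
      rw [h.apply_add]
      simp [this]
    · rw [h.apply_zero m hm]; simp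

theorem smul (h : IsShift u v b B) (c : ℂ) : IsShift u v (fun s => c * b s) (c • B) where
  apply_add s := by rw [LinearMap.smul_apply, h.apply_add, smul_smul]
  apply_zero m hm := by rw [LinearMap.smul_apply, h.apply_zero m hm, smul_zero]

/-- The diagonal entry of `B X` at `m` vanishes unless `m = s + v`, so the trace is a sum over `s`.
In `hasSum_mul_right` the trace of `X B` becomes a sum of the same products `b s * X (s+u, s+v)`;
only the argument of the weight differs, `s + v` against `s + u`. This is cyclicity of the trace
made explicit for a shift. -/
theorem hasSum_mul_left (h : IsShift u v b B) (W : Idx n → ℂ) (X : Module.End ℂ (Fock n)) {a : ℂ}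
    (ha : HasSum (fun s => W (s + v) * (b s * (X (single (s + v) 1)) (s + u))) a) :
    HasSum (fun m => W m * ((B * X) (single m 1)) m) a := by
  refine ((add_left_injective v).hasSum_iff fun m hm => ?_).1 ?_
  · rw [Module.End.mul_apply, h.coord_zero, mul_zero]
    exact fun hv => hm ⟨m - v, tsub_add_cancel_of_le hv⟩
  · simpa only [Function.comp_def, Module.End.mul_apply, h.coord_add] using ha

theorem hasSum_mul_right (h : IsShift u v b B) (W : Idx n → ℂ) (X : Module.End ℂ (Fock n)) {a : ℂ}
    (ha : HasSum (fun s => W (s + u) * (b s * (X (single (s + v) 1)) (s + u))) a) :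
    HasSum (fun m => W m * ((X * B) (single m 1)) m) a := by
  refine ((add_left_injective u).hasSum_iff fun m hm => ?_).1 ?_
  · rw [Module.End.mul_apply, h.apply_zero, map_zero, Finsupp.zero_apply, mul_zero]
    exact fun hv => hm ⟨m - u, tsub_add_cancel_of_le hv⟩
  · simpa only [Function.comp_def, Module.End.mul_apply, h.apply_add, map_smul,
      Finsupp.smul_apply, smul_eq_mul] using ha

end IsShift

/-- The diagonal operator with the eigenvalues `d m`. -/
noncomputable def diag (d : Idx n → ℂ) : Module.End ℂ (Fock n) :=
  Finsupp.linearCombination ℂ fun m => d m • single m (1 : ℂ)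

theorem diag_single (d : Idx n → ℂ) (m : Idx n) :
    diag d (single m 1) = d m • single m 1 := by
  simp [diag]

theorem isShift_diag (d : Idx n → ℂ) : IsShift 0 0 d (diag d) where
  apply_add s := by rw [add_zero, diag_single]
  apply_zero m hm := absurd (fun _ => Nat.zero_le _) hm

theorem diag_coord (d : Idx n → ℂ) (x : Fock n) (m : Idx n) : (diag d x) m = d m * x m :=
  (isShift_diag d).coord_add x m

theorem diag_mul_diag (d d' : Idx n → ℂ) : diag d * diag d' = diag (d * d') := by
  refine end_ext fun m => ?_
  rw [Module.End.mul_apply, diag_single, map_smul, diag_single, diag_single, smul_smul, mul_comm]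
  rfl

theorem diag_one : diag (1 : Idx n → ℂ) = 1 := by
  refine end_ext fun m => ?_
  rw [diag_single, Pi.one_apply, one_smul, Module.End.one_apply]

theorem diag_mul_diag_inv {d : Idx n → ℂ} (h : ∀ m, d m ≠ 0) : diag d * diag d⁻¹ = 1 := by
  rw [diag_mul_diag, ← diag_one]
  congr 1
  ext m
  exact mul_inv_cancel₀ (h m)

theorem diag_inv_mul_diag {d : Idx n → ℂ} (h : ∀ m, d m ≠ 0) : diag d⁻¹ * diag d = 1 := by
  rw [diag_mul_diag, ← diag_one]
  congr 1
  ext m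
  exact inv_mul_cancel₀ (h m)

namespace IsShift
variable {u v : Idx n} {b : Idx n → ℂ} {B : Module.End ℂ (Fock n)}

theorem mul_diag (h : IsShift u v b B) (d : Idx n → ℂ) :
    IsShift u v (fun s => d (s + u) * b s) (B * diag d) where
  apply_add s := by
    rw [Module.End.mul_apply, diag_single, map_smul, h.apply_add, smul_smul]
  apply_zero m hm := by
    rw [Module.End.mul_apply, diag_single, map_smul, h.apply_zero m hm, smul_zero]

/-- The weighted trace of a `q`-commutator vanishes (the form for the generators `E`). -/
theorem hasSum_commE (h : IsShift u v b B) {κ W : Idx n → ℂ} (hκ : ∀ m, κ m ≠ 0)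
    (hW : ∀ s, W (s + v) * κ (s + v) = W (s + u) * κ (s + u)) (X : Module.End ℂ (Fock n))
    (hs : Summable fun s => W (s + v) * (b s * (X (single (s + v) 1)) (s + u))) :
    HasSum (fun m => W m * ((B * X - diag κ * X * diag κ⁻¹ * B) (single m 1)) m) 0 := by
  obtain ⟨a, ha⟩ := hs
  have h1 := h.hasSum_mul_left W X ha
  -- Conjugation by `diag κ` multiplies the entry at `(s + u, s + v)` by `κ (s + u) / κ (s + v)`,
  -- and `hW` turns `W (s + u)` times this factor into `W (s + v)`: the series is the one of `ha`.
  have h2 := h.hasSum_mul_right W (diag κ * X * diag κ⁻¹) (a := a) (by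
    convert ha using 2 with s
    have := hκ (s + v)
    simp only [Module.End.mul_apply, diag_single, map_smul, diag_coord, Finsupp.smul_apply,
      smul_eq_mul, Pi.inv_apply]
    field_simp
    linear_combination -b s * (X (single (s + v) 1)) (s + u) * hW s)
  have h3 := h1.sub h2
  rw [sub_self] at h3
  refine Eq.mp (congrArg (HasSum · 0) (funext fun m => ?_)) h3
  rw [LinearMap.sub_apply, Finsupp.sub_apply, mul_sub]

/-- The weighted trace of a `q`-commutator vanishes (the form for the generators `F`). -/
theorem hasSum_commF (h : IsShift u v b B) {κ W : Idx n → ℂ}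
    (hW : ∀ s, W (s + v) * κ (s + v) = W (s + u) * κ (s + u)) (X : Module.End ℂ (Fock n))
    (hs : Summable fun s => W (s + v) * κ (s + v) * (b s * (X (single (s + v) 1)) (s + u))) :
    HasSum (fun m => W m * (((B * X - X * B) * diag κ) (single m 1)) m) 0 := by
  obtain ⟨a, ha⟩ := hs
  -- The right factor `diag κ` scales column `m` by `κ m`, so it is absorbed into the weight `W κ`;
  -- `hW` says that this new weight does not distinguish `s + v` from `s + u`.
  have h1 := h.hasSum_mul_left (fun m => W m * κ m) X ha
  have h2 := h.hasSum_mul_right (fun m => W m * κ m) X (a := a) (by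
    simpa only [hW] using ha)
  have h3 := h1.sub h2
  rw [sub_self] at h3
  refine Eq.mp (congrArg (HasSum · 0) (funext fun m => ?_)) h3
  rw [Module.End.mul_apply _ (diag κ), diag_single, map_smul, Finsupp.smul_apply,
    LinearMap.sub_apply, Finsupp.sub_apply, smul_eq_mul]
  ring

end IsShift

variable (q) in
theorem isShift_raise (i : Fin n) :
    IsShift 0 (Pi.single i 1) (fun s => qc q ^ above i s) (raise q i) where
  apply_add s := by rw [add_zero, raise_single]
  apply_zero m hm := absurd (fun _ => Nat.zero_le _) hm

variable (q) in
theorem isShift_lower (i : Fin n) :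
    IsShift (Pi.single i 1) 0 (fun s => qc q ^ above i s * (1 - qc q ^ (2 * (s i + 1))))
      (lower q i) where
  apply_add s := by rw [add_zero, lower_add]
  apply_zero m hm := by
    refine lower_zero q (by_contra fun h => hm fun j => ?_)
    rw [Pi.single_apply]
    split_ifs with e
    · subst e; lia
    · exact Nat.zero_le _

open Classical in
/-- The operator with prescribed coefficients. -/
noncomputable def shift (u v : Idx n) (b : Idx n → ℂ) : Module.End ℂ (Fock n) :=
  Finsupp.linearCombination ℂ fun m =>
    if u ≤ m then b (m - u) • single (m - u + v) (1 : ℂ) else 0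

theorem isShift_shift (u v : Idx n) (b : Idx n → ℂ) : IsShift u v b (shift u v b) where
  apply_add s := by simp [shift]
  apply_zero m hm := by simp [shift, hm]

/-- The vector with the coordinate `1` at the index following `k`, zero if `k` is the last
index. -/
def next (k : Fin n) : Idx n :=
  if h : (k : ℕ) + 1 < n then Pi.single ⟨k + 1, h⟩ 1 else 0

theorem next_low {k k' : Fin n} (hk : (k : ℕ) + 1 = k') : next k = Pi.single k' 1 := by
  have h : (k : ℕ) + 1 < n := hk ▸ k'.2
  obtain rfl : k' = ⟨k + 1, h⟩ := Fin.ext hk.symm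
  exact dif_pos h

theorem next_last {k : Fin n} (hk : (k : ℕ) + 1 = n) : next k = 0 := dif_neg (by lia)

/-- The character `∏ (w i) ^ (m i)`. -/
def chr (w : Fin n → ℂˣ) (m : Idx n) : ℂ := ((∏ i, w i ^ m i : ℂˣ) : ℂ)

theorem chr_ne_zero (w : Fin n → ℂˣ) (m : Idx n) : chr w m ≠ 0 := Units.ne_zero _

theorem chr_add (w : Fin n → ℂˣ) (m m' : Idx n) : chr w (m + m') = chr w m * chr w m' := by
  simp only [chr, ← Units.val_mul, ← Finset.prod_mul_distrib, Pi.add_apply, pow_add]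

theorem chr_single (w : Fin n → ℂˣ) (i : Fin n) : chr w (Pi.single i 1) = w i := by
  rw [chr, Finset.prod_eq_single i (by intro j _ h; simp [h]) (by simp)]
  simp

theorem chr_zero (w : Fin n → ℂˣ) : chr w 0 = 1 := by simp [chr]

/-- `T(scale w f)` is conjugate to `T(f)` by a diagonal operator. -/
theorem fock_scale (w : Fin n → ℂˣ) (f : BallAlg n q) :
    fock n q (BallAlg.scale w f) = diag (chr w) * fock n q f * diag (chr w)⁻¹ := by
  have h1 := diag_inv_mul_diag (chr_ne_zero w)
  have h2 := diag_mul_diag_inv (chr_ne_zero w)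
  -- On generators it is easier to verify the relation with the inverse diagonal operator moved to
  -- the other side.
  have mv : ∀ {X Y : Module.End ℂ (Fock n)}, X * diag (chr w) = diag (chr w) * Y →
      X = diag (chr w) * Y * diag (chr w)⁻¹ := fun {X Y} h => by
    rw [← h, mul_assoc, h2, mul_one]
  induction f using BallAlg.induction with
  | hgen x =>
    refine mv (end_ext fun m => ?_)
    rw [BallAlg.scale_gen]
    cases x with
    | z i =>
      simp only [FGen.elim, map_smul, fock, BallAlg.lift_gen, Module.End.mul_apply,
        LinearMap.smul_apply, diag_single, raise_single, chr_add, chr_single, smul_smul]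
      congr 1; ring
    | zs i =>
      simp only [FGen.elim, map_smul, fock, BallAlg.lift_gen, Module.End.mul_apply,
        LinearMap.smul_apply, diag_single]
      by_cases h : m i = 0
      · simp [lower_zero q h]
      · obtain ⟨s, rfl⟩ := exists_add h
        simp only [lower_add, map_smul, diag_single, chr_add, chr_single, smul_smul]
        congr 1
        have := (w i).ne_zero
        field_simp
    | f0 =>
      simp only [FGen.elim, map_smul, fock, BallAlg.lift_gen, Module.End.mul_apply,
        diag_single, vacuum_single]
      split_ifs with h
      · subst h; rw [diag_single]
      · simp
  | hc c =>
    refine mv ?_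
    simp only [AlgHom.commutes]
    exact Algebra.commutes c _
  | hadd x y hx hy => simp only [map_add, hx, hy, mul_add, add_mul]
  | hmul x y hx hy =>
    rw [map_mul, map_mul, hx, hy, map_mul]
    simp only [mul_assoc]
    rw [← mul_assoc (diag (chr w)⁻¹) (diag (chr w)), h1, one_mul]

theorem fock_z (i : Fin n) : fock n q (BallAlg.z q i) = raise q i := BallAlg.lift_gen _ _

theorem fock_zs (i : Fin n) : fock n q (BallAlg.zs q i) = lower q i := BallAlg.lift_gen _ _

theorem fock_f0 : fock n q (BallAlg.f0 n q) = vacuum n := BallAlg.lift_gen _ _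

end Fock
end QBall

/-! ### `E k` and `F k` for `k` not last, as commutators in the Fock space. -/

namespace QBall

open Finsupp (single)
open BallAlg

namespace Fock
variable {n : ℕ} {q : QParam}

/-- The `q`-integer `(q^a - q^{-a}) / (q - q⁻¹)`. -/
noncomputable def qnum (q : QParam) (a : ℕ) : ℂ :=
  (qc q ^ a - (qc q ^ a)⁻¹) / (qc q - (qc q)⁻¹)

theorem qc_sub_inv_ne_zero (q : QParam) : qc q - (qc q)⁻¹ ≠ 0 := by
  have h := one_sub_qc_sq_ne_zero q
  have hq := qc_ne_zero q
  intro h'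
  apply h
  field_simp at h'
  linear_combination -h'

theorem qnum_eq (a : ℕ) :
    qnum q a = qc q * ((qc q ^ a)⁻¹ - qc q ^ a) / (1 - qc q ^ 2) := by
  have h := qc_sub_inv_ne_zero q
  have h2 := one_sub_qc_sq_ne_zero q
  have hq := qc_ne_zero q
  have : 1 - qc q ^ 2 = -(qc q * (qc q - (qc q)⁻¹)) := by field_simp; ring
  rw [qnum, div_eq_div_iff h h2, this]
  ring

theorem above_eq {k k' : Fin n} (hk : (k : ℕ) + 1 = k') (m : Idx n) :
    above k m = m k' + above k' m := by
  have : Finset.Ioi k = insert k' (Finset.Ioi k') := by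
    ext l
    simp only [Finset.mem_Ioi, Finset.mem_insert, Fin.lt_def, Fin.ext_iff]
    lia
  rw [above, this, Finset.sum_insert (by simp), above]

/-- The operator `e m ↦ q^{-1/2} [m k'] e (m - δ k' + δ k)` corresponding to `E k`, where `k'` is
the successor of `k`. -/
noncomputable def lowE (q : QParam) (k k' : Fin n) : Module.End ℂ (Fock n) :=
  shift (Pi.single k' 1) (Pi.single k 1) fun s => (sq q)⁻¹ * qnum q (s k' + 1)

/-- The operator `e m ↦ q^{1/2} [m k] e (m - δ k + δ k')` corresponding to `F k`, where `k'` is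
the successor of `k`. -/
noncomputable def lowF (q : QParam) (k k' : Fin n) : Module.End ℂ (Fock n) :=
  shift (Pi.single k 1) (Pi.single k' 1) fun s => sq q * qnum q (s k + 1)

theorem not_single_le {i : Fin n} {m : Idx n} (h : m i = 0) : ¬ Pi.single i 1 ≤ m := fun hle => by
  have := hle i
  rw [Pi.single_eq_same, h] at this
  lia

/-- The check on the generators `z i` that the twisted derivation `E k` is implemented by the
twisted commutator with `lowE`. The basis vectors killed by `lowE`, those with `m k' = 0`, need a
separate treatment. -/
theorem lowE_z {k k' : Fin n} (hk : (k : ℕ) + 1 = k') (i : Fin n) (m : Idx n) :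
    fock n q (Ez q k k' i) (single m 1) =
      lowE q k k' (raise q i (single m 1))
        - qc q ^ wt k i • raise q i (lowE q k k' (single m 1)) := by
  have hB : IsShift _ _ _ (lowE q k k') := isShift_shift _ _ _
  have hq := qc_ne_zero q
  have hs := sq_ne_zero q
  have hd := qc_sub_inv_ne_zero q
  have hq2 := one_sub_qc_sq_ne_zero q
  have ne : k ≠ k' := fun e => by have := congrArg Fin.val e; lia
  have lt : k < k' := Fin.lt_def.2 (by lia)
  have w1 := wt_self_of_lt hk
  have w2 := wt_succ hk
  have ha := above_eq hk
  unfold Ez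
  by_cases h0 : m k' = 0
  · rw [hB.apply_zero m (not_single_le h0), map_zero, smul_zero, sub_zero, raise_single, map_smul]
    by_cases hi : i = k'
    · subst hi
      rw [if_pos rfl, map_smul, fock_z, LinearMap.smul_apply, raise_single, hB.apply_add, ha, h0]
      simp [qnum, hd, mul_comm]
    · rw [if_neg hi, map_zero, LinearMap.zero_apply, hB.apply_zero, smul_zero]
      exact not_single_le (by simp [h0, Ne.symm hi])
  · obtain ⟨s, rfl⟩ := exists_add h0
    rw [raise_single, hB.apply_add, add_right_comm, map_smul, map_smul, hB.apply_add, raise_single,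
      add_right_comm s (Pi.single k 1)]
    by_cases hi : i = k'
    · subst hi
      rw [if_pos rfl, map_smul, fock_z, LinearMap.smul_apply, raise_single, add_right_comm]
      simp only [smul_smul, ← sub_smul, above_add, lt_irrefl, if_false, add_zero, ha,
        w2, Pi.add_apply, Pi.single_eq_same, lt.not_gt, qnum_eq]
      -- What remains is `[b + 1] - q⁻¹ [b] = q ^ b` for `q`-integers, with `b = s k' + 1`.
      congr 1
      simp only [pow_add, zpow_neg, pow_one, zpow_one]
      field_simp
      ring
    · rw [if_neg hi, map_zero, LinearMap.zero_apply]
      simp only [smul_smul, ← sub_smul, above_add, Pi.add_apply,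
        Pi.single_eq_of_ne (Ne.symm hi), add_zero]
      symm
      refine smul_eq_zero_of_left ?_ _
      -- Both terms must cancel. For `i = k`, the order of the two shifts matters by one factor `q`,
      -- since `k'` lies above `k`, and `wt k k = 1` removes it. For other `i`, the indices `k` and
      -- `k'` lie on the same side of `i`, and the weight is `0`.
      by_cases hi' : i = k
      · subst hi'
        simp only [lt, if_true, lt_irrefl, if_false, w1, pow_add, pow_one, zpow_one]
        ring
      · have : i < k' ↔ i < k := by
          simp only [Fin.lt_def]; simp only [Fin.ext_iff] at hi hi'; lia
        simp only [this, wt_other hk hi' hi, zpow_zero]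
        ring

/-- The counterpart of `lowE_z` for the adjoint generators. Here `lower` also kills vectors, namely
those with a zero coordinate at `i`, so the cases are split a second time. -/
theorem lowE_zs {k k' : Fin n} (hk : (k : ℕ) + 1 = k') (i : Fin n) (m : Idx n) :
    fock n q (Ezs q k k' i) (single m 1) =
      lowE q k k' (lower q i (single m 1))
        - qc q ^ (-wt k i) • lower q i (lowE q k k' (single m 1)) := by
  have hB : IsShift _ _ _ (lowE q k k') := isShift_shift _ _ _
  have hq := qc_ne_zero q
  have hs := sq_ne_zero q
  have hd := qc_sub_inv_ne_zero q
  have hq2 := one_sub_qc_sq_ne_zero q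
  have ne : k ≠ k' := fun e => by have := congrArg Fin.val e; lia
  have lt : k < k' := Fin.lt_def.2 (by lia)
  have w1 := wt_self_of_lt hk
  have w2 := wt_succ hk
  have ha := above_eq hk
  have hq4 : 1 - sq q ^ 4 ≠ 0 := by
    have e : sq q ^ 4 = qc q ^ 2 := by rw [← sq_mul_sq]; ring
    rwa [e]
  unfold Ezs
  by_cases h0 : m k' = 0
  · have hr : lowE q k k' (lower q i (single m 1)) = 0 := by
      by_cases h1 : m i = 0
      · rw [lower_zero q h1, map_zero]
      · obtain ⟨s, rfl⟩ := exists_add h1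
        rw [lower_add, map_smul, hB.apply_zero, smul_zero]
        exact not_single_le (by have : s k' + _ = 0 := h0; lia)
    rw [hr, hB.apply_zero m (not_single_le h0), map_zero, smul_zero, sub_zero]
    split_ifs
    · rw [map_smul, fock_zs, LinearMap.smul_apply, lower_zero q h0, smul_zero]
    · simp
  · obtain ⟨s, rfl⟩ := exists_add h0
    rw [hB.apply_add]
    by_cases hi : i = k
    · subst hi
      rw [if_pos rfl, map_smul, fock_zs, LinearMap.smul_apply, lower_add, map_smul, lower_add]
      by_cases h1 : s i = 0
      · rw [lower_zero q (by simp [h1, ne]), map_zero, zero_sub]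
        simp only [smul_smul, ← neg_smul, ha, w1, h1]
        congr 1
        simp only [qnum_eq, pow_add, zpow_neg, pow_one, zpow_one, pow_mul]
        rw [← sq_mul_sq q]
        field_simp
        ring
      · obtain ⟨t, rfl⟩ := exists_add h1
        rw [add_right_comm, lower_add, map_smul, hB.apply_add]
        simp only [smul_smul, ← sub_smul, above_add, lt_irrefl, if_false, add_zero, ha,
          Pi.add_apply, Pi.single_eq_same, Pi.single_eq_of_ne ne, Pi.single_eq_of_ne ne.symm,
          lt.not_gt, w1]
        congr 1
        simp only [qnum_eq, pow_add, zpow_neg, pow_one, zpow_one, pow_mul]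
        rw [← sq_mul_sq q]
        field_simp
        ring
    · rw [if_neg hi, map_zero, LinearMap.zero_apply]
      by_cases hi' : i = k'
      · subst hi'
        rw [lower_add]
        by_cases h1 : s i = 0
        · rw [map_smul (lower q i), lower_zero q (by simp [h1, ne.symm]), smul_zero, smul_zero,
            sub_zero, map_smul, hB.apply_zero _ (not_single_le h1), smul_zero]
        · obtain ⟨t, rfl⟩ := exists_add h1
          rw [map_smul, hB.apply_add, add_right_comm, map_smul, lower_add]
          simp only [smul_smul, ← sub_smul]
          symm
          refine smul_eq_zero_of_left ?_ _
          simp only [above_add, lt_irrefl, if_false, add_zero,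
            Pi.add_apply, Pi.single_eq_same, Pi.single_eq_of_ne ne.symm,
            lt.not_gt, w2, neg_neg, qnum_eq, pow_add, zpow_one, pow_one, pow_mul]
          field_simp
          ring
      · by_cases h1 : s i = 0
        · rw [lower_zero q (by simp [h1, hi']), map_zero, map_smul, lower_zero q (by simp [h1, hi])]
          simp
        · obtain ⟨t, rfl⟩ := exists_add h1
          rw [add_right_comm, lower_add, map_smul, hB.apply_add, add_right_comm, map_smul,
            lower_add]
          simp only [smul_smul, ← sub_smul]
          symm
          refine smul_eq_zero_of_left ?_ _
          have : i < k' ↔ i < k := by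
            simp only [Fin.lt_def]; simp only [Fin.ext_iff] at hi hi'; lia
          simp only [above_add, this, wt_other hk hi hi', neg_zero, zpow_zero, Pi.add_apply,
            Pi.single_eq_of_ne hi, Pi.single_eq_of_ne hi', Pi.single_eq_of_ne (Ne.symm hi'),
            add_zero]
          ring

theorem chr_weight_low {k k' : Fin n} (hk : (k : ℕ) + 1 = k') (m : Idx n) :
    chr (weight q k) m = qc q ^ m k * (qc q ^ m k')⁻¹ := by
  have ne : k ≠ k' := fun e => by have := congrArg Fin.val e; lia
  rw [chr, Finset.prod_eq_mul k k' ne]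
  · rw [Units.val_mul, Units.val_pow_eq_pow_val, Units.val_pow_eq_pow_val, weight_val, weight_val,
      wt_self_of_lt hk, wt_succ hk, zpow_one, zpow_neg_one, inv_pow]
  · rintro i - ⟨h1, h2⟩
    rw [weight, wt_other hk h1 h2, zpow_zero, one_pow]
  · simp
  · simp

/-- `F k` satisfies the Leibniz rule with `K⁻¹` on the right, so it is modelled by an ordinary
commutator followed by `K`; the scalar `chr (weight q k) m` is the eigenvalue of `K k` at `e m`. The
identity behind the case `i = k` is `[b + 1] - q [b] = q ^ (-b)`. -/
theorem lowF_z {k k' : Fin n} (hk : (k : ℕ) + 1 = k') (i : Fin n) (m : Idx n) :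
    fock n q (if i = k then sq q • z q k' else 0) (single m 1) =
      chr (weight q k) m • (lowF q k k' (raise q i (single m 1))
        - raise q i (lowF q k k' (single m 1))) := by
  have hB : IsShift _ _ _ (lowF q k k') := isShift_shift _ _ _
  have hq := qc_ne_zero q
  have hs := sq_ne_zero q
  have hd := qc_sub_inv_ne_zero q
  have hq2 := one_sub_qc_sq_ne_zero q
  have ne : k ≠ k' := fun e => by have := congrArg Fin.val e; lia
  have lt : k < k' := Fin.lt_def.2 (by lia)
  have ha := above_eq hk
  rw [chr_weight_low hk]
  by_cases h0 : m k = 0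
  · rw [hB.apply_zero m (not_single_le h0), map_zero, sub_zero, raise_single, map_smul]
    by_cases hi : i = k
    · subst hi
      rw [if_pos rfl, map_smul, fock_z, LinearMap.smul_apply, raise_single, hB.apply_add, ha, h0]
      simp only [smul_smul]
      congr 1
      simp only [qnum, zero_add, pow_one, div_self hd, pow_add]
      field_simp
    · rw [if_neg hi, map_zero, LinearMap.zero_apply, hB.apply_zero, smul_zero, smul_zero]
      exact not_single_le (by simp [h0, Ne.symm hi])
  · obtain ⟨s, rfl⟩ := exists_add h0
    rw [raise_single, hB.apply_add, add_right_comm, map_smul, map_smul, hB.apply_add, raise_single,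
      add_right_comm s (Pi.single k' 1)]
    by_cases hi : i = k
    · subst hi
      rw [if_pos rfl, map_smul, fock_z, LinearMap.smul_apply, raise_single, add_right_comm]
      simp only [smul_smul, ← sub_smul, above_add, lt_irrefl, if_false, add_zero, ha,
        Pi.add_apply, Pi.single_eq_same, Pi.single_eq_of_ne ne.symm, lt.not_gt, qnum_eq]
      congr 1
      simp only [pow_add, pow_one]
      field_simp
      ring
    · rw [if_neg hi, map_zero, LinearMap.zero_apply]
      simp only [smul_smul, ← sub_smul, above_add, Pi.add_apply,
        Pi.single_eq_of_ne (Ne.symm hi), add_zero]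
      symm
      refine smul_eq_zero_of_left ?_ _
      have : i < k ↔ i < k' := by
        simp only [Fin.lt_def]; simp only [Fin.ext_iff] at hi; lia
      simp only [this]
      ring

/-- The remaining generators for `F k`. Now the case `i = k'` is the one with a nonzero result,
because the conjugation exchanges the roles of the two indices. -/
theorem lowF_zs {k k' : Fin n} (hk : (k : ℕ) + 1 = k') (i : Fin n) (m : Idx n) :
    fock n q (if i = k' then (-sq q ^ 3) • zs q k else 0) (single m 1) =
      chr (weight q k) m • (lowF q k k' (lower q i (single m 1))
        - lower q i (lowF q k k' (single m 1))) := by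
  have hB : IsShift _ _ _ (lowF q k k') := isShift_shift _ _ _
  have hq := qc_ne_zero q
  have hs := sq_ne_zero q
  have hq2 := one_sub_qc_sq_ne_zero q
  have ne : k ≠ k' := fun e => by have := congrArg Fin.val e; lia
  have lt : k < k' := Fin.lt_def.2 (by lia)
  have ha := above_eq hk
  have hq4 : 1 - sq q ^ 4 ≠ 0 := by
    have e : sq q ^ 4 = qc q ^ 2 := by rw [← sq_mul_sq]; ring
    rwa [e]
  rw [chr_weight_low hk]
  by_cases h0 : m k = 0
  · have hr : lowF q k k' (lower q i (single m 1)) = 0 := by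
      by_cases h1 : m i = 0
      · rw [lower_zero q h1, map_zero]
      · obtain ⟨s, rfl⟩ := exists_add h1
        rw [lower_add, map_smul, hB.apply_zero, smul_zero]
        exact not_single_le (by have : s k + _ = 0 := h0; lia)
    rw [hr, hB.apply_zero m (not_single_le h0), map_zero, sub_zero, smul_zero]
    split_ifs
    · rw [map_smul, fock_zs, LinearMap.smul_apply, lower_zero q h0, smul_zero]
    · simp
  · obtain ⟨s, rfl⟩ := exists_add h0
    rw [hB.apply_add]
    by_cases hi : i = k'
    · subst hi
      rw [if_pos rfl, map_smul, fock_zs, LinearMap.smul_apply, lower_add, map_smul, lower_add]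
      by_cases h1 : s i = 0
      · rw [lower_zero q (by simp [h1, ne.symm]), map_zero, zero_sub]
        simp only [← neg_smul, smul_smul, ha, h1, Pi.add_apply, Pi.single_eq_same,
          Pi.single_eq_of_ne ne.symm]
        congr 1
        simp only [qnum_eq, pow_add, pow_one, pow_mul]
        rw [← sq_mul_sq q]
        field_simp
        ring
      · obtain ⟨t, rfl⟩ := exists_add h1
        rw [add_right_comm, lower_add, map_smul, hB.apply_add]
        simp only [smul_smul, ← sub_smul, above_add, lt_irrefl, if_false, add_zero, ha,
          Pi.add_apply, Pi.single_eq_same, Pi.single_eq_of_ne ne, Pi.single_eq_of_ne ne.symm,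
          lt.not_gt]
        congr 1
        simp only [qnum_eq, pow_add, pow_one, pow_mul]
        rw [← sq_mul_sq q]
        field_simp
        ring
    · rw [if_neg hi, map_zero, LinearMap.zero_apply]
      by_cases hi' : i = k
      · subst hi'
        rw [lower_add]
        by_cases h1 : s i = 0
        · rw [map_smul (lower q i), lower_zero q (by simp [h1, ne]), smul_zero,
            sub_zero, map_smul, hB.apply_zero _ (not_single_le h1), smul_zero, smul_zero]
        · obtain ⟨t, rfl⟩ := exists_add h1
          rw [map_smul, hB.apply_add, add_right_comm t _ (Pi.single k' 1), map_smul, lower_add]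
          simp only [smul_smul, ← sub_smul]
          symm
          refine smul_eq_zero_of_left ?_ _
          simp only [above_add, lt, if_true, lt_irrefl, if_false, add_zero, Pi.add_apply,
            Pi.single_eq_same, Pi.single_eq_of_ne ne, qnum_eq, pow_add, pow_one, pow_mul]
          field_simp
          ring
      · by_cases h1 : s i = 0
        · rw [lower_zero q (by simp [h1, hi']), map_zero, map_smul, lower_zero q (by simp [h1, hi])]
          simp
        · obtain ⟨t, rfl⟩ := exists_add h1
          rw [add_right_comm, lower_add, map_smul, hB.apply_add,
            add_right_comm t _ (Pi.single k' 1), map_smul, lower_add]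
          simp only [smul_smul, ← sub_smul]
          symm
          refine smul_eq_zero_of_left ?_ _
          have : i < k' ↔ i < k := by
            simp only [Fin.lt_def]; simp only [Fin.ext_iff] at hi hi'; lia
          simp only [above_add, this, Pi.add_apply,
            Pi.single_eq_of_ne hi, Pi.single_eq_of_ne hi', Pi.single_eq_of_ne (Ne.symm hi'),
            add_zero]
          ring

end Fock
end QBall

/-! ### The action of all generators as twisted commutators in the Fock space. -/

namespace QBall

open Finsupp (single)
open BallAlg

namespace Fock
variable {n : ℕ} {q : QParam}

theorem end_sub_mul (A B C : Module.End ℂ (Fock n)) : (A - B) * C = A * C - B * C :=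
  LinearMap.ext fun _ => rfl

theorem end_mul_sub (A B C : Module.End ℂ (Fock n)) : A * (B - C) = A * B - A * C :=
  LinearMap.ext fun _ => map_sub A _ _

theorem end_sub_self (A : Module.End ℂ (Fock n)) : A - A = 0 :=
  LinearMap.ext fun _ => sub_self (_ : Fock n)

theorem end_smul_sub (c : ℂ) (A B : Module.End ℂ (Fock n)) : c • (A - B) = c • A - c • B :=
  LinearMap.ext fun _ => smul_sub c (_ : Fock n) _

/-- The operator in the Fock space whose `q`-commutator with `T(f)` is `T(E k f)`. -/
noncomputable def hatE (q : QParam) (k : Fin n) : Module.End ℂ (Fock n) :=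
  if h : (k : ℕ) + 1 < n then lowE q k ⟨k + 1, h⟩ else (-(sq q / (1 - qc q ^ 2))) • raise q k

theorem hatE_low {k k' : Fin n} (hk : (k : ℕ) + 1 = k') : hatE q k = lowE q k k' := by
  have h : (k : ℕ) + 1 < n := hk ▸ k'.2
  obtain rfl : k' = ⟨k + 1, h⟩ := Fin.ext hk.symm
  exact dif_pos h

theorem hatE_last {k : Fin n} (hk : (k : ℕ) + 1 = n) :
    hatE q k = (-(sq q / (1 - qc q ^ 2))) • raise q k := dif_neg (by lia)

/-- The operator in the Fock space whose `q`-commutator with `T(f)` is `T(F k f)`. -/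
noncomputable def hatF (q : QParam) (k : Fin n) : Module.End ℂ (Fock n) :=
  if h : (k : ℕ) + 1 < n then lowF q k ⟨k + 1, h⟩
  else (sq q / (qc q ^ (-2 : ℤ) - 1)) • (lower q k * diag (chr (weight q k))⁻¹)

theorem hatF_low {k k' : Fin n} (hk : (k : ℕ) + 1 = k') : hatF q k = lowF q k k' := by
  have h : (k : ℕ) + 1 < n := hk ▸ k'.2
  obtain rfl : k' = ⟨k + 1, h⟩ := Fin.ext hk.symm
  exact dif_pos h

theorem hatF_last {k : Fin n} (hk : (k : ℕ) + 1 = n) :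
    hatF q k = (sq q / (qc q ^ (-2 : ℤ) - 1)) • (lower q k * diag (chr (weight q k))⁻¹) :=
  dif_neg (by lia)

theorem low_or_last (k : Fin n) : (∃ k' : Fin n, (k : ℕ) + 1 = k') ∨ (k : ℕ) + 1 = n := by
  by_cases h : (k : ℕ) + 1 < n
  · exact Or.inl ⟨⟨k + 1, h⟩, rfl⟩
  · exact Or.inr (by have := k.2; lia)

theorem exists_isShift_hatE (k : Fin n) :
    ∃ b, IsShift (next k) (Pi.single k 1) b (hatE q k) := by
  obtain ⟨k', hk⟩ | hk := low_or_last k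
  · rw [next_low hk, hatE_low hk]
    exact ⟨_, isShift_shift _ _ _⟩
  · rw [next_last hk, hatE_last hk]
    exact ⟨_, (isShift_raise q k).smul _⟩

theorem exists_isShift_hatF (k : Fin n) :
    ∃ b, IsShift (Pi.single k 1) (next k) b (hatF q k) := by
  obtain ⟨k', hk⟩ | hk := low_or_last k
  · rw [next_low hk, hatF_low hk]
    exact ⟨_, isShift_shift _ _ _⟩
  · rw [next_last hk, hatF_last hk]
    exact ⟨_, ((isShift_lower q k).mul_diag _).smul _⟩

theorem fock_actK (k : Fin n) (f : BallAlg n q) : fock n q (actK q k f) =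
    diag (chr (weight q k)) * fock n q f * diag (chr (weight q k))⁻¹ := fock_scale _ f

theorem chr_inv (w : Fin n → ℂˣ) : chr w⁻¹ = (chr w)⁻¹ := by
  ext m
  simp [chr, Finset.prod_inv_distrib]

theorem fock_actL (k : Fin n) (f : BallAlg n q) : fock n q (actL q k f) =
    diag (chr (weight q k))⁻¹ * fock n q f * diag (chr (weight q k)) := by
  rw [actL, fock_scale, chr_inv, inv_inv]

/-- Both sides obey the Leibniz rule `D(x y) = D(x) y + K(x) D(y)` and vanish on scalars, so for `k`
not last the generators suffice. At the last node the action was defined as this inner twisted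
derivation. -/
theorem fock_actE (k : Fin n) (f : BallAlg n q) :
    fock n q (actE q k f) = hatE q k * fock n q f - fock n q (actK q k f) * hatE q k := by
  obtain ⟨k', hk⟩ | hk := low_or_last k
  · rw [hatE_low hk]
    induction f using BallAlg.induction with
    | hgen x =>
      rw [actE_gen_low hk, actK_gen]
      refine end_ext fun m => ?_
      cases x with
      | z i =>
        simpa only [FGen.elim, map_smul, fock_z, LinearMap.sub_apply, Module.End.mul_apply,
          LinearMap.smul_apply] using lowE_z hk i m
      | zs i =>
        simpa only [FGen.elim, map_smul, fock_zs, LinearMap.sub_apply, Module.End.mul_apply,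
          LinearMap.smul_apply] using lowE_zs hk i m
      | f0 =>
        have hB : IsShift _ _ _ (lowE q k k') := isShift_shift _ _ _
        -- `lowE` increases the coordinate `k`, so its image has no component along `e 0`; and it
        -- annihilates `e 0`. Hence both products with the vacuum projection vanish, in agreement
        -- with `E k f0 = 0`.
        have h1 : vacuum n (lowE q k k' (single m 1)) = 0 := by
          by_cases h0 : m k' = 0
          · rw [hB.apply_zero m (not_single_le h0), map_zero]
          · obtain ⟨s, rfl⟩ := exists_add h0
            rw [hB.apply_add, map_smul, vacuum_single, if_neg, smul_zero]
            intro h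
            simpa using congrFun h k
        have h2 : lowE q k k' (vacuum n (single m 1)) = 0 := by
          rw [vacuum_single]
          split_ifs
          · exact hB.apply_zero _ (not_single_le rfl)
          · exact map_zero _
        simp only [FGen.elim, map_zero, fock_f0, LinearMap.sub_apply, Module.End.mul_apply, h1, h2,
          LinearMap.zero_apply, sub_zero]
    | hc c =>
      rw [actE_algebraMap, map_zero, AlgHom.commutes, AlgHom.commutes, AlgHom.commutes,
        Algebra.commutes,
        end_sub_self]
    | hadd x y hx hy => simp only [map_add, hx, hy, mul_add, add_mul]; abel
    | hmul x y hx hy =>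
      rw [actE_mul]
      simp only [map_add, map_mul, hx, hy, end_mul_sub, end_sub_mul, mul_assoc]
      abel
  · rw [hatE_last hk, actE_last hk, map_smul, map_sub, map_mul, map_mul, fock_z, end_smul_sub,
      smul_mul_assoc, mul_smul_comm]

/-- Both sides obey `D(x y) = D(x) K⁻¹(y) + x D(y)`. At the last node the factor `diag (chr (weight
q k))⁻¹` inside `hatF` cancels the final diagonal operator, leaving `z^* K⁻¹(f) - f z^*` up to a
scalar. -/
theorem fock_actF (k : Fin n) (f : BallAlg n q) :
    fock n q (actF q k f) =
      (hatF q k * fock n q f - fock n q f * hatF q k) * diag (chr (weight q k)) := by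
  have hi := diag_mul_diag_inv (chr_ne_zero (weight q k))
  have hi' := diag_inv_mul_diag (chr_ne_zero (weight q k))
  obtain ⟨k', hk⟩ | hk := low_or_last k
  · rw [hatF_low hk]
    induction f using BallAlg.induction with
    | hgen x =>
      rw [actF_gen_low hk]
      refine end_ext fun m => ?_
      cases x with
      | z i =>
        simpa only [FGen.elim, fock_z, LinearMap.sub_apply, Module.End.mul_apply,
          LinearMap.smul_apply, diag_single, map_smul, smul_sub] using lowF_z hk i m
      | zs i =>
        simpa only [FGen.elim, fock_zs, LinearMap.sub_apply, Module.End.mul_apply,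
          LinearMap.smul_apply, diag_single, map_smul, smul_sub] using lowF_zs hk i m
      | f0 =>
        have hB : IsShift _ _ _ (lowF q k k') := isShift_shift _ _ _
        have h1 : vacuum n (lowF q k k' (single m 1)) = 0 := by
          by_cases h0 : m k = 0
          · rw [hB.apply_zero m (not_single_le h0), map_zero]
          · obtain ⟨s, rfl⟩ := exists_add h0
            rw [hB.apply_add, map_smul, vacuum_single, if_neg, smul_zero]
            intro h
            simpa using congrFun h k'
        have h2 : lowF q k k' (vacuum n (single m 1)) = 0 := by
          rw [vacuum_single]
          split_ifs
          · exact hB.apply_zero _ (not_single_le rfl)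
          · exact map_zero _
        simp only [FGen.elim, map_zero, fock_f0, LinearMap.sub_apply, Module.End.mul_apply, h1, h2,
          LinearMap.zero_apply, sub_zero, diag_single, map_smul, smul_zero]
    | hc c =>
      rw [actF_algebraMap, map_zero, AlgHom.commutes, Algebra.commutes,
        end_sub_self, zero_mul]
    | hadd x y hx hy => simp only [map_add, hx, hy, mul_add, add_mul, end_sub_mul]; abel
    | hmul x y hx hy =>
      -- The `K` that ends the image of `F k x` meets the `K⁻¹` that begins that of `K⁻¹(y)`.
      have e : ∀ X Y : Module.End ℂ (Fock n), X * diag (chr (weight q k)) *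
          (diag (chr (weight q k))⁻¹ * Y) = X * Y := fun X Y => by
        rw [mul_assoc, ← mul_assoc (diag (chr (weight q k))), hi, one_mul]
      rw [actF_mul]
      simp only [map_add, map_mul, hx, hy, fock_actL]
      rw [mul_assoc (diag (chr (weight q k))⁻¹), e]
      simp only [end_mul_sub, end_sub_mul, mul_assoc]
      abel
  · rw [hatF_last hk, actF_last hk, map_smul, map_sub, map_mul, map_mul, fock_zs, fock_actL,
      smul_mul_assoc, mul_smul_comm, ← end_smul_sub, smul_mul_assoc, end_sub_mul]
    simp only [mul_assoc, hi', mul_one]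

end Fock

/-! ### Ordered monomials and the identification of `ℂ[z]` with the Fock space. -/

namespace BallAlg
variable {n : ℕ} {q : QParam}

theorem z_mul_pow {i j : Fin n} (h : i < j) (a : ℕ) :
    z q i * z q j ^ a = qc q ^ a • (z q j ^ a * z q i) := by
  induction a with
  | zero => simp
  | succ a ih =>
    rw [pow_succ, ← mul_assoc, ih, smul_mul_assoc, mul_assoc, (BallAlg.relations n q).zz i j h,
      mul_smul_comm, smul_smul, ← mul_assoc, mul_assoc, pow_succ]

/-- The factors come in decreasing order, so `z i` passes exactly the powers `z j ^ m j` with `j >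
i`, each at the cost of `q ^ m j`, before it joins its own power. The induction is on the list,
since the head of the list is the next factor to be passed. -/
theorem z_mul_list_prod (i : Fin n) (m : Idx n) (l : List (Fin n)) (hl : l.Pairwise (· > ·))
    (hi : i ∈ l) : z q i * (l.map fun j => z q j ^ m j).prod =
      qc q ^ ((l.filter (i < ·)).map m).sum •
        (l.map fun j => z q j ^ (m + Pi.single i 1 : Idx n) j).prod := by
  induction l with
  | nil => simp at hi
  | cons a l ih =>
    rw [List.pairwise_cons] at hl
    simp only [List.map_cons, List.prod_cons]
    rcases eq_or_ne a i with rfl | hne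
    · have h1 : (a :: l).filter (a < ·) = [] := by
        rw [List.filter_eq_nil_iff]
        intro b hb
        rcases List.mem_cons.1 hb with rfl | hb
        · simp
        · simpa using (hl.1 b hb).le
      have h2 : (l.map fun j => z q j ^ m j) =
          l.map fun j => z q j ^ (m + Pi.single a 1 : Idx n) j :=
        List.map_congr_left fun j hj => by
          rw [Pi.add_apply, Pi.single_eq_of_ne (hl.1 j hj).ne, add_zero]
      rw [h1, h2]
      simp [pow_succ', mul_assoc]
    · have hil : i ∈ l := (List.mem_cons.1 hi).resolve_left hne.symm
      have hia : i < a := hl.1 i hil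
      rw [List.filter_cons_of_pos (by simpa using hia), ← mul_assoc, z_mul_pow hia, smul_mul_assoc,
        mul_assoc, ih hl.2 hil, mul_smul_comm, smul_smul, Pi.add_apply, Pi.single_eq_of_ne hne,
        add_zero, List.map_cons, List.sum_cons, pow_add]

/-- The same scalar as in the definition of `raise`; this is why `z^m e 0` is the basis vector `e
m`. -/
theorem z_mul_zmon (i : Fin n) (m : Idx n) :
    z q i * zmon q m = qc q ^ Fock.above i m • zmon q (m + Pi.single i 1) := by
  have hs : ((List.finRange n).reverse).Pairwise (· > ·) := by
    rw [List.pairwise_reverse]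
    exact List.pairwise_lt_finRange n
  have h := z_mul_list_prod (q := q) i m (List.finRange n).reverse hs (by simp)
  simp only [List.map_reverse] at h
  unfold zmon
  rw [h]
  congr 2
  have nd : ((List.finRange n).reverse.filter (i < ·)).Nodup :=
    (List.nodup_reverse.2 (List.nodup_finRange n)).filter _
  rw [Fock.above, ← List.sum_toFinset _ nd]
  congr 1
  ext j
  simp

theorem zmon_zero : zmon q (0 : Idx n) = 1 := by
  unfold zmon
  rw [List.prod_eq_one]
  intro x hx
  simp only [List.mem_reverse, List.mem_map] at hx
  obtain ⟨i, -, rfl⟩ := hx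
  simp

theorem idx_induction {P : Idx n → Prop} (h0 : P 0)
    (h1 : ∀ (m : Idx n) (i : Fin n), P m → P (m + Pi.single i 1)) (m : Idx n) : P m := by
  -- Induction on the total degree, which drops by one when a unit is removed from a nonzero
  -- coordinate.
  induction hN : ∑ i, m i using Nat.strong_induction_on generalizing m with
  | _ N ih =>
    by_cases hm : m = 0
    · rw [hm]; exact h0
    · obtain ⟨i, hi⟩ : ∃ i, m i ≠ 0 := by
        by_contra! h
        exact hm (funext h)
      obtain ⟨s, rfl⟩ := Fock.exists_add hi
      refine h1 s i (ih _ ?_ s rfl)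
      rw [← hN]
      simp [Finset.sum_add_distrib]

theorem zmon_add_single (m : Idx n) (i : Fin n) :
    zmon q (m + Pi.single i 1) = (qc q ^ Fock.above i m)⁻¹ • (z q i * zmon q m) := by
  rw [z_mul_zmon, smul_smul, inv_mul_cancel₀ (pow_ne_zero _ (qc_ne_zero q)), one_smul]

theorem fock_zmon_zero (m : Idx n) : fock n q (zmon q m) (single 0 1) = single m 1 := by
  induction m using idx_induction with
  | h0 => rw [zmon_zero, map_one, Module.End.one_apply]
  | h1 m i ih =>
    rw [zmon_add_single, map_smul, map_mul, LinearMap.smul_apply, Module.End.mul_apply, ih,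
      Fock.fock_z, Fock.raise_single, smul_smul,
      inv_mul_cancel₀ (pow_ne_zero _ (qc_ne_zero q)), one_smul]

/-- Only the shape of `T(z^p)` and the normalization at the vacuum matter later, so the coefficients
are left implicit. -/
theorem exists_fock_zmon (p : Idx n) :
    ∃ t : Idx n → ℂ, t 0 = 1 ∧ ∀ m, fock n q (zmon q p) (single m 1) = t m • single (m + p) 1 := by
  suffices h : ∃ t : Idx n → ℂ, ∀ m,
      fock n q (zmon q p) (single m 1) = t m • single (m + p) 1 by
    obtain ⟨t, ht⟩ := h
    refine ⟨t, ?_, ht⟩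
    -- The coefficient at `0` is read off from `T(z^p) e 0 = e p`.
    have := ht 0
    rw [fock_zmon_zero, zero_add] at this
    simpa using (DFunLike.congr_fun this p).symm
  induction p using idx_induction with
  | h0 => exact ⟨1, fun m => by rw [zmon_zero, map_one, Module.End.one_apply, add_zero]; simp⟩
  | h1 p i ih =>
    obtain ⟨t, ht⟩ := ih
    refine ⟨fun m => (qc q ^ Fock.above i p)⁻¹ * (t m * qc q ^ Fock.above i (m + p)), fun m => ?_⟩
    rw [zmon_add_single, map_smul, map_mul, LinearMap.smul_apply, Module.End.mul_apply, ht,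
      map_smul, Fock.fock_z, Fock.raise_single, smul_smul, smul_smul, add_assoc, mul_assoc]

/-- The coefficients of `T(z^p)`. -/
noncomputable def zcoef (q : QParam) (p : Idx n) : Idx n → ℂ := (exists_fock_zmon (q := q) p).choose

theorem zcoef_zero (p : Idx n) : zcoef q p 0 = 1 :=
  (exists_fock_zmon (q := q) p).choose_spec.1

theorem isShift_zmon (p : Idx n) : Fock.IsShift 0 p (zcoef q p) (fock n q (zmon q p)) where
  apply_add s := by rw [add_zero]; exact (exists_fock_zmon (q := q) p).choose_spec.2 s
  apply_zero m hm := absurd (fun _ => Nat.zero_le _) hm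

theorem holo_eq_span : holo n q = Submodule.span ℂ (Set.range (zmon q)) := by
  set M := Submodule.span ℂ (Set.range (zmon (n := n) q)) with hM
  refine le_antisymm (fun x hx => ?_) (Submodule.span_le.2 ?_)
  -- Stability of the span under left multiplication by `x` is what survives products of such `x`;
  -- membership of `x` itself follows on applying it to `1`.
  · suffices h : ∀ y ∈ M, x * y ∈ M by
      have := h 1 (by rw [← zmon_zero]; exact Submodule.subset_span ⟨0, rfl⟩)
      rwa [mul_one] at this
    replace hx : x ∈ holoAlg n q := hx
    induction hx using Algebra.adjoin_induction with
    | mem x hx =>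
      obtain ⟨i, rfl⟩ := hx
      intro y hy
      induction hy using Submodule.span_induction with
      | mem y hy =>
        obtain ⟨m, rfl⟩ := hy
        rw [z_mul_zmon]
        exact M.smul_mem _ (Submodule.subset_span ⟨_, rfl⟩)
      | zero => rw [mul_zero]; exact zero_mem _
      | add y y' _ _ h h' => rw [mul_add]; exact add_mem h h'
      | smul c y _ h => rw [mul_smul_comm]; exact M.smul_mem c h
    | algebraMap c =>
      intro y hy
      rw [← Algebra.smul_def]
      exact M.smul_mem c hy
    | add x x' _ _ h h' => intro y hy; rw [add_mul]; exact add_mem (h y hy) (h' y hy)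
    | mul x x' _ _ h h' => intro y hy; rw [mul_assoc]; exact h _ (h' y hy)
  · rintro _ ⟨m, rfl⟩
    exact zmon_mem m

/-- Linear maps on the space of holomorphic polynomials agree if they agree on monomials. -/
theorem holo_induction {P : BallAlg n q → Prop} (hz : ∀ m, P (zmon q m)) (h0 : P 0)
    (hadd : ∀ x y, P x → P y → P (x + y)) (hsmul : ∀ (c : ℂ) x, P x → P (c • x))
    {x : BallAlg n q} (hx : x ∈ holo n q) : P x := by
  rw [holo_eq_span] at hx
  induction hx using Submodule.span_induction with
  | mem x hx => obtain ⟨m, rfl⟩ := hx; exact hz m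
  | zero => exact h0
  | add x y _ _ hx hy => exact hadd x y hx hy
  | smul c x _ hx => exact hsmul c x hx

/-- The polynomial with the given coefficients in the basis of monomials. -/
noncomputable def ofCoeffs (n : ℕ) (q : QParam) : Fock n →ₗ[ℂ] holo n q :=
  Finsupp.linearCombination ℂ fun m => ⟨zmon q m, zmon_mem m⟩

theorem ofCoeffs_single (m : Idx n) :
    ofCoeffs n q (single m 1) = ⟨zmon q m, zmon_mem m⟩ := by
  simp [ofCoeffs]

/-- The action on the vacuum vector identifies the space of holomorphic polynomials with the
Fock space. -/
noncomputable def vac (n : ℕ) (q : QParam) : holo n q ≃ₗ[ℂ] Fock n :=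
  LinearEquiv.ofLinearMap
    (((LinearMap.applyₗ (single (0 : Idx n) (1 : ℂ))).comp (fock n q).toLinearMap).comp
      (holo n q).subtype)
    (ofCoeffs n q)
    (by
      refine Fock.end_ext fun m => ?_
      rw [LinearMap.comp_apply, ofCoeffs_single]
      exact fock_zmon_zero m)
    (by
      refine LinearMap.ext fun x => ?_
      obtain ⟨x, hx⟩ := x
      refine Subtype.ext ?_
      change (ofCoeffs n q (fock n q x (single 0 1)) : BallAlg n q) = x
      refine holo_induction
        (P := fun x => (ofCoeffs n q (fock n q x (single 0 1)) : BallAlg n q) = x)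
        (fun m => ?_) ?_ (fun x y hx hy => ?_) (fun c x hx => ?_) hx
      · rw [fock_zmon_zero, ofCoeffs_single]
      · simp
      · rw [map_add, LinearMap.add_apply, map_add, Submodule.coe_add, hx, hy]
      · rw [map_smul, LinearMap.smul_apply, map_smul, Submodule.coe_smul, hx])

theorem vac_apply (x : holo n q) : vac n q x = fock n q (x : BallAlg n q) (single 0 1) := rfl

theorem vac_symm_single (m : Idx n) :
    (vac n q).symm (single m 1) = ⟨zmon q m, zmon_mem m⟩ := ofCoeffs_single m

theorem vac_zmon (m : Idx n) : vac n q ⟨zmon q m, zmon_mem m⟩ = single m 1 := fock_zmon_zero m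

end BallAlg
end QBall

namespace QBall

open Finsupp (single)
open BallAlg

namespace Fock
variable {n : ℕ} {q : QParam}

/-! ### Adjoint operators -/

/-- The squared norm of `e m` in the Fock space. -/
noncomputable def nrm (q : QParam) (m : Idx n) : ℝ :=
  ∏ i, ∏ j ∈ Finset.range (m i), (1 - (q : ℝ) ^ (2 * (j + 1)))

theorem one_sub_pow_pos (q : QParam) (j : ℕ) : 0 < 1 - (q : ℝ) ^ (2 * (j + 1)) :=
  sub_pos.2 (pow_lt_one₀ q.2.1.le q.2.2 (by lia))

theorem nrm_pos (m : Idx n) : 0 < nrm q m :=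
  Finset.prod_pos fun _ _ => Finset.prod_pos fun _ _ => one_sub_pow_pos _ _

theorem nrm_ne_zero (m : Idx n) : (nrm q m : ℂ) ≠ 0 := Complex.ofReal_ne_zero.2 (nrm_pos m).ne'

theorem nrm_zero : nrm q (0 : Idx n) = 1 := by simp [nrm]

theorem nrm_add_single (s : Idx n) (i : Fin n) :
    (nrm q (s + Pi.single i 1) : ℂ) = nrm q s * (1 - qc q ^ (2 * (s i + 1))) := by
  have h : nrm q (s + Pi.single i 1) = nrm q s * (1 - (q : ℝ) ^ (2 * (s i + 1))) := by
    unfold nrm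
    rw [← Finset.mul_prod_erase _ _ (Finset.mem_univ i),
      ← Finset.mul_prod_erase Finset.univ (fun i => ∏ j ∈ Finset.range (s i), _)
        (Finset.mem_univ i)]
    rw [Pi.add_apply, Pi.single_eq_same, Finset.prod_range_succ, mul_right_comm]
    congr 2
    refine Finset.prod_congr rfl fun j hj => ?_
    rw [Pi.add_apply, Pi.single_eq_of_ne (Finset.ne_of_mem_erase hj), add_zero]
  rw [h, qc]
  push_cast
  rfl

/-- `B` is adjoint to `A` with respect to the scalar product with the orthogonal basis `e m`,
`(e m, e m) = nrm q m`. -/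
def IsAdj (q : QParam) (A B : Module.End ℂ (Fock n)) : Prop :=
  ∀ p r, (nrm q p : ℂ) * (B (single r 1)) p = starRingEnd ℂ ((A (single p 1)) r) * nrm q r

namespace IsAdj
variable {A B A' B' : Module.End ℂ (Fock n)}

theorem symm (h : IsAdj q A B) : IsAdj q B A := fun p r => by
  have := congrArg (starRingEnd ℂ) (h r p)
  simp only [map_mul, Complex.conj_conj, Complex.conj_ofReal] at this
  rw [mul_comm, ← this, mul_comm]

theorem add (h : IsAdj q A B) (h' : IsAdj q A' B') : IsAdj q (A + A') (B + B') := fun p r => by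
  simp only [LinearMap.add_apply, Finsupp.add_apply, map_add, mul_add, add_mul, h p r, h' p r]

theorem mul (h : IsAdj q A B) (h' : IsAdj q A' B') : IsAdj q (A * A') (B' * B) := fun p r => by
  classical
  -- Both matrix products are expanded over the union of the two supports, so that they become
  -- finite sums over one index set and can be compared term by term.
  have e1 := coord_eq_sum B' (B (single r 1))
    (Finset.subset_union_left (s₂ := (A' (single p 1)).support)) p
  have e2 := coord_eq_sum A (A' (single p 1))
    (Finset.subset_union_right (s₁ := (B (single r 1)).support)) r
  simp only [Module.End.mul_apply]
  rw [e1, e2, map_sum, Finset.mul_sum, Finset.sum_mul]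
  refine Finset.sum_congr rfl fun s _ => ?_
  rw [map_mul, mul_left_comm, h' p s, mul_assoc, ← h s r]
  ring

end IsAdj

theorem isAdj_raise (i : Fin n) : IsAdj q (raise q i) (lower q i) := fun p r => by
  have e := (isShift_lower q i).coord_add (single r 1) p
  rw [add_zero] at e
  rw [e, raise_single, Finsupp.smul_apply, smul_eq_mul, map_mul, map_pow, star_qc]
  by_cases h : p + Pi.single i 1 = r
  · subst h
    rw [nrm_add_single]
    simp
    ring
  · rw [Finsupp.single_eq_of_ne h, Finsupp.single_eq_of_ne (Ne.symm h)]
    simp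

theorem isAdj_vacuum : IsAdj q (vacuum n) (vacuum n) := fun p r => by
  rw [vacuum_single, vacuum_single]
  by_cases hp : p = 0
  · by_cases hr : r = 0
    · subst hp hr; simp [nrm_zero]
    · subst hp; simp [hr]
  · by_cases hr : r = 0
    · subst hr; simp [hp]
    · simp [hp, hr]

/-- Adjointness is stable under sums and, in reversed order, under products, so it follows from the
generators. Thus `T` is a `*`-representation. -/
theorem isAdj_conj (f : BallAlg n q) : IsAdj q (fock n q f) (fock n q (conj f)) := by
  induction f using BallAlg.induction with
  | hgen x =>
    rw [conj_gen]
    cases x with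
    | z i => simpa only [FGen.elim, fock_z, fock_zs] using isAdj_raise i
    | zs i => simpa only [FGen.elim, fock_z, fock_zs] using (isAdj_raise i).symm
    | f0 => simpa only [FGen.elim, fock_f0] using isAdj_vacuum
  | hc c =>
    intro p r
    rw [Algebra.algebraMap_eq_smul_one, conj_smul, conj_one, map_smul, map_smul, map_one]
    by_cases h : p = r
    · subst h; simp [mul_comm]
    · simp [h, Ne.symm h]
  | hadd x y hx hy => rw [conj_add, map_add, map_add]; exact hx.add hy
  | hmul x y hx hy => rw [conj_mul, map_mul, map_mul]; exact hx.mul hy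

/-! ### Bounds for matrix entries -/

/-- The `ℓ¹` norm of the coordinates. -/
noncomputable def l1 (x : Fock n) : ℝ := x.sum fun _ a => ‖a‖

theorem l1_eq_sum (x : Fock n) {S : Finset (Idx n)} (hS : x.support ⊆ S) :
    l1 x = ∑ m ∈ S, ‖x m‖ := Finsupp.sum_of_support_subset x hS _ (by simp)

theorem l1_zero : l1 (0 : Fock n) = 0 := by simp [l1]

theorem l1_nonneg (x : Fock n) : 0 ≤ l1 x := Finset.sum_nonneg fun _ _ => norm_nonneg _

theorem l1_add_le (x y : Fock n) : l1 (x + y) ≤ l1 x + l1 y := by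
  classical
  rw [l1_eq_sum x Finset.subset_union_left, l1_eq_sum y Finset.subset_union_right,
    l1_eq_sum (x + y) Finsupp.support_add, ← Finset.sum_add_distrib]
  exact Finset.sum_le_sum fun m _ => norm_add_le _ _

theorem l1_smul (c : ℂ) (x : Fock n) : l1 (c • x) = ‖c‖ * l1 x := by
  rw [l1_eq_sum (c • x) Finsupp.support_smul, l1, Finsupp.sum, Finset.mul_sum]
  simp

theorem l1_single (m : Idx n) : l1 (single m (1 : ℂ)) = 1 := by simp [l1]

theorem norm_le_l1 (x : Fock n) (m : Idx n) : ‖x m‖ ≤ l1 x := by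
  by_cases h : m ∈ x.support
  · exact Finset.single_le_sum (f := fun m => ‖x m‖) (fun _ _ => norm_nonneg _) h
  · rw [Finsupp.notMem_support_iff.1 h, norm_zero]
    exact l1_nonneg x

theorem l1_apply_le {A : Module.End ℂ (Fock n)} {C : ℝ} (h : ∀ m, l1 (A (single m 1)) ≤ C)
    (x : Fock n) : l1 (A x) ≤ C * l1 x := by
  have hx : x = ∑ m ∈ x.support, x m • single m (1 : ℂ) := by
    conv_lhs => rw [← Finsupp.sum_single x]
    simp [Finsupp.sum]
  conv_lhs => rw [hx]
  rw [map_sum]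
  refine (Finset.le_sum_of_subadditive l1 l1_zero.le l1_add_le _ _).trans ?_
  rw [l1, Finsupp.sum, Finset.mul_sum]
  refine Finset.sum_le_sum fun m _ => ?_
  rw [map_smul, l1_smul, mul_comm]
  exact mul_le_mul_of_nonneg_right (h m) (norm_nonneg _)

theorem norm_qc : ‖qc q‖ = (q : ℝ) := by
  rw [qc, Complex.norm_real, Real.norm_of_nonneg q.2.1.le]

theorem norm_qc_pow_le_one (a : ℕ) : ‖qc q ^ a‖ ≤ 1 := by
  rw [norm_pow, norm_qc]
  exact pow_le_one₀ q.2.1.le q.2.2.le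

/-- Column sums are bounded rather than single entries because this bound passes to products. The
columns of the generators have at most one nonzero entry, of modulus at most `2`. -/
theorem exists_l1_bound (f : BallAlg n q) :
    ∃ C : ℝ, ∀ m, l1 (fock n q f (single m 1)) ≤ C := by
  induction f using BallAlg.induction with
  | hgen x =>
    refine ⟨2, fun m => ?_⟩
    cases x with
    | z i =>
      rw [fock_z, raise_single, l1_smul, l1_single, mul_one]
      exact (norm_qc_pow_le_one _).trans one_le_two
    | zs i =>
      rw [fock_zs]
      by_cases h : m i = 0
      · rw [lower_zero q h, l1_zero]; exact zero_le_two
      · obtain ⟨s, rfl⟩ := exists_add h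
        rw [lower_add, l1_smul, l1_single, mul_one, norm_mul]
        refine (mul_le_mul (norm_qc_pow_le_one _) ((norm_sub_le _ _).trans
          (add_le_add norm_one.le (norm_qc_pow_le_one _))) (norm_nonneg _) zero_le_one).trans ?_
        norm_num
    | f0 =>
      rw [fock_f0, vacuum_single]
      split_ifs
      · rw [l1_single]; exact one_le_two
      · rw [l1_zero]; exact zero_le_two
  | hc c =>
    refine ⟨‖c‖, fun m => ?_⟩
    rw [AlgHom.commutes, Module.algebraMap_end_apply, l1_smul, l1_single, mul_one]
  | hadd x y hx hy =>
    obtain ⟨C, hC⟩ := hx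
    obtain ⟨D, hD⟩ := hy
    refine ⟨C + D, fun m => ?_⟩
    rw [map_add, LinearMap.add_apply]
    exact (l1_add_le _ _).trans (add_le_add (hC m) (hD m))
  | hmul x y hx hy =>
    obtain ⟨C, hC⟩ := hx
    obtain ⟨D, hD⟩ := hy
    have hC0 : 0 ≤ C := (l1_nonneg _).trans (hC 0)
    refine ⟨C * D, fun m => ?_⟩
    rw [map_mul, Module.End.mul_apply]
    exact (l1_apply_le hC _).trans (mul_le_mul_of_nonneg_left (hD m) hC0)

theorem exists_entry_bound (f : BallAlg n q) : ∃ C : ℝ, ∀ p r, ‖entry f p r‖ ≤ C := by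
  obtain ⟨C, hC⟩ := exists_l1_bound f
  exact ⟨C, fun p r => (norm_le_l1 _ p).trans (hC r)⟩

/-- The matrices of the operators `T(f)` are band matrices. -/
theorem exists_band (f : BallAlg n q) :
    ∃ d : ℕ, ∀ p r, entry f p r ≠ 0 → ∀ i, p i ≤ r i + d ∧ r i ≤ p i + d := by
  have hsingle : ∀ (c : ℂ) {m p : Idx n}, (c • single m (1 : ℂ)) p ≠ 0 → m = p :=
    fun c m p h => by
      by_contra hne
      exact h (by simp [Finsupp.single_eq_of_ne (Ne.symm hne)])
  have hone : ∀ (i j : Fin n), (Pi.single i 1 : Idx n) j ≤ 1 := fun i j => by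
    rw [Pi.single_apply]; split_ifs <;> simp
  induction f using BallAlg.induction with
  | hgen x =>
    refine ⟨1, fun p r h i => ?_⟩
    unfold entry at h
    cases x with
    | z j =>
      rw [fock_z, raise_single] at h
      obtain rfl := hsingle _ h
      have := hone j i
      simp only [Pi.add_apply]
      lia
    | zs j =>
      rw [fock_zs] at h
      by_cases h0 : r j = 0
      · rw [lower_zero q h0] at h; exact absurd rfl h
      · obtain ⟨s, rfl⟩ := exists_add h0
        rw [lower_add] at h
        obtain rfl := hsingle _ h
        have := hone j i
        simp only [Pi.add_apply]
        lia
    | f0 =>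
      rw [fock_f0, vacuum_single] at h
      split_ifs at h with h0
      · rw [← one_smul ℂ (single (0 : Idx n) (1 : ℂ))] at h
        obtain rfl := hsingle _ h
        subst h0
        simp
      · exact absurd rfl h
  | hc c =>
    refine ⟨0, fun p r h i => ?_⟩
    unfold entry at h
    rw [AlgHom.commutes, Module.algebraMap_end_apply] at h
    obtain rfl := hsingle _ h
    simp
  | hadd x y hx hy =>
    obtain ⟨C, hC⟩ := hx
    obtain ⟨D, hD⟩ := hy
    refine ⟨C + D, fun p r h i => ?_⟩
    have : entry x p r ≠ 0 ∨ entry y p r ≠ 0 := by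
      by_contra! h'
      apply h
      unfold entry at h' ⊢
      rw [map_add, LinearMap.add_apply, Finsupp.add_apply, h'.1, h'.2, add_zero]
    rcases this with h | h
    · have := hC p r h i; lia
    · have := hD p r h i; lia
  | hmul x y hx hy =>
    obtain ⟨C, hC⟩ := hx
    obtain ⟨D, hD⟩ := hy
    refine ⟨C + D, fun p r h i => ?_⟩
    unfold entry at h
    rw [map_mul, Module.End.mul_apply, coord_eq_sum _ _ (Finset.Subset.refl _)] at h
    obtain ⟨s, -, hs⟩ := Finset.exists_ne_zero_of_sum_ne_zero h
    have h1 := hC p s (right_ne_zero_of_mul hs) i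
    have h2 := hD s r (left_ne_zero_of_mul hs) i
    lia

/-! ### Summability -/

/-- A finite set of multi-indices lies in a box, and the sum over a box is a product of partial
geometric sums. -/
theorem summable_pow_sum (n : ℕ) (q : QParam) :
    Summable fun m : Idx n => (q : ℝ) ^ ∑ i, m i := by
  have h0 := q.2.1
  have hg := summable_geometric_of_lt_one h0.le q.2.2
  refine summable_of_sum_le (c := ∏ _i : Fin n, ∑' k : ℕ, (q : ℝ) ^ k)
    (fun m => pow_nonneg h0.le _) fun S => ?_
  have hS : S ⊆ Fintype.piFinset fun _ : Fin n => Finset.range (S.sup (fun m => ∑ i, m i) + 1) := by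
    intro m hm
    rw [Fintype.mem_piFinset]
    intro i
    rw [Finset.mem_range, Nat.lt_succ_iff]
    exact (Finset.single_le_sum (fun _ _ => Nat.zero_le _) (Finset.mem_univ i)).trans
      (Finset.le_sup (f := fun m : Idx n => ∑ i, m i) hm)
  refine (Finset.sum_le_sum_of_subset_of_nonneg hS fun m _ _ => pow_nonneg h0.le _).trans ?_
  simp only [← Finset.prod_pow_eq_pow_sum]
  rw [← Finset.prod_univ_sum (f := fun _ k => (q : ℝ) ^ k)]
  exact Finset.prod_le_prod (fun _ _ => Finset.sum_nonneg fun _ _ => pow_nonneg h0.le _)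
    fun _ _ => hg.sum_le_tsum _ fun _ _ => pow_nonneg h0.le _

theorem simplexWeight_pos (α : ℝ) (m : Idx n) : 0 < simplexWeight q α m :=
  mul_pos (Real.rpow_pos_of_pos q.2.1 _) (Finset.prod_pos fun _ _ => pow_pos q.2.1 _)

theorem simplexWeight_add_single (α : ℝ) (s : Idx n) (i : Fin n) :
    simplexWeight q α (s + Pi.single i 1) =
      (q : ℝ) ^ (2 * α) * (q : ℝ) ^ (2 * ((i : ℕ) + 1)) * simplexWeight q α s := by
  have h0 := q.2.1
  have h1 : ∑ j, (s + Pi.single i 1 : Idx n) j = ∑ j, s j + 1 := by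
    simp [Finset.sum_add_distrib]
  have h2 : ∀ l, ∑ j ∈ Finset.Ici l, (s + Pi.single i 1 : Idx n) j =
      ∑ j ∈ Finset.Ici l, s j + if l ≤ i then 1 else 0 := fun l => by
    simp [Finset.sum_add_distrib, Pi.single_apply]
  unfold simplexWeight
  simp only [h1, h2, mul_add, pow_add, Finset.prod_mul_distrib]
  push_cast
  rw [mul_add, mul_one, Real.rpow_add h0]
  -- A unit added at `i` increases `k_l` for all `l ≤ i`. There are `i + 1` such `l`, the indices
  -- starting from `0`.
  have h3 : ∏ l : Fin n, (q : ℝ) ^ (2 * if l ≤ i then 1 else 0) =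
      (q : ℝ) ^ (2 * (i : ℕ)) * (q : ℝ) ^ (2 * 1) := by
    rw [Finset.prod_pow_eq_pow_sum, ← Finset.mul_sum, ← pow_add, ← mul_add]
    congr 2
    rw [Finset.sum_boole]
    have : Finset.univ.filter (fun l : Fin n => l ≤ i) = Finset.Iic i := by
      ext; simp
    rw [this, Fin.card_Iic]
    rfl
  rw [h3]
  ring

/-- The factor with `α` is at most `1`, and `k_i ≥ m i` in each of the other factors. -/
theorem simplexWeight_le {α : ℝ} (hα : 0 < α) (m : Idx n) :
    simplexWeight q α m ≤ (q : ℝ) ^ (2 * ∑ i, m i) := by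
  have h0 := q.2.1
  have h1 : (q : ℝ) ^ (2 * α * (∑ j, m j : ℕ)) ≤ 1 :=
    Real.rpow_le_one h0.le q.2.2.le (by positivity)
  have h2 : ∏ i, (q : ℝ) ^ (2 * ∑ j ∈ Finset.Ici i, m j) ≤ ∏ i, (q : ℝ) ^ (2 * m i) :=
    Finset.prod_le_prod (fun _ _ => pow_nonneg h0.le _) fun i _ =>
      pow_le_pow_of_le_one h0.le q.2.2.le (Nat.mul_le_mul_left 2
        (Finset.single_le_sum (f := m) (fun _ _ => Nat.zero_le _) (by simp)))
  rw [Finset.prod_pow_eq_pow_sum Finset.univ (fun i => 2 * m i), ← Finset.mul_sum] at h2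
  refine (mul_le_mul h1 h2 (Finset.prod_nonneg fun _ _ => pow_nonneg h0.le _)
    zero_le_one).trans ?_
  rw [one_mul]

/-- The criterion of summability used for weighted traces. -/
theorem summable_weighted {α : ℝ} (hα : 0 < α) {g X : Idx n → ℂ} (v : Idx n) {C D : ℝ}
    (hg : ∀ s, ‖g s‖ * (q : ℝ) ^ ∑ i, s i ≤ C) (hX : ∀ s, ‖X s‖ ≤ D) :
    Summable fun s => (simplexWeight q α (s + v) : ℂ) * (g s * X s) := by
  have h0 := q.2.1
  have hC : 0 ≤ C := le_trans (by positivity) (hg 0)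
  refine Summable.of_norm_bounded ((summable_pow_sum n q).mul_right (C * D)) fun s => ?_
  rw [norm_mul, norm_mul, Complex.norm_real, Real.norm_of_nonneg (simplexWeight_pos α _).le]
  -- The weight supplies two copies of `q ^ |s|`: one absorbs the growth allowed for `g`, the other
  -- is summed.
  have h1 : simplexWeight q α (s + v) ≤ (q : ℝ) ^ (∑ i, s i) * (q : ℝ) ^ (∑ i, s i) := by
    refine (simplexWeight_le hα _).trans ?_
    rw [← pow_add]
    refine pow_le_pow_of_le_one h0.le q.2.2.le ?_
    simp only [Pi.add_apply, Finset.sum_add_distrib]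
    lia
  calc _ ≤ ((q : ℝ) ^ (∑ i, s i) * (q : ℝ) ^ (∑ i, s i)) * (‖g s‖ * ‖X s‖) :=
        mul_le_mul_of_nonneg_right h1 (by positivity)
    _ = (q : ℝ) ^ (∑ i, s i) * ((‖g s‖ * (q : ℝ) ^ (∑ i, s i)) * ‖X s‖) := by ring
    _ ≤ _ := mul_le_mul_of_nonneg_left
        (mul_le_mul (hg s) (hX s) (norm_nonneg _) hC) (by positivity)

theorem norm_qnum_le (a : ℕ) : ‖qnum q a‖ * (q : ℝ) ^ a ≤ 2 / (1 - (q : ℝ) ^ 2) := by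
  have h0 := q.2.1
  have h1 : (0 : ℝ) < 1 - (q : ℝ) ^ 2 := sub_pos.2 (pow_lt_one₀ h0.le q.2.2 two_ne_zero)
  have h2 : ‖(1 : ℂ) - qc q ^ 2‖ = 1 - (q : ℝ) ^ 2 := by
    rw [qc, ← Complex.ofReal_pow, ← Complex.ofReal_one, ← Complex.ofReal_sub, Complex.norm_real,
      Real.norm_of_nonneg h1.le]
  rw [qnum_eq, norm_div, h2, norm_mul, norm_qc, div_mul_eq_mul_div]
  refine div_le_div_of_nonneg_right ?_ h1.le
  have hx : (0 : ℝ) < (q : ℝ) ^ a := pow_pos h0 a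
  have hx1 : (q : ℝ) ^ a ≤ 1 := pow_le_one₀ h0.le q.2.2.le
  have h3 : ‖(qc q ^ a)⁻¹ - qc q ^ a‖ ≤ ((q : ℝ) ^ a)⁻¹ + (q : ℝ) ^ a := by
    refine (norm_sub_le _ _).trans ?_
    rw [norm_inv, norm_pow, norm_qc]
  calc (q : ℝ) * ‖(qc q ^ a)⁻¹ - qc q ^ a‖ * (q : ℝ) ^ a
      ≤ 1 * (((q : ℝ) ^ a)⁻¹ + (q : ℝ) ^ a) * (q : ℝ) ^ a := by
        refine mul_le_mul_of_nonneg_right (mul_le_mul q.2.2.le h3 (norm_nonneg _) zero_le_one)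
          hx.le
    _ = 1 + (q : ℝ) ^ a * (q : ℝ) ^ a := by field_simp
    _ ≤ 2 := by nlinarith

/-- The operators `lowE` and `lowF` are unbounded, since `[a]` grows like `q ^ (-a)`. This growth is
within what `summable_weighted` tolerates; the extra division by `q` accounts for the argument `s j
+ 1`. -/
theorem norm_mul_qnum_le (c : ℂ) (s : Idx n) (j : Fin n) :
    ‖c * qnum q (s j + 1)‖ * (q : ℝ) ^ ∑ i, s i ≤ ‖c‖ * (2 / (1 - (q : ℝ) ^ 2) / q) := by
  have h0 := q.2.1
  rw [norm_mul, mul_assoc]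
  refine mul_le_mul_of_nonneg_left ?_ (norm_nonneg _)
  rw [le_div_iff₀ h0, mul_assoc, ← pow_succ]
  refine le_trans (mul_le_mul_of_nonneg_left ?_ (norm_nonneg _)) (norm_qnum_le (s j + 1))
  refine pow_le_pow_of_le_one h0.le q.2.2.le ?_
  have := Finset.single_le_sum (f := s) (fun _ _ => Nat.zero_le _) (Finset.mem_univ j)
  lia

end Fock
end QBall

/-! ### The weighted integral and its invariance properties. -/

namespace QBall

open Finsupp (single)
open BallAlg Fock

namespace Fock
variable {n : ℕ} {q : QParam}

/-- The matrix of an adjoint is the conjugate transpose, rescaled by the norms, so the adjoint of a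
shift runs backwards. -/
theorem IsAdj.isShift {A B : Module.End ℂ (Fock n)} (h : IsAdj q A B) {u v : Idx n}
    {b : Idx n → ℂ} (hA : IsShift u v b A) :
    IsShift v u (fun s => starRingEnd ℂ (b s) * nrm q (s + v) / nrm q (s + u)) B where
  apply_add s := by
    ext l
    have hl := nrm_ne_zero (q := q) l
    refine mul_left_cancel₀ hl ?_
    rw [h l (s + v), hA.coord_add, Finsupp.smul_apply, smul_eq_mul]
    by_cases e : s + u = l
    · subst e
      simp
      field_simp
    · rw [Finsupp.single_eq_of_ne e, Finsupp.single_eq_of_ne (Ne.symm e)]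
      simp
  apply_zero m hm := by
    ext l
    refine mul_left_cancel₀ (nrm_ne_zero (q := q) l) ?_
    rw [h l m, hA.coord_zero _ hm]
    simp

end Fock

namespace BallAlg
variable {n : ℕ} {q : QParam} {α : ℝ}

theorem entry_apply (f : BallAlg n q) (p r : Idx n) :
    entry f p r = fock n q f (single r 1) p := rfl

/-- Conjugation by a diagonal operator does not change the diagonal. Hence every integral or trace
built from diagonal entries is invariant under the `K k`. -/
theorem entry_scale (w : Fin n → ℂˣ) (f : BallAlg n q) (m : Idx n) :
    entry (scale w f) m m = entry f m m := by
  rw [entry, fock_scale]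
  simp only [Module.End.mul_apply, diag_single, map_smul, diag_coord, Finsupp.smul_apply,
    smul_eq_mul, Pi.inv_apply, entry]
  have := chr_ne_zero w m
  field_simp

theorem summable_entry (hα : 0 < α) (f : BallAlg n q) :
    Summable fun m : Idx n => (simplexWeight q α m : ℂ) * entry f m m := by
  obtain ⟨C, hC⟩ := exists_entry_bound f
  have := summable_weighted (q := q) hα (g := fun _ : Idx n => 1) (X := fun m => entry f m m) 0
    (C := 1) (fun s => by
      rw [norm_one, one_mul]; exact pow_le_one₀ q.2.1.le q.2.2.le) fun s => hC s s
  simpa only [add_zero, one_mul] using this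

/-- The weighted integral without its normalizing factor. -/
noncomputable def wInt (n : ℕ) (q : QParam) (hα : 0 < α) : BallAlg n q →ₗ[ℂ] ℂ where
  toFun f := ∑' m : Idx n, (simplexWeight q α m : ℂ) * entry f m m
  map_add' f g := by
    rw [← (summable_entry hα f).tsum_add (summable_entry hα g)]
    simp [entry, mul_add]
  map_smul' c f := by
    rw [RingHom.id_apply, smul_eq_mul, ← tsum_mul_left]
    simp [entry, mul_left_comm]

variable (hα : 0 < α)

theorem hasSum_wInt (f : BallAlg n q) :
    HasSum (fun m : Idx n => (simplexWeight q α m : ℂ) * entry f m m) (wInt n q hα f) :=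
  (summable_entry hα f).hasSum

theorem wInt_eq {f : BallAlg n q} {a : ℂ}
    (h : HasSum (fun m : Idx n => (simplexWeight q α m : ℂ) * entry f m m) a) :
    wInt n q hα f = a := h.tsum_eq

theorem wInt_scale (w : Fin n → ℂˣ) (f : BallAlg n q) :
    wInt n q hα (scale w f) = wInt n q hα f :=
  tsum_congr fun m => by rw [entry_scale]

theorem wInt_actK (k : Fin n) (f : BallAlg n q) :
    wInt n q hα (actK q k f) = wInt n q hα f := wInt_scale hα _ f

theorem wInt_actL (k : Fin n) (f : BallAlg n q) :
    wInt n q hα (actL q k f) = wInt n q hα f := wInt_scale hα _ f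

/-- Twisted cyclicity of the integral: after reindexing by the shift, the two series differ only in
the weight, by the constant ratio `ρ`. Boundedness of the coefficients is enough for convergence
here. -/
theorem wInt_shift {u v : Idx n} {b : Idx n → ℂ} {x f : BallAlg n q}
    (hB : IsShift u v b (fock n q x)) {C : ℝ} (hb : ∀ s, ‖b s‖ ≤ C) {ρ : ℂ}
    (hW : ∀ s, (simplexWeight q α (s + v) : ℂ) = ρ * simplexWeight q α (s + u)) :
    wInt n q hα (x * f) = ρ * wInt n q hα (f * x) := by
  obtain ⟨D, hD⟩ := exists_entry_bound f
  have hs := summable_weighted (q := q) hα (g := b) (X := fun s => entry f (s + u) (s + v)) u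
    (C := C) (fun s => by
      refine le_trans ?_ (hb s)
      exact mul_le_of_le_one_right (norm_nonneg _) (pow_le_one₀ q.2.1.le q.2.2.le))
    fun s => hD _ _
  obtain ⟨a, ha⟩ := hs
  have h1 := hB.hasSum_mul_right (fun m => (simplexWeight q α m : ℂ)) (fock n q f) ha
  have h2 := hB.hasSum_mul_left (fun m => (simplexWeight q α m : ℂ)) (fock n q f)
    (a := ρ * a) (by
      simp only [hW, mul_assoc]
      exact ha.mul_left ρ)
  rw [← map_mul] at h1 h2
  rw [wInt_eq hα h1, wInt_eq hα h2]

/-- The ratio of the weights at `m + δ i` and `m`. -/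
noncomputable def ratio (q : QParam) (α : ℝ) (i : Fin n) : ℂ :=
  (((q : ℝ) ^ (2 * α) * (q : ℝ) ^ (2 * ((i : ℕ) + 1)) : ℝ) : ℂ)

theorem ratio_ne_zero (i : Fin n) : ratio q α i ≠ 0 :=
  Complex.ofReal_ne_zero.2 (mul_pos (Real.rpow_pos_of_pos q.2.1 _) (pow_pos q.2.1 _)).ne'

theorem simplexWeight_succ (s : Idx n) (i : Fin n) :
    (simplexWeight q α (s + Pi.single i 1) : ℂ) = ratio q α i * simplexWeight q α s := by
  rw [simplexWeight_add_single, ratio, Complex.ofReal_mul _ (simplexWeight q α s)]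

theorem wInt_z_mul (i : Fin n) (f : BallAlg n q) :
    wInt n q hα (z q i * f) = ratio q α i * wInt n q hα (f * z q i) := by
  have hB := isShift_raise q i
  rw [← fock_z] at hB
  refine wInt_shift hα hB (fun s => norm_qc_pow_le_one _) fun s => ?_
  rw [simplexWeight_succ, add_zero]

theorem wInt_mul_zs (i : Fin n) (f : BallAlg n q) :
    wInt n q hα (f * zs q i) = ratio q α i * wInt n q hα (zs q i * f) := by
  have hB := isShift_lower q i
  rw [← fock_zs] at hB
  have hr := ratio_ne_zero (q := q) (α := α) i
  have := wInt_shift hα (f := f) (ρ := (ratio q α i)⁻¹) hB (C := 2) (fun s => by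
    rw [norm_mul]
    refine (mul_le_mul (norm_qc_pow_le_one _) ((norm_sub_le _ _).trans
      (add_le_add norm_one.le (norm_qc_pow_le_one _))) (norm_nonneg _) zero_le_one).trans ?_
    norm_num) fun s => by
      rw [simplexWeight_succ, add_zero, ← mul_assoc, inv_mul_cancel₀ hr, one_mul]
  rw [this, ← mul_assoc, mul_inv_cancel₀ hr, one_mul]

/-- The balance required by `hasSum_commE` and `hasSum_commF`. In passing from `k` to `k'` the ratio
of the weights gains `q ^ 2`, while the eigenvalue of `K k` drops from `q` to `q⁻¹`. -/
theorem weight_balance {k k' : Fin n} (hk : (k : ℕ) + 1 = k') (s : Idx n) :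
    (simplexWeight q α (s + Pi.single k 1) : ℂ) * chr (weight q k) (s + Pi.single k 1) =
      simplexWeight q α (s + Pi.single k' 1) * chr (weight q k) (s + Pi.single k' 1) := by
  have hq := qc_ne_zero q
  rw [simplexWeight_succ, simplexWeight_succ, chr_add, chr_add, chr_single, chr_single,
    weight_val, weight_val, wt_self_of_lt hk, wt_succ hk]
  have : ratio q α k' = ratio q α k * qc q ^ 2 := by
    unfold ratio qc
    rw [← hk]
    push_cast
    ring
  rw [this, zpow_one, zpow_neg_one]
  field_simp

theorem wInt_actE_low {k k' : Fin n} (hk : (k : ℕ) + 1 = k') (f : BallAlg n q) :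
    wInt n q hα (actE q k f) = 0 := by
  obtain ⟨D, hD⟩ := exists_entry_bound f
  have hB : IsShift _ _ _ (lowE q k k') := isShift_shift _ _ _
  have hs := summable_weighted hα (g := fun s : Idx n => (sq q)⁻¹ * qnum q (s k' + 1))
    (X := fun s => entry f (s + Pi.single k' 1) (s + Pi.single k 1)) (Pi.single k 1)
    (fun s => norm_mul_qnum_le _ s k') fun s => hD _ _
  have := hB.hasSum_commE (W := fun m => (simplexWeight q α m : ℂ))
    (chr_ne_zero (weight q k)) (weight_balance (α := α) hk) (fock n q f) hs
  rw [← hatE_low hk, ← fock_actK, ← fock_actE] at this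
  exact wInt_eq hα this

theorem wInt_actF_low {k k' : Fin n} (hk : (k : ℕ) + 1 = k') (f : BallAlg n q) :
    wInt n q hα (actF q k f) = 0 := by
  obtain ⟨D, hD⟩ := exists_entry_bound f
  have h0 := q.2.1
  have ne : k ≠ k' := fun e => by have := congrArg Fin.val e; lia
  have hB : IsShift _ _ _ (lowF q k k') := isShift_shift _ _ _
  have hs := summable_weighted hα (g := fun s : Idx n =>
      chr (weight q k) (s + Pi.single k' 1) * (sq q * qnum q (s k + 1)))
    (X := fun s => entry f (s + Pi.single k 1) (s + Pi.single k' 1)) (Pi.single k' 1)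
    -- The factor `κ` contributes `q ^ s k * q ^ (-(s k' + 1))`. Its first part tames `[s k + 1]`,
    -- and its second is compensated by `q ^ |s| ≤ q ^ s k'`. One of the two powers of `q` in the
    -- constant pays for the shift by `δ k'`, the other for the argument `s k + 1`.
    (C := ‖sq q‖ * (2 / (1 - (q : ℝ) ^ 2)) / (q : ℝ) ^ 2) (fun s => by
      have h1 := norm_qnum_le (q := q) (s k + 1)
      have h2 : (q : ℝ) ^ ∑ i, s i ≤ (q : ℝ) ^ s k' :=
        pow_le_pow_of_le_one h0.le q.2.2.le
          (Finset.single_le_sum (f := s) (fun _ _ => Nat.zero_le _) (Finset.mem_univ k'))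
      rw [chr_weight_low hk]
      simp only [Pi.add_apply, Pi.single_eq_of_ne ne, Pi.single_eq_same, norm_mul, norm_inv, norm_pow,
        norm_qc, add_zero]
      rw [le_div_iff₀ (pow_pos h0 2)]
      calc _ ≤ (q : ℝ) ^ s k * ((q : ℝ) ^ (s k' + 1))⁻¹ * (‖sq q‖ * ‖qnum q (s k + 1)‖) *
            (q : ℝ) ^ s k' * (q : ℝ) ^ 2 := by gcongr
        _ = ‖sq q‖ * (‖qnum q (s k + 1)‖ * (q : ℝ) ^ (s k + 1)) := by
          have := h0.ne'
          simp only [pow_succ]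
          field_simp
        _ ≤ _ := mul_le_mul_of_nonneg_left h1 (norm_nonneg _)) fun s => hD _ _
  have := hB.hasSum_commF (W := fun m => (simplexWeight q α m : ℂ))
    (fun s => (weight_balance (α := α) hk s).symm) (fock n q f)
    (by simpa only [mul_assoc, entry] using hs)
  rw [← hatF_low hk, ← fock_actF] at this
  exact wInt_eq hα this

/-! ### The orthogonal projection to holomorphic polynomials -/

/-- Orthogonality to the holomorphic polynomials. -/
def Perp (φ : BallAlg n q) : Prop := ∀ g ∈ holo n q, wInt n q hα (conj g * φ) = 0

variable {hα}

theorem Perp.smul {φ : BallAlg n q} (h : Perp hα φ) (c : ℂ) : Perp hα (c • φ) := fun g hg => by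
  rw [mul_smul_comm, map_smul, h g hg, smul_zero]

/-- The integral is invariant under `K k`, and `conj g` is `K k` applied to the conjugate of another
polynomial. -/
theorem Perp.actK {φ : BallAlg n q} (h : Perp hα φ) (k : Fin n) : Perp hα (actK q k φ) :=
  fun g hg => by
  have e : conj g = BallAlg.actK q k (conj (BallAlg.actK q k g)) := by
    rw [conj_scale, actK_actL, actL_actK_self]
  rw [e, ← map_mul, wInt_actK]
  exact h _ (actK_mem k hg)

theorem Perp.actL {φ : BallAlg n q} (h : Perp hα φ) (k : Fin n) : Perp hα (actL q k φ) :=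
  fun g hg => by
  have e : conj g = BallAlg.actL q k (conj (BallAlg.actL q k g)) := by
    rw [conj_actL, actL_actK_self]
  rw [e, ← map_mul, wInt_actL]
  exact h _ (actL_mem k hg)

/-- Apply the vanishing of `∫ E k (·)` to `conj (K g) φ`. Since `E k` of a conjugate is a multiple
of the conjugate of `F k`, the first Leibniz term is the pairing of `φ` with a polynomial, hence
zero; the second is the desired `∫ conj g · E k φ`. -/
theorem Perp.actE_low {φ : BallAlg n q} (h : Perp hα φ) {k k' : Fin n} (hk : (k : ℕ) + 1 = k') :
    Perp hα (actE q k φ) := fun g hg => by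
  have hq := qc_ne_zero q
  have e : conj g = BallAlg.actK q k (conj (BallAlg.actK q k g)) := by
    rw [conj_scale, actK_actL, actL_actK_self]
  obtain ⟨c, hc⟩ : ∃ c : ℂ, ∀ y : BallAlg n q, actE q k (conj y) = c • conj (actF q k y) :=
    ⟨(-qc q ^ 2)⁻¹, fun y => by
      rw [actF_apply, if_pos (by have := k'.2; lia), conj_smul, conj_conj, map_neg, map_pow,
        star_qc, smul_smul, inv_mul_cancel₀ (by simpa using hq), one_smul]⟩
  have h0 := wInt_actE_low hα hk (conj (BallAlg.actK q k g) * φ)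
  rw [actE_mul, ← e, hc, map_add, smul_mul_assoc, map_smul,
    h _ (actF_mem k (actK_mem k hg)), smul_zero, zero_add] at h0
  exact h0

/-- The same argument; here the discarded Leibniz term contains `K⁻¹ φ`, which is again orthogonal.
-/
theorem Perp.actF_low {φ : BallAlg n q} (h : Perp hα φ) {k k' : Fin n} (hk : (k : ℕ) + 1 = k') :
    Perp hα (actF q k φ) := fun g hg => by
  have h0 := wInt_actF_low hα hk (conj g * φ)
  rw [actF_mul, actF_apply, conj_conj, map_add, smul_mul_assoc, map_smul,
    h.actL k _ (actE_mem k hg), smul_zero, zero_add] at h0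
  exact h0

/-- `F` at the last node is `z^* K⁻¹(φ) - φ z^*` up to a scalar. A `z^*` next to `conj g` turns it
into the conjugate of another polynomial, and the `z^*` on the far right is first brought to the
front by `wInt_mul_zs`. Both terms vanish separately, so no precise scalar is needed. -/
theorem Perp.actF_last {φ : BallAlg n q} (h : Perp hα φ) {k : Fin n} (hk : (k : ℕ) + 1 = n) :
    Perp hα (actF q k φ) := by
  rw [BallAlg.actF_last hk]
  refine Perp.smul (fun g hg => ?_) _
  have e1 : conj g * zs q k = conj (z q k * g) := by rw [conj_mul, conj_gen]; rfl
  have e2 : zs q k * conj g = conj (g * z q k) := by rw [conj_mul, conj_gen]; rfl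
  rw [mul_sub, map_sub, ← mul_assoc, ← mul_assoc, e1, wInt_mul_zs, ← mul_assoc, e2,
    h.actL k _ ((holoAlg n q).mul_mem (z_mem k) hg), h _ ((holoAlg n q).mul_mem hg (z_mem k))]
  simp

/-- The arithmetic that singles out the twist `q ^ (α + n + 1)`: the constants produced in
`Perp.twE_last` by cyclicity and by `K n z n = q² z n` must cancel against its square. -/
theorem twist_sq {k : Fin n} (hk : (k : ℕ) + 1 = n) :
    (twist n q α : ℂ) ^ 2 = ratio q α k * qc q ^ 2 := by
  unfold ratio qc twist
  rw [hk, Units.val_mk0]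
  norm_cast
  have h0 := q.2.1
  rw [← Real.rpow_natCast, ← Real.rpow_mul h0.le, ← Real.rpow_natCast, ← Real.rpow_add h0,
    ← Real.rpow_natCast, ← Real.rpow_add h0]
  congr 1
  push_cast
  ring

/-- Unlike for `F`, neither term vanishes alone, since `conj g · z` is not the conjugate of a
polynomial. With the right twist, the two terms combine into the pairing of `φ` with `z^* g - K(g)
z^*`, and this is holomorphic. -/
theorem Perp.twE_last {φ : BallAlg n q} (h : Perp hα φ) {k : Fin n} (hk : (k : ℕ) + 1 = n) :
    Perp hα (twE q (twist n q α) k φ) := by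
  have hq := qc_ne_zero q
  have hr := ratio_ne_zero (q := q) (α := α) k
  rw [BallAlg.twE_last _ hk]
  refine Perp.smul (fun g hg => ?_) _
  have w1 : wt k k = 2 := by unfold wt; rw [if_pos hk, if_pos rfl]
  have hg' : BallAlg.actK q k g ∈ holoAlg n q := actK_mem k hg
  -- Up to a nonzero scalar this element is `F k (K k g)`, and `F k` preserves `ℂ[z]`.
  have hm : zs q k * g - BallAlg.actK q k g * zs q k ∈ holoAlg n q := by
    have h1 := actF_mem k hg'
    rw [BallAlg.actF_last hk, actL_actK_self] at h1
    have hne : sq q / (qc q ^ (-2 : ℤ) - 1) ≠ 0 := by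
      have hq2 := one_sub_qc_sq_ne_zero q
      have : qc q ^ (-2 : ℤ) - 1 = (1 - qc q ^ 2) / qc q ^ 2 := by
        rw [zpow_neg]; field_simp
      rw [this]
      exact div_ne_zero (sq_ne_zero q) (div_ne_zero hq2 (pow_ne_zero 2 hq))
    have h2 := (holoAlg n q).smul_mem h1 (sq q / (qc q ^ (-2 : ℤ) - 1))⁻¹
    rwa [smul_smul, inv_mul_cancel₀ hne, one_smul] at h2
  -- Move `z` to the front by twisted cyclicity, then apply the `K⁻¹`-invariance of the integral to
  -- free `φ` from `K`.
  have h1 : wInt n q hα (conj g * (BallAlg.actK q k φ * z q k)) =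
      (ratio q α k)⁻¹ * ((qc q ^ 2)⁻¹ *
        wInt n q hα (z q k * conj (BallAlg.actK q k g) * φ)) := by
    rw [← mul_assoc, eq_inv_mul_iff_mul_eq₀ hr, ← wInt_z_mul, ← wInt_actL hα k]
    simp only [map_mul, actL_actK_self, actL_gen, FGen.elim, w1, ← conj_scale, smul_mul_assoc,
      map_smul, smul_eq_mul, mul_assoc]
    rw [zpow_neg]; rfl
  have h2 := h _ hm
  rw [conj_sub, conj_mul, conj_mul, conj_gen] at h2
  simp only [FGen.elim] at h2
  rw [sub_mul, map_sub] at h2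
  rw [mul_sub, map_sub, mul_smul_comm, map_smul, h1, twist_sq hk, ← mul_assoc, smul_eq_mul]
  rw [← h2]
  field_simp

theorem Perp.twAct {φ : BallAlg n q} (h : Perp hα φ) (x : UGen n) :
    Perp hα (piAct n q α (Uq.gen q x) φ) := by
  unfold piAct QBall.twAct
  rw [Uq.lift_gen]
  cases x with
  | E k =>
    rw [UGen.elim]
    obtain ⟨k', hk⟩ | hk := low_or_last k
    · rw [twE_low _ (by have := k'.2; lia)]
      exact h.actE_low hk
    · exact h.twE_last hk
  | F k =>
    rw [UGen.elim]
    refine Perp.smul ?_ _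
    obtain ⟨k', hk⟩ | hk := low_or_last k
    · exact h.actF_low hk
    · exact h.actF_last hk
  | K k => exact (h.actK k).smul _
  | L k => exact (h.actL k).smul _

end BallAlg
end QBall

/-! ### The orthogonal projection to `ℂ[z]` and the Toeplitz operators. -/

namespace QBall

open Finsupp (single)
open BallAlg Fock

namespace BallAlg
variable {n : ℕ} {q : QParam} {α : ℝ} (hα : 0 < α)

/-- `T` of the conjugate of `z^p` is the backward shift by `p`. So the pairing with `z^p` sees only
the entries of `T(φ)` at the positions `(m + p, m)`. -/
theorem entry_conj_zmon_mul (p m : Idx n) (φ : BallAlg n q) :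
    entry (conj (zmon q p) * φ) m m =
      starRingEnd ℂ (zcoef q p m) * nrm q (m + p) / nrm q m * entry φ (m + p) m := by
  have h := (isAdj_conj (zmon q p)).isShift (isShift_zmon p)
  have e := h.coord_add (fock n q φ (single m 1)) m
  simp only [add_zero] at e
  rw [entry, map_mul, Module.End.mul_apply, e, entry]

theorem entry_zmon (p r m : Idx n) :
    entry (zmon q r) (m + p) m = if r = p then zcoef q p m else 0 := by
  have e := (isShift_zmon (q := q) r).apply_add m
  rw [add_zero] at e
  rw [entry, e]
  split_ifs with h
  · subst h; simp
  · rw [Finsupp.smul_apply, Finsupp.single_eq_of_ne, smul_zero]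
    exact fun h' => h (add_left_cancel h').symm

theorem wInt_zmon_ne {p r : Idx n} (h : r ≠ p) :
    wInt n q hα (conj (zmon q p) * zmon q r) = 0 := by
  refine wInt_eq hα ?_
  simp only [entry_conj_zmon_mul, entry_zmon, if_neg h, mul_zero]
  exact hasSum_zero

/-- A series of nonnegative real terms whose term at `m = 0` is positive, since `zcoef q p 0 = 1`.
-/
theorem wInt_zmon_self (p : Idx n) : wInt n q hα (conj (zmon q p) * zmon q p) ≠ 0 := by
  have h := hasSum_wInt hα (conj (zmon q p) * zmon q p)
  set g : Idx n → ℝ := fun m =>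
    simplexWeight q α m * (Complex.normSq (zcoef q p m) * nrm q (m + p) / nrm q m) with hg
  have e : (fun m : Idx n => (simplexWeight q α m : ℂ) * entry (conj (zmon q p) * zmon q p) m m) =
      fun m => (g m : ℂ) := by
    funext m
    rw [entry_conj_zmon_mul, entry_zmon, if_pos rfl, hg]
    push_cast
    rw [Complex.normSq_eq_conj_mul_self]
    ring
  rw [e] at h
  have hs : Summable g := Complex.summable_ofReal.1 h.summable
  have h2 := h.unique (Complex.hasSum_ofReal.2 hs.hasSum)
  rw [h2]
  refine Complex.ofReal_ne_zero.2 (hs.tsum_pos (fun m => ?_) 0 ?_).ne'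
  · exact mul_nonneg (simplexWeight_pos α m).le (div_nonneg (mul_nonneg (Complex.normSq_nonneg _)
      (nrm_pos _).le) (nrm_pos _).le)
  · refine mul_pos (simplexWeight_pos α 0) (div_pos (mul_pos ?_ (nrm_pos _)) (nrm_pos _))
    rw [zcoef_zero]
    simp

theorem wInt_ofCoeffs (p : Idx n) (x : Fock n) :
    wInt n q hα (conj (zmon q p) * (ofCoeffs n q x : BallAlg n q)) =
      x p * wInt n q hα (conj (zmon q p) * zmon q p) := by
  induction x using Finsupp.induction_linear with
  | zero => simp
  | add x y hx hy =>
    rw [map_add, Submodule.coe_add, mul_add, map_add, hx, hy, Finsupp.add_apply, add_mul]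
  | single r c =>
    have hc : single r c = c • single r (1 : ℂ) := by rw [Finsupp.smul_single, smul_eq_mul, mul_one]
    rw [hc, map_smul, ofCoeffs_single, Submodule.coe_smul, mul_smul_comm, map_smul, Finsupp.smul_apply]
    by_cases h : r = p
    · subst h; simp
    · rw [wInt_zmon_ne hα h, Finsupp.single_eq_of_ne (Ne.symm h)]; simp

theorem perp_iff {φ : BallAlg n q} :
    Perp hα φ ↔ ∀ p, wInt n q hα (conj (zmon q p) * φ) = 0 := by
  refine ⟨fun h p => h _ (zmon_mem p), fun h g hg => ?_⟩
  refine holo_induction (P := fun g => wInt n q hα (conj g * φ) = 0) h ?_ (fun x y hx hy => ?_)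
    (fun c x hx => ?_) hg
  · rw [conj_zero, zero_mul, map_zero]
  · rw [conj_add, add_mul, map_add, hx, hy, add_zero]
  · rw [conj_smul, smul_mul_assoc, map_smul, hx, smul_zero]

theorem exists_bound_of_entry {φ : BallAlg n q} {M : Idx n}
    (h : ∀ m p, entry φ (m + p) m ≠ 0 → p ≤ M) :
    (Function.support fun p => wInt n q hα (conj (zmon q p) * φ) /
      wInt n q hα (conj (zmon q p) * zmon q p)).Finite := by
  refine (Set.finite_Iic M).subset fun p hp => ?_
  by_contra hM
  refine hp ?_
  have : wInt n q hα (conj (zmon q p) * φ) = 0 := by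
    refine wInt_eq hα ?_
    have : ∀ m, entry φ (m + p) m = 0 := fun m => by_contra fun h' => hM (h m p h')
    simp only [entry_conj_zmon_mul, this, mul_zero]
    exact hasSum_zero
  simp only [this, zero_div]

/-- A band matrix has no entries at `(m + p, m)` once some coordinate of `p` exceeds the band width,
so the projection is a polynomial and not just a formal series. -/
theorem finite_coeffs (φ : BallAlg n q) :
    (Function.support fun p => wInt n q hα (conj (zmon q p) * φ) /
      wInt n q hα (conj (zmon q p) * zmon q p)).Finite := by
  obtain ⟨d, hd⟩ := exists_band φ
  refine exists_bound_of_entry hα (M := fun _ => d) fun m p h i => ?_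
  have := (hd _ _ h i).1
  simp only [Pi.add_apply] at this
  lia

/-- The coefficients of the orthogonal projection. -/
noncomputable def projCoeffs (n : ℕ) (q : QParam) {α : ℝ} (hα : 0 < α) :
    BallAlg n q →ₗ[ℂ] Fock n where
  toFun φ := Finsupp.ofSupportFinite _ (finite_coeffs hα φ)
  map_add' φ ψ := by
    ext p
    rw [Finsupp.add_apply]
    simp only [Finsupp.ofSupportFinite_coe, mul_add, map_add, add_div]
  map_smul' c φ := by
    ext p
    rw [Finsupp.smul_apply]
    simp only [Finsupp.ofSupportFinite_coe, mul_smul_comm, map_smul, smul_eq_mul, mul_div_assoc,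
      RingHom.id_apply]

theorem projCoeffs_apply (φ : BallAlg n q) (p : Idx n) :
    projCoeffs n q hα φ p = wInt n q hα (conj (zmon q p) * φ) /
      wInt n q hα (conj (zmon q p) * zmon q p) := rfl

/-- The orthogonal projection to the space of holomorphic polynomials. -/
noncomputable def proj (n : ℕ) (q : QParam) {α : ℝ} (hα : 0 < α) : BallAlg n q →ₗ[ℂ] holo n q :=
  (ofCoeffs n q).comp (projCoeffs n q hα)

theorem perp_sub_proj (φ : BallAlg n q) : Perp hα (φ - (proj n q hα φ : BallAlg n q)) := by
  rw [perp_iff]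
  intro p
  rw [mul_sub, map_sub, proj, LinearMap.comp_apply, wInt_ofCoeffs, projCoeffs_apply,
    div_mul_cancel₀ _ (wInt_zmon_self hα p), sub_self]

theorem eq_zero_of_perp {x : holo n q} (h : Perp hα (x : BallAlg n q)) : x = 0 := by
  have hx : ofCoeffs n q (vac n q x) = x := (vac n q).symm_apply_apply x
  rw [perp_iff, ← hx] at h
  have : vac n q x = 0 := by
    ext p
    have := h p
    rw [wInt_ofCoeffs] at this
    exact (mul_eq_zero.1 this).resolve_right (wInt_zmon_self hα p)
  rw [← hx, this, map_zero]

variable {hα} in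
theorem Perp.sub {φ ψ : BallAlg n q} (h : Perp hα φ) (h' : Perp hα ψ) : Perp hα (φ - ψ) :=
  fun g hg => by rw [mul_sub, map_sub, h g hg, h' g hg, sub_zero]

theorem eq_proj_iff {φ : BallAlg n q} {x : holo n q} :
    Perp hα (φ - (x : BallAlg n q)) ↔ x = proj n q hα φ := by
  refine ⟨fun h => ?_, fun h => h ▸ perp_sub_proj hα φ⟩
  rw [← sub_eq_zero]
  refine eq_zero_of_perp hα ?_
  have := (perp_sub_proj hα φ).sub h
  rwa [sub_sub_sub_cancel_left] at this

/-- `φ - proj φ` is orthogonal to `ℂ[z]` and stays so under the twisted action, while the image of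
`proj φ` remains in `ℂ[z]`; uniqueness of the projection gives the claim. -/
theorem proj_act (x : UGen n) (φ : BallAlg n q) :
    proj n q hα (piAct n q α (Uq.gen q x) φ) =
      piHolo n q α (Uq.gen q x) (proj n q hα φ) := by
  symm
  rw [← eq_proj_iff]
  have := (perp_sub_proj hα φ).twAct x
  rwa [map_sub] at this

/-- The Toeplitz operators. -/
noncomputable def toeplitz (n : ℕ) (q : QParam) {α : ℝ} (hα : 0 < α) :
    BallAlg n q →ₗ[ℂ] HoloEnd n q :=
  LinearMap.mk₂ ℂ (fun f (ψ : holo n q) => proj n q hα (f * (ψ : BallAlg n q)))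
    (fun f g ψ => by rw [add_mul, map_add]) (fun c f ψ => by rw [smul_mul_assoc, map_smul])
    (fun f ψ χ => by rw [Submodule.coe_add, mul_add, map_add])
    (fun c f ψ => by rw [Submodule.coe_smul, mul_smul_comm, map_smul])

theorem toeplitz_apply (f : BallAlg n q) (ψ : holo n q) :
    toeplitz n q hα f ψ = proj n q hα (f * (ψ : BallAlg n q)) := rfl

theorem qPoch_pos {a : ℝ} (h0 : 0 < a) (h1 : a < 1) (k : ℕ) : 0 < qPoch q a k :=
  Finset.prod_pos fun _ _ => sub_pos.2
    ((mul_le_of_le_one_right h0.le (pow_le_one₀ q.2.1.le q.2.2.le)).trans_lt h1)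

/-- The series always converges, and the normalizing factor is nonzero because `q ^ (2α + 2) < 1`.
-/
theorem hasWeightedIntegral_iff {f : BallAlg n q} :
    HasWeightedIntegral α f 0 ↔ wInt n q hα f = 0 := by
  have hc : (qPoch q ((q : ℝ) ^ (2 * α + 2)) n : ℂ) ≠ 0 :=
    Complex.ofReal_ne_zero.2 (qPoch_pos (Real.rpow_pos_of_pos q.2.1 _)
      (Real.rpow_lt_one q.2.1.le q.2.2 (by positivity)) n).ne'
  have h := hasSum_wInt hα f
  unfold HasWeightedIntegral
  simp only [Complex.ofReal_mul, mul_assoc]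
  refine ⟨fun h' => ?_, fun h' => ?_⟩
  · have := (h.mul_left _).unique h'
    exact (mul_eq_zero.1 this).resolve_left hc
  · have := h.mul_left (qPoch q ((q : ℝ) ^ (2 * α + 2)) n : ℂ)
    rwa [h', mul_zero] at this

theorem isToeplitz_iff {f : BallAlg n q} {A : HoloEnd n q} :
    IsToeplitz α f A ↔ A = toeplitz n q hα f := by
  unfold IsToeplitz
  simp only [hasWeightedIntegral_iff hα]
  constructor
  · intro h
    refine LinearMap.ext fun ψ => ?_
    have hp : Perp hα (f * (ψ : BallAlg n q) - (A ψ : BallAlg n q)) := fun g hg => h ψ ⟨g, hg⟩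
    rw [toeplitz_apply, ← (eq_proj_iff hα).1 hp]
  · rintro rfl ψ g
    rw [toeplitz_apply]
    exact perp_sub_proj hα (f * (ψ : BallAlg n q)) g g.2

end BallAlg

/-! ### The canonical action on `End V`. -/

section EndAction
variable {n : ℕ} {q : QParam} {V : Type*} [AddCommGroup V] [Module ℂ V]
  (ρ : Uq n q →ₐ[ℂ] Module.End ℂ V)

open scoped TensorProduct in
/-- The operators `T ↦ ρ(a) T ρ(S(b))`. -/
noncomputable def Uq.sandwich : Uq n q ⊗[ℂ] Uq n q →ₗ[ℂ] Module.End ℂ (Module.End ℂ V) :=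
  TensorProduct.lift
    (((LinearMap.mul ℂ (Module.End ℂ (Module.End ℂ V))).compl₁₂
      ((LinearMap.mul ℂ (Module.End ℂ V)).comp ρ.toLinearMap))
      ((LinearMap.mul ℂ (Module.End ℂ V)).flip.comp
        (ρ.toLinearMap.comp ((MulOpposite.opLinearEquiv ℂ).symm.toLinearMap.comp
          (Uq.antipode n q).toLinearMap))))

theorem Uq.endAction_apply (ξ : Uq n q) :
    Uq.endAction ρ ξ = Uq.sandwich ρ (Uq.comul n q ξ) := rfl

theorem Uq.sandwich_tmul (a b : Uq n q) (T : Module.End ℂ V) :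
    Uq.sandwich ρ (a ⊗ₜ b) T = ρ a * (T * ρ (Uq.antipode n q b).unop) := rfl

/-- The reversal of order in the antipode matches the fact that the second tensor factor multiplies
from the right. -/
theorem Uq.sandwich_mul (x y : TensorProduct ℂ (Uq n q) (Uq n q)) :
    Uq.sandwich ρ (x * y) = Uq.sandwich ρ x * Uq.sandwich ρ y := by
  induction x using TensorProduct.induction_on with
  | zero => rw [zero_mul, map_zero, zero_mul]
  | add x x' hx hx' => rw [add_mul, map_add, hx, hx', map_add, add_mul]
  | tmul a b =>
    induction y using TensorProduct.induction_on with
    | zero => rw [mul_zero, map_zero, mul_zero]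
    | add y y' hy hy' => rw [mul_add, map_add, hy, hy', map_add, mul_add]
    | tmul c d =>
      refine LinearMap.ext fun T => ?_
      rw [Algebra.TensorProduct.tmul_mul_tmul, Module.End.mul_apply, Uq.sandwich_tmul,
        Uq.sandwich_tmul, Uq.sandwich_tmul, map_mul, map_mul, MulOpposite.unop_mul, map_mul]
      simp only [mul_assoc]

/-- The canonical action on `End V` as a homomorphism. -/
noncomputable def Uq.endHom : Uq n q →ₐ[ℂ] Module.End ℂ (Module.End ℂ V) :=
  AlgHom.ofLinearMap (Uq.endAction ρ)
    (by
      refine LinearMap.ext fun T => ?_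
      rw [Uq.endAction_apply, map_one, Algebra.TensorProduct.one_def, Uq.sandwich_tmul, map_one,
        map_one, MulOpposite.unop_one, map_one, mul_one, one_mul, Module.End.one_apply])
    (fun x y => by
      rw [Uq.endAction_apply, map_mul, Uq.sandwich_mul, Uq.endAction_apply, Uq.endAction_apply])

theorem Uq.endHom_apply (ξ : Uq n q) : Uq.endHom ρ ξ = Uq.endAction ρ ξ := rfl

theorem Uq.endHom_E (k : Fin n) (T : Module.End ℂ V) : Uq.endHom ρ (gen q (.E k)) T =
    ρ (gen q (.E k)) * T - ρ (gen q (.K k)) * T * ρ (gen q (.L k)) * ρ (gen q (.E k)) := by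
  rw [Uq.endHom_apply, Uq.endAction_apply, Uq.comul, Uq.lift_gen, UGen.elim, map_add,
    LinearMap.add_apply, Uq.sandwich_tmul, Uq.sandwich_tmul, map_one, MulOpposite.unop_one, map_one,
    mul_one, Uq.antipode, Uq.lift_gen, UGen.elim, MulOpposite.unop_op, map_neg, map_mul, mul_neg,
    mul_neg, ← sub_eq_add_neg]
  simp only [mul_assoc]

theorem Uq.endHom_F (k : Fin n) (T : Module.End ℂ V) : Uq.endHom ρ (gen q (.F k)) T =
    (ρ (gen q (.F k)) * T - T * ρ (gen q (.F k))) * ρ (gen q (.K k)) := by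
  rw [Uq.endHom_apply, Uq.endAction_apply, Uq.comul, Uq.lift_gen, UGen.elim, map_add,
    LinearMap.add_apply, Uq.sandwich_tmul, Uq.sandwich_tmul, map_one, one_mul,
    Uq.antipode, Uq.lift_gen, Uq.lift_gen, UGen.elim, UGen.elim, MulOpposite.unop_op,
    MulOpposite.unop_op, map_neg, map_mul, mul_neg, ← sub_eq_add_neg, sub_mul]
  simp only [mul_assoc]

theorem Uq.endHom_K (k : Fin n) (T : Module.End ℂ V) : Uq.endHom ρ (gen q (.K k)) T =
    ρ (gen q (.K k)) * T * ρ (gen q (.L k)) := by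
  rw [Uq.endHom_apply, Uq.endAction_apply, Uq.comul, Uq.lift_gen, UGen.elim, Uq.sandwich_tmul,
    Uq.antipode, Uq.lift_gen, UGen.elim, MulOpposite.unop_op, mul_assoc]

theorem Uq.endHom_L (k : Fin n) (T : Module.End ℂ V) : Uq.endHom ρ (gen q (.L k)) T =
    ρ (gen q (.L k)) * T * ρ (gen q (.K k)) := by
  rw [Uq.endHom_apply, Uq.endAction_apply, Uq.comul, Uq.lift_gen, UGen.elim, Uq.sandwich_tmul,
    Uq.antipode, Uq.lift_gen, UGen.elim, MulOpposite.unop_op, mul_assoc]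

/-- The subtracted term is moved to the left, so that later uses involve only addition. -/
theorem Uq.endHom_E_apply (k : Fin n) (T : Module.End ℂ V) (v : V) :
    Uq.endHom ρ (gen q (.E k)) T v + ρ (gen q (.K k)) (T (ρ (gen q (.L k)) (ρ (gen q (.E k)) v))) =
      ρ (gen q (.E k)) (T v) := by
  rw [Uq.endHom_E, LinearMap.sub_apply]
  exact sub_add_cancel _ _

theorem Uq.endHom_F_apply (k : Fin n) (T : Module.End ℂ V) (v : V) :
    Uq.endHom ρ (gen q (.F k)) T v + T (ρ (gen q (.F k)) (ρ (gen q (.K k)) v)) =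
      ρ (gen q (.F k)) (T (ρ (gen q (.K k)) v)) := by
  rw [Uq.endHom_F, Module.End.mul_apply, LinearMap.sub_apply]
  exact sub_add_cancel _ _

end EndAction

theorem Uq.KL_apply {n : ℕ} {q : QParam} {V : Type*} [AddCommMonoid V] [Module ℂ V] (ρ : Uq n q →ₐ[ℂ] Module.End ℂ V)
    (k : Fin n) (v : V) : ρ (gen q (.K k)) (ρ (gen q (.L k)) v) = v := by
  rw [← Module.End.mul_apply, ← map_mul, (Uq.relations n q).KL, map_one, Module.End.one_apply]

theorem Uq.LK_apply {n : ℕ} {q : QParam} {V : Type*} [AddCommMonoid V] [Module ℂ V] (ρ : Uq n q →ₐ[ℂ] Module.End ℂ V)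
    (k : Fin n) (v : V) : ρ (gen q (.L k)) (ρ (gen q (.K k)) v) = v := by
  rw [← Module.End.mul_apply, ← map_mul, (Uq.relations n q).LK, map_one, Module.End.one_apply]

/-- A linear map intertwining the generators is a morphism of modules. -/
theorem Uq.intertwine {n : ℕ} {q : QParam} {V W : Type*} [AddCommMonoid V] [Module ℂ V]
    [AddCommMonoid W] [Module ℂ W]
    {ρ : Uq n q →ₐ[ℂ] Module.End ℂ V} {ρ' : Uq n q →ₐ[ℂ] Module.End ℂ W} {t : V →ₗ[ℂ] W}
    (h : ∀ x v, t (ρ (gen q x) v) = ρ' (gen q x) (t v)) (ξ : Uq n q) (v : V) :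
    t (ρ ξ v) = ρ' ξ (t v) := by
  obtain ⟨y, rfl⟩ := RingQuot.mkAlgHom_surjective ℂ (URel n q) ξ
  induction y using FreeAlgebra.induction generalizing v with
  | grade0 c => simp [AlgHom.commutes, Module.algebraMap_end_apply]
  | grade1 x => exact h x v
  | mul a b ha hb =>
    rw [map_mul, map_mul, map_mul, Module.End.mul_apply, Module.End.mul_apply, ha, hb]
  | add a b ha hb =>
    rw [map_add, map_add, map_add, LinearMap.add_apply, LinearMap.add_apply, map_add, ha, hb]

/-! ### The Toeplitz map intertwines the actions. -/

namespace BallAlg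
variable {n : ℕ} {q : QParam} {α : ℝ} (hα : 0 < α)

theorem piAct_gen (x : UGen n) : piAct n q α (Uq.gen q x) =
    UGen.elim (twE q (twist n q α)) (twF q (twist n q α)) (twK q (twist n q α))
      (twL q (twist n q α)) x := Uq.lift_gen _ x

/-- The twisted action is compatible with the multiplication by `f`: the form for `E`. -/
theorem piAct_E_mul (k : Fin n) (f ψ : BallAlg n q) :
    piAct n q α (Uq.gen q (.E k)) (f * ψ) =
      act n q (Uq.gen q (.E k)) f * ψ
        + act n q (Uq.gen q (.K k)) f * piAct n q α (Uq.gen q (.E k)) ψ := by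
  rw [piAct_gen, act_gen, act_gen]
  simp only [UGen.elim, AlgHom.toLinearMap_apply]
  obtain ⟨k', hk⟩ | hk := low_or_last k
  · have h : (k : ℕ) + 1 < n := hk ▸ k'.2
    rw [twE_low _ h, twE_low _ h, actE_mul]
  -- The correction term of the twisted `E` is `K(f ψ) z = K(f) (K(ψ) z)` up to a scalar, so it
  -- falls entirely on `ψ` and `f` feels only the untwisted action.
  · rw [BallAlg.twE_last _ hk, BallAlg.twE_last _ hk, actE_last hk, map_mul]
    simp only [smul_mul_assoc, mul_smul_comm, ← smul_add, sub_mul, mul_sub, mul_assoc]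
    congr 1
    abel

/-- In each term the twisting scalar is carried by the factor acting on `ψ`, through `K⁻¹` in the
first and `F` in the second. Together with its companions for `E` and `K`, this says that
multiplication by functions is compatible with `π_α`. -/
theorem piAct_F_mul (k : Fin n) (f ψ : BallAlg n q) :
    piAct n q α (Uq.gen q (.F k)) (f * ψ) =
      act n q (Uq.gen q (.F k)) f * piAct n q α (Uq.gen q (.L k)) ψ
        + f * piAct n q α (Uq.gen q (.F k)) ψ := by
  rw [piAct_gen, piAct_gen, act_gen]
  simp only [UGen.elim, AlgHom.toLinearMap_apply, twF, twL, LinearMap.smul_apply, actF_mul,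
    mul_smul_comm, smul_add]

theorem piAct_K_mul (k : Fin n) (f ψ : BallAlg n q) :
    piAct n q α (Uq.gen q (.K k)) (f * ψ) =
      act n q (Uq.gen q (.K k)) f * piAct n q α (Uq.gen q (.K k)) ψ := by
  rw [piAct_gen, act_gen]
  simp only [UGen.elim, AlgHom.toLinearMap_apply, twK, LinearMap.smul_apply, map_mul,
    mul_smul_comm]

theorem piAct_L_mul (k : Fin n) (f ψ : BallAlg n q) :
    piAct n q α (Uq.gen q (.L k)) (f * ψ) =
      act n q (Uq.gen q (.L k)) f * piAct n q α (Uq.gen q (.L k)) ψ := by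
  rw [piAct_gen, act_gen]
  simp only [UGen.elim, AlgHom.toLinearMap_apply, twL, LinearMap.smul_apply, map_mul,
    mul_smul_comm]

theorem piHolo_coe (ξ : Uq n q) (ψ : holo n q) :
    (piHolo n q α ξ ψ : BallAlg n q) = piAct n q α ξ (ψ : BallAlg n q) := rfl

/-- The canonical action on `End(ℂ[ℂ^n]_q)` as a homomorphism. -/
noncomputable def endHolo (n : ℕ) (q : QParam) (α : ℝ) :
    Uq n q →ₐ[ℂ] Module.End ℂ (HoloEnd n q) :=
  Uq.endHom (V := ↥(holo n q)) (piHolo n q α)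

theorem addCommGroup_add (a b : holo n q) : (@HAdd.hAdd _ _ _ (@instHAdd _
    (AddCommGroup.toAddCommMonoid (G := holo n q)).toAddMonoid.toAddSemigroup.toAdd) a b) =
      a + b := rfl

theorem endHolo_E (k : Fin n) (T : HoloEnd n q) (v : holo n q) :
    endHolo n q α (Uq.gen q (.E k)) T v + piHolo n q α (Uq.gen q (.K k))
      (T (piHolo n q α (Uq.gen q (.L k)) (piHolo n q α (Uq.gen q (.E k)) v))) =
      piHolo n q α (Uq.gen q (.E k)) (T v) := by
  have h := Uq.endHom_E_apply (V := ↥(holo n q)) (piHolo n q α) k T v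
  refine Eq.trans ((addCommGroup_add _ _).symm.trans ?_) h
  rfl

theorem endHolo_F (k : Fin n) (T : HoloEnd n q) (v : holo n q) :
    endHolo n q α (Uq.gen q (.F k)) T v +
      T (piHolo n q α (Uq.gen q (.F k)) (piHolo n q α (Uq.gen q (.K k)) v)) =
      piHolo n q α (Uq.gen q (.F k)) (T (piHolo n q α (Uq.gen q (.K k)) v)) := by
  have h := Uq.endHom_F_apply (V := ↥(holo n q)) (piHolo n q α) k T v
  refine Eq.trans ((addCommGroup_add _ _).symm.trans ?_) h
  rfl

theorem endHolo_K (k : Fin n) (T : HoloEnd n q) : endHolo n q α (Uq.gen q (.K k)) T =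
    piHolo n q α (Uq.gen q (.K k)) * T * piHolo n q α (Uq.gen q (.L k)) :=
  Uq.endHom_K (V := ↥(holo n q)) _ k T

theorem endHolo_L (k : Fin n) (T : HoloEnd n q) : endHolo n q α (Uq.gen q (.L k)) T =
    piHolo n q α (Uq.gen q (.L k)) * T * piHolo n q α (Uq.gen q (.K k)) :=
  Uq.endHom_L (V := ↥(holo n q)) _ k T

/-- Project the product rule for `π_α` to `ℂ[z]`: by `proj_act`, the left side becomes `π_α(x)`
applied to `T_f ψ`, and the terms on the right are Toeplitz operators. Solving for the one with
symbol `x(f)` gives the canonical action on `T_f`. -/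
theorem toeplitz_act (ξ : Uq n q) (f : BallAlg n q) :
    toeplitz n q hα (act n q ξ f) = endHolo n q α ξ (toeplitz n q hα f) := by
  have hK : ∀ k f, toeplitz n q hα (act n q (Uq.gen q (.K k)) f) =
      piHolo n q α (Uq.gen q (.K k)) * toeplitz n q hα f * piHolo n q α (Uq.gen q (.L k)) := by
    intro k f
    refine LinearMap.ext fun ψ => ?_
    have h := piAct_K_mul (α := α) k f (piHolo n q α (Uq.gen q (.L k)) ψ)
    rw [← piHolo_coe, Uq.KL_apply] at h
    rw [Module.End.mul_apply, Module.End.mul_apply, toeplitz_apply, toeplitz_apply, ← h, proj_act]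
  refine Uq.intertwine (ρ' := endHolo n q α) (fun x f => LinearMap.ext fun ψ => ?_) ξ f
  cases x with
  | E k =>
    refine add_right_cancel ((?_ : _ = _).trans (endHolo_E k _ ψ).symm)
    have h := congrArg (proj n q hα) (piAct_E_mul (α := α) k f (ψ : BallAlg n q))
    have h' := LinearMap.congr_fun (hK k f) (piHolo n q α (Uq.gen q (.E k)) ψ)
    rw [Module.End.mul_apply, Module.End.mul_apply] at h'
    rw [proj_act, map_add] at h
    rw [← h', toeplitz_apply, toeplitz_apply, toeplitz_apply, h, piHolo_coe]
  | F k =>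
    refine add_right_cancel ((?_ : _ = _).trans (endHolo_F k _ ψ).symm)
    -- The rule is applied to `K k ψ`, so that the `K⁻¹` in the Leibniz rule of `F` is undone.
    have h := congrArg (proj n q hα)
      (piAct_F_mul (α := α) k f (piHolo n q α (Uq.gen q (.K k)) ψ))
    rw [proj_act, map_add, ← piHolo_coe, ← piHolo_coe, Uq.LK_apply] at h
    rw [toeplitz_apply, toeplitz_apply, toeplitz_apply, h]
  | K k => rw [endHolo_K, hK]
  | L k =>
    rw [endHolo_L]
    have h := piAct_L_mul (α := α) k f (piHolo n q α (Uq.gen q (.K k)) ψ)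
    rw [← piHolo_coe, Uq.LK_apply] at h
    rw [Module.End.mul_apply, Module.End.mul_apply, toeplitz_apply, toeplitz_apply, ← h, proj_act]

end BallAlg
end QBall

/-! ### Weighted traces of operators with finitely many nonzero columns. -/

namespace QBall

open Finsupp (single)
open BallAlg Fock

namespace Fock
variable {n : ℕ} {q : QParam}

/-- Only finitely many columns of the matrix of `X` are nonzero. -/
def FinCols (X : Module.End ℂ (Fock n)) : Prop := {m | X (single m 1) ≠ 0}.Finite

namespace FinCols
variable {X Y : Module.End ℂ (Fock n)}

theorem mul_left (hX : FinCols X) (B : Module.End ℂ (Fock n)) : FinCols (B * X) :=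
  hX.subset fun m hm h => hm (by rw [Module.End.mul_apply, h, map_zero])

/-- Right multiplication can destroy finiteness in general. A shift maps at most one basis vector to
each line, so it only moves the finite set of columns. -/
theorem mul_shift (hX : FinCols X) {u v : Idx n} {b : Idx n → ℂ} {B : Module.End ℂ (Fock n)}
    (h : IsShift u v b B) : FinCols (X * B) := by
  refine ((hX.preimage (add_left_injective v).injOn).image (· + u)).subset fun m hm => ?_
  by_cases hu : u ≤ m
  · obtain ⟨s, rfl⟩ : ∃ s, m = s + u := ⟨m - u, (tsub_add_cancel_of_le hu).symm⟩
    refine ⟨s, fun h0 => hm ?_, rfl⟩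
    rw [Module.End.mul_apply, h.apply_add, map_smul, h0, smul_zero]
  · exact absurd (by rw [Module.End.mul_apply, h.apply_zero m hu, map_zero]) hm

theorem add (hX : FinCols X) (hY : FinCols Y) : FinCols (X + Y) :=
  (hX.union hY).subset fun m hm => by
    by_contra h
    simp only [Set.mem_union, Set.mem_ofPred_eq, not_or, not_not] at h
    exact hm (by rw [LinearMap.add_apply, h.1, h.2, add_zero])

theorem smul (hX : FinCols X) (c : ℂ) : FinCols (c • X) :=
  hX.subset fun m hm h => hm (by rw [LinearMap.smul_apply, h, smul_zero])

theorem of_add {Z : Module.End ℂ (Fock n)} (h : X + Y = Z) (hY : FinCols Y) (hZ : FinCols Z) :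
    FinCols X := by
  have e : X = Z + (-1 : ℂ) • Y := by
    refine LinearMap.ext fun v => ?_
    rw [← h]
    simp
  rw [e]
  exact hZ.add (hY.smul _)

end FinCols

/-- The trace with the weight `w`. -/
noncomputable def wtr (w : Idx n → ℂ) (X : Module.End ℂ (Fock n)) : ℂ :=
  ∑ᶠ m, w m * (X (single m 1)) m

theorem FinCols.hasSum {X : Module.End ℂ (Fock n)} (hX : FinCols X) (w : Idx n → ℂ) :
    HasSum (fun m => w m * (X (single m 1)) m) (wtr w X) := by
  have h : (Function.support fun m => w m * (X (single m 1)) m).Finite :=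
    hX.subset fun m hm h => hm (by simp only [h, Finsupp.zero_apply, mul_zero])
  rw [wtr, ← tsum_eq_finsum (L := .unconditional _) h]
  exact (summable_of_hasFiniteSupport h).hasSum

section wtr
variable {w : Idx n → ℂ} {X Y : Module.End ℂ (Fock n)}

theorem wtr_add (hX : FinCols X) (hY : FinCols Y) : wtr w (X + Y) = wtr w X + wtr w Y := by
  refine ((hX.add hY).hasSum w).unique ?_
  simpa only [LinearMap.add_apply, Finsupp.add_apply, mul_add] using (hX.hasSum w).add (hY.hasSum w)

theorem wtr_smul (c : ℂ) : wtr w (c • X) = c * wtr w X := by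
  simp only [wtr, LinearMap.smul_apply, Finsupp.smul_apply, smul_eq_mul, mul_left_comm _ c]
  rw [← smul_eq_mul, smul_finsum]
  rfl

theorem wtr_congr (h : ∀ m, (X (single m 1)) m = (Y (single m 1)) m) : wtr w X = wtr w Y := by
  simp only [wtr, h]

theorem wtr_diag_conj {d : Idx n → ℂ} (hd : ∀ m, d m ≠ 0) :
    wtr w (diag d * X * diag d⁻¹) = wtr w X := by
  refine wtr_congr fun m => ?_
  rw [Module.End.mul_apply, Module.End.mul_apply, diag_single, map_smul, map_smul,
    Finsupp.smul_apply, diag_coord, Pi.inv_apply, smul_eq_mul, inv_mul_cancel_left₀ (hd m)]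

variable {u v : Idx n} {b : Idx n → ℂ} {B : Module.End ℂ (Fock n)}

theorem summable_of_finCols (hX : FinCols X) (g : Idx n → ℂ) (x : Idx n → Idx n) (v : Idx n) :
    Summable fun s => g s * (X (single (s + v) 1)) (x s) := by
  refine summable_of_hasFiniteSupport ((hX.preimage (add_left_injective v).injOn).subset
    fun s hs h => hs ?_)
  simp only [h, Finsupp.zero_apply, mul_zero]

/-- With finitely many columns the convergence required by `hasSum_commE` is automatic, and both
terms of the twisted commutator have a trace of their own. -/
theorem wtr_commE (h : IsShift u v b B) {κ : Idx n → ℂ} (hκ : ∀ m, κ m ≠ 0)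
    (hw : ∀ s, w (s + v) * κ (s + v) = w (s + u) * κ (s + u)) (hX : FinCols X) :
    wtr w (B * X) = wtr w (diag κ * X * diag κ⁻¹ * B) := by
  have h1 := (hX.mul_left B).hasSum w
  have h2 := (((hX.mul_left (diag κ)).mul_shift (isShift_diag κ⁻¹)).mul_shift h).hasSum w
  have h3 := h1.sub h2
  have h4 := h.hasSum_commE hκ hw X (by
    simpa only [mul_assoc] using summable_of_finCols hX (fun s => w (s + v) * b s) (· + u) v)
  refine sub_eq_zero.1 (h3.unique (Eq.mp (congrArg (HasSum · 0) (funext fun m => ?_)) h4))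
  rw [LinearMap.sub_apply, Finsupp.sub_apply, mul_sub]

theorem wtr_commF (h : IsShift u v b B) {κ : Idx n → ℂ}
    (hw : ∀ s, w (s + v) * κ (s + v) = w (s + u) * κ (s + u)) (hX : FinCols X) :
    wtr w (B * X * diag κ) = wtr w (X * B * diag κ) := by
  have h1 := ((hX.mul_left B).mul_shift (isShift_diag κ)).hasSum w
  have h2 := ((hX.mul_shift h).mul_shift (isShift_diag κ)).hasSum w
  have h3 := h1.sub h2
  have h4 := h.hasSum_commF hw X (by
    simpa only [mul_assoc] using
      summable_of_finCols hX (fun s => w (s + v) * (κ (s + v) * b s)) (· + u) v)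
  refine sub_eq_zero.1 (h3.unique (Eq.mp (congrArg (HasSum · 0) (funext fun m => ?_)) h4))
  rw [end_sub_mul, LinearMap.sub_apply, Finsupp.sub_apply, mul_sub]

end wtr
end Fock

/-! ### The modular element and the two invariant traces. -/

section Modular
variable {n : ℕ} {q : QParam}

/-- The weights of the element `∏ K j ^ (- j (n + 1 - j))`. -/
noncomputable def modWeight (n : ℕ) (q : QParam) (i : Fin n) : ℂˣ :=
  Units.mk0 (qc q) (qc_ne_zero q) ^ (-∑ j : Fin n, ((j : ℤ) + 1) * (n - j) * wt j i)

/-- In the usual numbering the numbers `j (n + 1 - j)` are the coefficients of the sum of the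
positive roots in the simple roots, and this sum pairs to `2` with every simple coroot. -/
theorem sum_cartan (k : Fin n) :
    ∑ j : Fin n, ((j : ℤ) + 1) * (n - j) * CartanMatrix.A n j k = 2 := by
  -- At most three entries of a column of the Cartan matrix are nonzero. At the two ends of the
  -- diagram the missing neighbour needs no correction, because its coefficient `k (n - k + 1)` or
  -- `(k + 2) (n - k - 1)` is zero there.
  have h : ∀ j : Fin n, ((j : ℤ) + 1) * (n - j) * CartanMatrix.A n j k =
      (if (j : ℕ) = k then 2 * (((k : ℕ) : ℤ) + 1) * (n - k) else 0)
        - (if (j : ℕ) + 1 = k then ((k : ℕ) : ℤ) * (n - k + 1) else 0)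
        - (if (j : ℕ) = k + 1 then (((k : ℕ) : ℤ) + 2) * (n - k - 1) else 0) := by
    intro j
    simp only [CartanMatrix.A, Matrix.of_apply, Fin.ext_iff]
    by_cases h1 : (j : ℕ) = k
    · rw [if_pos h1, if_pos h1, if_neg (by lia), if_neg (by lia), h1]; ring
    · rw [if_neg h1, if_neg h1]
      by_cases h2 : (j : ℕ) + 1 = k
      · rw [if_pos (Or.inl h2), if_pos h2, if_neg (by lia), ← h2]; push_cast; ring
      · by_cases h3 : (j : ℕ) = k + 1
        · rw [if_pos (Or.inr h3.symm), if_neg h2, if_pos h3, h3]; push_cast; ring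
        · rw [if_neg (by lia), if_neg h2, if_neg h3]; ring
  have hk := k.2
  simp only [h, Finset.sum_sub_distrib]
  rw [Finset.sum_eq_single k (by intro j _ hj; rw [if_neg (by simpa [Fin.ext_iff] using hj)])
    (by simp), if_pos rfl]
  have e2 : ∑ j : Fin n, (if (j : ℕ) + 1 = k then ((k : ℕ) : ℤ) * (n - k + 1) else 0) =
      ((k : ℕ) : ℤ) * (n - k + 1) := by
    by_cases h0 : (k : ℕ) = 0
    · rw [h0]; simp
    · rw [Finset.sum_eq_single (⟨k - 1, by lia⟩ : Fin n)
        (by intro j _ hj; rw [if_neg (by simp only [ne_eq, Fin.ext_iff] at hj; lia)]) (by simp),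
        if_pos (by simp only; lia)]
  have e3 : ∑ j : Fin n, (if (j : ℕ) = k + 1 then (((k : ℕ) : ℤ) + 2) * (n - k - 1) else 0) =
      (((k : ℕ) : ℤ) + 2) * (n - k - 1) := by
    by_cases h0 : (k : ℕ) + 1 < n
    · rw [Finset.sum_eq_single (⟨k + 1, h0⟩ : Fin n)
        (by intro j _ hj; rw [if_neg (by simpa [Fin.ext_iff] using hj)]) (by simp), if_pos rfl]
    · have : (n : ℤ) - k - 1 = 0 := by lia
      rw [this]; simp
  rw [e2, e3]
  ring

/-- The invariance property of the modular weight. -/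
theorem modWeight_balance (k : Fin n) (s : Idx n) :
    chr (modWeight n q) (s + Pi.single k 1) * chr (weight q k) (s + Pi.single k 1) =
      chr (modWeight n q) (s + next k) * chr (weight q k) (s + next k) := by
  have hs := sum_cartan k
  simp only [chr_add, chr_single]
  obtain ⟨k', hk⟩ | hk := low_or_last k
  · rw [next_low hk, chr_single, chr_single]
    -- By `wt_sub`, the differences of weights between `k` and `k'` are Cartan entries. The modular
    -- weight contributes `-2` to the exponent by `sum_cartan`, and `K k` contributes `a_kk = 2`.
    have : modWeight n q k * weight q k k = modWeight n q k' * weight q k k' := by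
      unfold modWeight weight
      rw [← zpow_add, ← zpow_add]
      congr 1
      simp only [wt_sub _ hk, mul_add, Finset.sum_add_distrib, hs, cartan_self]
      ring
    have this' := congrArg (Units.val) this
    rw [Units.val_mul, Units.val_mul] at this'
    linear_combination chr (modWeight n q) s * chr (weight q k) s * this'
  · rw [next_last hk, chr_zero, chr_zero]
    have : modWeight n q k * weight q k k = 1 := by
      unfold modWeight weight
      rw [← zpow_add, ← zpow_zero (Units.mk0 (qc q) (qc_ne_zero q))]
      congr 1
      simp only [wt_last _ hk, hs, cartan_self]
      norm_num
    have this' := congrArg (Units.val) this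
    rw [Units.val_mul, Units.val_one] at this'
    linear_combination chr (modWeight n q) s * chr (weight q k) s * this'

theorem prod_weight_inv : ((List.finRange n).map fun i => (weight q i)⁻¹ ^ (((i : ℕ) + 1) *
    (n - i))).prod = modWeight n q := by
  funext i
  rw [← List.ofFn_eq_map, List.prod_ofFn, Finset.prod_apply, modWeight, ← Finset.sum_neg_distrib]
  have : ∀ (s : Finset (Fin n)) (f : Fin n → ℤ), Units.mk0 (qc q) (qc_ne_zero q) ^ (∑ j ∈ s, f j) =
      ∏ j ∈ s, Units.mk0 (qc q) (qc_ne_zero q) ^ f j := fun s f => by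
    induction s using Finset.cons_induction with
    | empty => simp
    | cons a s ha ih => rw [Finset.sum_cons, Finset.prod_cons, zpow_add, ih]
  rw [this]
  refine Finset.prod_congr rfl fun j _ => ?_
  rw [Pi.pow_apply, Pi.inv_apply, weight, inv_pow, ← zpow_natCast, ← zpow_mul, ← zpow_neg]
  congr 1
  have := j.2
  push_cast [this.le]
  ring

/-- Each twisted `K⁻¹` is a scalar times a diagonal automorphism, hence so is the product. The
scalar is only needed to be nonzero, since vanishing and comparison of traces do not see it. -/
theorem twAct_modular (c : ℂˣ) : ∃ d : ℂˣ, ∀ f : BallAlg n q,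
    twAct n q c (modular n q) f = (d : ℂ) • scale (modWeight n q) f := by
  rw [← prod_weight_inv, modular]
  generalize List.finRange n = l
  have hp : ∀ (k : Fin n) (a : ℕ), ∃ d : ℂˣ, ∀ f : BallAlg n q,
      twAct n q c (Uq.gen q (.L k) ^ a) f = (d : ℂ) • scale ((weight q k)⁻¹ ^ a) f := by
    intro k a
    induction a with
    | zero =>
      refine ⟨1, fun f => ?_⟩
      rw [pow_zero, pow_zero, map_one, Units.val_one, one_smul, scale_one, Module.End.one_apply]
    | succ a ih =>
      obtain ⟨d, hd⟩ := ih
      refine ⟨(lastScalar c k)⁻¹ * d, fun f => ?_⟩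
      rw [pow_succ', pow_succ', map_mul, Module.End.mul_apply, hd, map_smul, ← scale_scale,
        Units.val_mul, mul_smul, smul_comm]
      congr 1
      unfold twAct
      rw [Uq.lift_gen, UGen.elim, twL, LinearMap.smul_apply, Units.val_inv_eq_inv_val]
      rfl
  induction l with
  | nil =>
    refine ⟨1, fun f => ?_⟩
    rw [List.map_nil, List.map_nil, List.prod_nil, List.prod_nil, map_one, Units.val_one, one_smul,
      scale_one, Module.End.one_apply]
  | cons k l ih =>
    obtain ⟨d, hd⟩ := ih
    obtain ⟨d', hd'⟩ := hp k (((k : ℕ) + 1) * (n - k))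
    refine ⟨d * d', fun f => ?_⟩
    rw [List.map_cons, List.map_cons, List.prod_cons, List.prod_cons, map_mul,
      Module.End.mul_apply, hd, map_smul, hd', scale_scale, smul_smul, Units.val_mul]

theorem fock_scale_zmon (w : Fin n → ℂˣ) (m : Idx n) :
    fock n q (scale w (zmon q m)) (single 0 1) = chr w m • single m 1 := by
  rw [fock_scale, Module.End.mul_apply, Module.End.mul_apply, diag_single, map_smul, map_smul,
    fock_zmon_zero, diag_single, Pi.inv_apply, chr_zero, inv_one, one_smul]

theorem vac_piHolo_modular (α : ℝ) : ∃ d : ℂˣ, ∀ m : Idx n,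
    piHolo n q α (modular n q) ⟨zmon q m, zmon_mem m⟩ =
      ((d : ℂ) * chr (modWeight n q) m) • (⟨zmon q m, zmon_mem m⟩ : holo n q) := by
  obtain ⟨d, hd⟩ := twAct_modular (n := n) (q := q) (twist n q α)
  refine ⟨d, fun m => (vac n q).injective ?_⟩
  rw [map_smul, vac_zmon, vac_apply, piHolo_coe, piAct, hd, map_smul, LinearMap.smul_apply,
    fock_scale_zmon, mul_smul]

/-- The invariant integral as a weighted trace. -/
theorem exists_invInt_eq (n : ℕ) (q : QParam) : ∃ c : ℂ, c ≠ 0 ∧ ∀ f : BallAlg n q,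
    invInt f = c * wtr (chr (modWeight n q)) (fock n q f) := by
  obtain ⟨d, hd⟩ := twAct_modular (n := n) (q := q) 1
  have hq : (qPoch q ((q : ℝ) ^ 2) n : ℂ) ≠ 0 :=
    Complex.ofReal_ne_zero.2 (qPoch_pos (pow_pos q.2.1 _)
      (pow_lt_one₀ q.2.1.le q.2.2 two_ne_zero) n).ne'
  refine ⟨_, mul_ne_zero hq d.ne_zero, fun f => ?_⟩
  rw [invInt, mul_assoc, ← wtr_smul]
  congr 1
  refine finsum_congr fun m => ?_
  rw [coeff, entry, map_mul, Module.End.mul_apply, act, hd, map_smul, LinearMap.smul_apply,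
    fock_scale_zmon, map_smul, map_smul, LinearMap.smul_apply, Finsupp.smul_apply,
    Finsupp.smul_apply, Finsupp.smul_apply, smul_eq_mul, smul_eq_mul, smul_eq_mul]
  ring

end Modular
end QBall

/-! ### Finite functions, matrix units and the generators as matrices. -/

namespace QBall

open Finsupp (single)
open BallAlg Fock

namespace BallAlg
variable {n : ℕ} {q : QParam} {α : ℝ}

theorem vacuum_apply (x : Fock n) : vacuum n x = x 0 • single 0 1 := by
  induction x using Finsupp.induction_linear with
  | zero => simp
  | add x y hx hy => rw [map_add, hx, hy, Finsupp.add_apply, add_smul]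
  | single m c =>
    rw [← mul_one c, ← smul_eq_mul, ← Finsupp.smul_single, map_smul, vacuum_single]
    by_cases h : m = 0
    · subst h; simp
    · simp [h]

/-- `a f0 b` kills `e m` unless `T(b) e m` has a component along `e 0`, which by the band property
of `T(b)` happens for finitely many `m`. -/
theorem finCols_fock {f : BallAlg n q} (hf : f ∈ finiteFun n q) : FinCols (fock n q f) := by
  induction hf using Submodule.span_induction with
  | zero =>
    refine Set.finite_empty.subset fun m hm => hm ?_
    rw [map_zero, LinearMap.zero_apply]
  | add x y _ _ hx hy => rw [map_add]; exact hx.add hy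
  | smul c x _ hx => rw [map_smul]; exact hx.smul c
  | mem x hx =>
    obtain ⟨a, b, rfl⟩ := hx
    rw [mul_assoc, map_mul]
    refine FinCols.mul_left ?_ _
    obtain ⟨d, hd⟩ := exists_band b
    refine (Set.finite_Iic (fun _ : Fin n => d)).subset fun m hm i => ?_
    have : entry b 0 m ≠ 0 := fun h => hm (by
      rw [map_mul, Module.End.mul_apply, fock_f0, vacuum_apply, ← entry_apply, h, zero_smul])
    simpa using (hd _ _ this i).2

/-- The finite function whose only nonzero matrix entry is at `(r, p)`. -/
noncomputable def munit (q : QParam) (r p : Idx n) : finiteFun n q :=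
  ⟨(nrm q p : ℂ)⁻¹ • (zmon q r * f0 n q * conj (zmon q p)),
    Submodule.smul_mem _ _ (Submodule.subset_span ⟨_, _, rfl⟩)⟩

/-- The conjugate of `z^p` lowers `e m` by `p`, the vacuum projection keeps only `m = p`, and `z^r`
raises the vacuum to `e r`; the norm in `munit` is the scalar picked up on the way down. -/
theorem fock_munit (r p m : Idx n) :
    fock n q (munit q r p : BallAlg n q) (single m 1) = if m = p then single r 1 else 0 := by
  have h := (isAdj_conj (zmon q p)).isShift (isShift_zmon p)
  rw [munit, map_smul, map_mul, map_mul, LinearMap.smul_apply, Module.End.mul_apply,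
    Module.End.mul_apply, fock_f0]
  by_cases hp : p ≤ m
  · obtain ⟨s, rfl⟩ : ∃ s, m = s + p := ⟨m - p, (tsub_add_cancel_of_le hp).symm⟩
    rw [h.apply_add, map_smul, vacuum_single]
    by_cases hs : s = 0
    · subst hs
      have hn := nrm_ne_zero (q := q) p
      simp only [zero_add, add_zero, if_true, map_smul, fock_zmon_zero, zcoef_zero, map_one,
        nrm_zero, Complex.ofReal_one, one_mul, div_one, smul_smul, inv_mul_cancel₀ hn, one_smul]
    · have : s + p ≠ p := fun e => hs (by simpa using e)
      simp [hs]
  · rw [h.apply_zero m hp, map_zero, map_zero, smul_zero, if_neg]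
    rintro rfl; exact hp le_rfl

theorem entry_munit (r p a b : Idx n) :
    entry (munit q r p : BallAlg n q) a b = if a = r ∧ b = p then 1 else 0 := by
  rw [entry, fock_munit]
  by_cases h : b = p
  · subst h
    by_cases h' : a = r
    · subst h'; simp
    · simp [h', Finsupp.single_eq_of_ne h']
  · simp [h]

section proj
variable (hα : 0 < α)

/-- `T(z^m)` maps into the span of the `e (s + m)`, so the hypothesis makes `T(f z^m)` zero; the
weighted integral depends on a function only through its image under `T`. -/
theorem toeplitz_eq_zero_of_forall {f : BallAlg n q} {m : Idx n}
    (h : ∀ s, fock n q f (single (s + m) 1) = 0) :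
    toeplitz n q hα f ⟨zmon q m, zmon_mem m⟩ = 0 := by
  have h0 : fock n q (f * zmon q m) = 0 := by
    refine end_ext fun s => ?_
    have e := (isShift_zmon (q := q) m).apply_add s
    rw [add_zero] at e
    rw [map_mul, Module.End.mul_apply, e, map_smul, h, smul_zero, LinearMap.zero_apply]
  have h1 : projCoeffs n q hα (f * zmon q m) = 0 := by
    ext p
    have h2 : ∀ s, entry (conj (zmon q p) * (f * zmon q m)) s s = 0 := fun s => by
      rw [entry, map_mul, h0, mul_zero]; rfl
    have h3 : wInt n q hα (conj (zmon q p) * (f * zmon q m)) = 0 := wInt_eq hα (by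
      simp only [h2, mul_zero]
      exact hasSum_zero)
    rw [projCoeffs_apply, h3, zero_div, Finsupp.zero_apply]
  rw [toeplitz_apply, proj, LinearMap.comp_apply, h1, map_zero]

end proj

/-- The matrix of an operator in the space of holomorphic polynomials. -/
noncomputable def vacConj (n : ℕ) (q : QParam) : HoloEnd n q →ₗ[ℂ] Module.End ℂ (Fock n) :=
  (vac n q).conj.toLinearMap

theorem vacConj_apply (A : HoloEnd n q) (x : Fock n) :
    vacConj n q A x = vac n q (A ((vac n q).symm x)) := rfl

theorem vacConj_single (A : HoloEnd n q) (m : Idx n) :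
    vacConj n q A (single m 1) = vac n q (A ⟨zmon q m, zmon_mem m⟩) := by
  rw [vacConj_apply, vac_symm_single]

theorem vacConj_mul (A B : HoloEnd n q) :
    vacConj n q (A * B) = vacConj n q A * vacConj n q B := by
  refine LinearMap.ext fun x => ?_
  rw [Module.End.mul_apply, vacConj_apply, vacConj_apply, vacConj_apply,
    LinearEquiv.symm_apply_apply, Module.End.mul_apply]

/-- Column `m` of `T_f` can be nonzero only if `T(f)` has a nonzero column `p ≥ m`, which leaves
finitely many `m`. -/
theorem finCols_toeplitz (hα : 0 < α) {f : BallAlg n q} (hf : f ∈ finiteFun n q) :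
    FinCols (vacConj n q (toeplitz n q hα f)) := by
  have h := finCols_fock hf
  refine (h.biUnion fun p _ => Set.finite_Iic p).subset fun m hm => ?_
  by_contra hc
  simp only [Set.mem_iUnion, not_exists] at hc
  refine hm ?_
  rw [vacConj_single, toeplitz_eq_zero_of_forall, map_zero]
  exact fun s => by_contra fun hs => hc (s + m) hs (le_add_self : m ≤ s + m)

theorem exists_qTrace_eq (n : ℕ) (q : QParam) {α : ℝ} (hα : 0 < α) : ∃ c : ℂ, c ≠ 0 ∧
    ∀ A : HoloEnd n q, qTrace α A = c * wtr (chr (modWeight n q)) (vacConj n q A) := by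
  obtain ⟨d, hd⟩ := vac_piHolo_modular (n := n) (q := q) α
  have h0 := q.2.1
  have hq : ((((q : ℝ) ^ ((n : ℝ) * (n + α + 1)) * qPoch q ((q : ℝ) ^ 2) n) /
      qPoch q ((q : ℝ) ^ (2 + 2 * α)) n : ℝ) : ℂ) ≠ 0 :=
    Complex.ofReal_ne_zero.2 (div_pos (mul_pos (Real.rpow_pos_of_pos h0 _)
      (qPoch_pos (pow_pos h0 _) (pow_lt_one₀ h0.le q.2.2 two_ne_zero) n))
      (qPoch_pos (Real.rpow_pos_of_pos h0 _)
        (Real.rpow_lt_one h0.le q.2.2 (by positivity)) n)).ne'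
  refine ⟨_, mul_ne_zero hq d.ne_zero, fun A => ?_⟩
  rw [qTrace, mul_assoc, ← wtr_smul]
  congr 1
  refine finsum_congr fun m => ?_
  rw [hd, map_smul, LinearMap.smul_apply, vacConj_single, vac_apply, coeff, entry,
    Submodule.coe_smul, map_smul, LinearMap.smul_apply, Finsupp.smul_apply, Finsupp.smul_apply,
    smul_eq_mul, smul_eq_mul]
  ring

/-! ### The generators in the Fock space -/

theorem hatF_vacuum (k : Fin n) : hatF q k (single 0 1) = 0 := by
  obtain ⟨b, hb⟩ := exists_isShift_hatF (q := q) k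
  exact hb.apply_zero 0 (not_single_le rfl)

theorem vac_piHolo (x : UGen n) (ψ : holo n q) : vac n q (piHolo n q α (Uq.gen q x) ψ) =
    fock n q (UGen.elim (twE q (twist n q α)) (twF q (twist n q α)) (twK q (twist n q α))
      (twL q (twist n q α)) x (ψ : BallAlg n q)) (single 0 1) := by
  rw [vac_apply, piHolo_coe, piAct_gen]

theorem vacConj_K (k : Fin n) : vacConj n q (piHolo n q α (Uq.gen q (.K k))) =
    (lastScalar (twist n q α) k : ℂ) • diag (chr (weight q k)) := by
  refine end_ext fun m => ?_
  rw [vacConj_single, vac_piHolo, UGen.elim, twK, LinearMap.smul_apply, map_smul,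
    AlgHom.toLinearMap_apply, actK, LinearMap.smul_apply, LinearMap.smul_apply, fock_scale_zmon,
    diag_single]

theorem vacConj_L (k : Fin n) : vacConj n q (piHolo n q α (Uq.gen q (.L k))) =
    (lastScalar (twist n q α) k : ℂ)⁻¹ • diag (chr (weight q k))⁻¹ := by
  refine end_ext fun m => ?_
  rw [vacConj_single, vac_piHolo, UGen.elim, twL, LinearMap.smul_apply, map_smul,
    AlgHom.toLinearMap_apply, actL, LinearMap.smul_apply, LinearMap.smul_apply, fock_scale_zmon,
    diag_single, chr_inv]

/-- Since `hatF` annihilates the vacuum, only one term of the commutator survives on `z^m e 0`. The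
balance conditions depend on the shift vectors and not on the coefficients, so the latter need not
be known. -/
theorem exists_isShift_F (k : Fin n) : ∃ b, IsShift (Pi.single k 1) (next k) b
    (vacConj n q (piHolo n q α (Uq.gen q (.F k)))) := by
  obtain ⟨b, hb⟩ := exists_isShift_hatF (q := q) k
  have e : vacConj n q (piHolo n q α (Uq.gen q (.F k))) =
      (lastScalar (twist n q α) k : ℂ)⁻¹ • hatF q k := by
    refine end_ext fun m => ?_
    rw [vacConj_single, vac_piHolo, UGen.elim, twF, LinearMap.smul_apply, map_smul,
      LinearMap.smul_apply, LinearMap.smul_apply, fock_actF, Module.End.mul_apply, diag_single,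
      chr_zero, one_smul, LinearMap.sub_apply, Module.End.mul_apply, Module.End.mul_apply,
      hatF_vacuum, map_zero, fock_zmon_zero, sub_zero]
  exact ⟨_, e ▸ hb.smul _⟩

theorem exists_isShift_E (k : Fin n) : ∃ b, IsShift (next k) (Pi.single k 1) b
    (vacConj n q (piHolo n q α (Uq.gen q (.E k)))) := by
  obtain ⟨k', hk⟩ | hk := low_or_last k
  · obtain ⟨b, hb⟩ := exists_isShift_hatE (q := q) k
    have e : vacConj n q (piHolo n q α (Uq.gen q (.E k))) = hatE q k := by
      have h0 : hatE q k (single 0 1) = 0 := hb.apply_zero 0 (by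
        rw [next_low hk]; exact not_single_le rfl)
      have h : (k : ℕ) + 1 < n := hk ▸ k'.2
      refine end_ext fun m => ?_
      rw [vacConj_single, vac_piHolo, UGen.elim, twE_low _ h, fock_actE, LinearMap.sub_apply,
        Module.End.mul_apply, Module.End.mul_apply, h0, map_zero, fock_zmon_zero, sub_zero]
    exact ⟨b, e ▸ hb⟩
  · rw [next_last hk]
    -- Here the raising operator does not kill the vacuum, so both terms of the twisted `E`
    -- contribute; each is a multiple of the same basis vector.
    have e : ∀ m : Idx n, ∃ b : ℂ, vacConj n q (piHolo n q α (Uq.gen q (.E k))) (single m 1) =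
        b • single (m + Pi.single k 1) 1 := fun m => by
      have h1 := (isShift_raise q k).apply_add m
      have h2 := (isShift_raise q k).apply_add 0
      have h3 := (isShift_zmon (q := q) m).apply_add (Pi.single k 1)
      rw [add_zero] at h1 h3
      rw [add_zero, zero_add] at h2
      rw [vacConj_single, vac_piHolo, UGen.elim, BallAlg.twE_last _ hk, map_smul, map_sub, map_smul,
        map_mul, map_mul, fock_z, LinearMap.smul_apply, LinearMap.sub_apply, LinearMap.smul_apply,
        Module.End.mul_apply, Module.End.mul_apply, fock_zmon_zero, h1, h2, map_smul, fock_actK,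
        Module.End.mul_apply, Module.End.mul_apply, diag_single, map_smul, h3, map_smul, map_smul,
        diag_single, add_comm (Pi.single k 1) m]
      simp only [smul_smul, ← sub_smul]
      exact ⟨_, rfl⟩
    choose b hb using e
    exact ⟨b, fun s => by rw [add_zero, hb], fun m hm => absurd (fun _ => Nat.zero_le _) hm⟩

end BallAlg
end QBall

/-! ### The antipode on generators. -/

namespace QBall

open Finsupp (single)
open BallAlg Fock

section antipode
variable {n : ℕ} {q : QParam}

theorem neg_eq_smul {A : Type*} [Ring A] [Algebra ℂ A] (a : A) : -a = (-1 : ℂ) • a := by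
  rw [neg_smul, one_smul]

/-- The value of the antipode on a generator. -/
noncomputable def Uq.antiGen (q : QParam) (x : UGen n) : Uq n q :=
  (Uq.antipode n q (Uq.gen q x)).unop

theorem Uq.antiGen_E (k : Fin n) :
    antiGen q (.E k) = (-1 : ℂ) • (gen q (.L k) * gen q (.E k)) := by
  rw [antiGen, antipode, Uq.lift_gen, UGen.elim, MulOpposite.unop_op]
  exact neg_eq_smul _

theorem Uq.antiGen_F (k : Fin n) :
    antiGen q (.F k) = (-1 : ℂ) • (gen q (.F k) * gen q (.K k)) := by
  rw [antiGen, antipode, Uq.lift_gen, UGen.elim, MulOpposite.unop_op]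
  exact neg_eq_smul _

theorem Uq.antiGen_K (k : Fin n) : antiGen q (.K k) = gen q (.L k) := by
  rw [antiGen, antipode, Uq.lift_gen, UGen.elim, MulOpposite.unop_op]

theorem Uq.antiGen_L (k : Fin n) : antiGen q (.L k) = gen q (.K k) := by
  rw [antiGen, antipode, Uq.lift_gen, UGen.elim, MulOpposite.unop_op]

end antipode

namespace BallAlg
variable {n : ℕ} {q : QParam} {α : ℝ}

/-! ### Invariance of the integral over finite functions -/

theorem end_sub_add_cancel (A B : Module.End ℂ (Fock n)) : A - B + B = A :=
  LinearMap.ext fun _ => sub_add_cancel (_ : Fock n) _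

theorem act_mem (ξ : Uq n q) {f : BallAlg n q} (hf : f ∈ finiteFun n q) :
    act n q ξ f ∈ finiteFun n q := (finAct n q ξ ⟨f, hf⟩).2

theorem mul_mem_finiteFun (a : BallAlg n q) {f : BallAlg n q} (hf : f ∈ finiteFun n q) :
    a * f ∈ finiteFun n q := by simpa using finiteFun_mul a hf 1

theorem invInt_add {f g : BallAlg n q} (hf : f ∈ finiteFun n q) (hg : g ∈ finiteFun n q) :
    invInt (f + g) = invInt f + invInt g := by
  obtain ⟨c, -, hc⟩ := exists_invInt_eq n q
  rw [hc, hc, hc, map_add, wtr_add (finCols_fock hf) (finCols_fock hg), mul_add]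

theorem invInt_smul (c : ℂ) (f : BallAlg n q) : invInt (c • f) = c * invInt f := by
  obtain ⟨d, -, hd⟩ := exists_invInt_eq n q
  rw [hd, hd, map_smul, wtr_smul, mul_left_comm]

theorem act_K (k : Fin n) (f : BallAlg n q) : act n q (Uq.gen q (.K k)) f = actK q k f := by
  rw [act_gen]; rfl

theorem act_L (k : Fin n) (f : BallAlg n q) : act n q (Uq.gen q (.L k)) f = actL q k f := by
  rw [act_gen]; rfl

theorem act_E (k : Fin n) (f : BallAlg n q) : act n q (Uq.gen q (.E k)) f = actE q k f := by
  rw [act_gen]; rfl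

theorem act_F (k : Fin n) (f : BallAlg n q) : act n q (Uq.gen q (.F k)) f = actF q k f := by
  rw [act_gen]; rfl

theorem invInt_act_E (k : Fin n) {f : BallAlg n q} (hf : f ∈ finiteFun n q) :
    invInt (act n q (Uq.gen q (.E k)) f) = 0 := by
  obtain ⟨c, -, hc⟩ := exists_invInt_eq n q
  obtain ⟨b, hb⟩ := exists_isShift_hatE (q := q) k
  have hX := finCols_fock hf
  have e := wtr_commE hb (chr_ne_zero (weight q k)) (modWeight_balance k) hX
  rw [← fock_actK] at e
  have hE : fock n q (act n q (Uq.gen q (.E k)) f) + fock n q (actK q k f) * hatE q k =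
      hatE q k * fock n q f := by
    rw [act_E, fock_actE, end_sub_add_cancel]
  have hK : FinCols (fock n q (actK q k f)) := act_K (q := q) k f ▸ finCols_fock (act_mem _ hf)
  rw [← hE, wtr_add (finCols_fock (act_mem _ hf)) (hK.mul_shift hb)] at e
  rw [hc, add_eq_right.1 e, mul_zero]

theorem invInt_act_F (k : Fin n) {f : BallAlg n q} (hf : f ∈ finiteFun n q) :
    invInt (act n q (Uq.gen q (.F k)) f) = 0 := by
  obtain ⟨c, -, hc⟩ := exists_invInt_eq n q
  obtain ⟨b, hb⟩ := exists_isShift_hatF (q := q) k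
  have hX := finCols_fock hf
  have e := wtr_commF (κ := chr (weight q k)) hb (fun s => (modWeight_balance k s).symm) hX
  have hF : fock n q (act n q (Uq.gen q (.F k)) f) +
      fock n q f * hatF q k * diag (chr (weight q k)) =
      hatF q k * fock n q f * diag (chr (weight q k)) := by
    rw [act_F, fock_actF, end_sub_mul, end_sub_add_cancel]
  rw [← hF, wtr_add (finCols_fock (act_mem _ hf)) ((hX.mul_shift hb).mul_shift (isShift_diag _))]
    at e
  rw [hc, add_eq_right.1 e, mul_zero]

theorem invInt_scale (w : Fin n → ℂˣ) (f : BallAlg n q) : invInt (scale w f) = invInt f := by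
  obtain ⟨c, -, hc⟩ := exists_invInt_eq n q
  rw [hc, hc, wtr_congr fun m => entry_scale w f m]

theorem invInt_act_K (k : Fin n) (f : BallAlg n q) :
    invInt (act n q (Uq.gen q (.K k)) f) = invInt f := by rw [act_K]; exact invInt_scale _ f

theorem invInt_act_L (k : Fin n) (f : BallAlg n q) :
    invInt (act n q (Uq.gen q (.L k)) f) = invInt f := by rw [act_L]; exact invInt_scale _ f

/-- The usual consequence of an invariant functional on a module algebra: `ξ` is moved across the
product as `S(ξ)`. Only `f` has to be finite, since finite functions form an ideal. -/
theorem invInt_act_mul (x : UGen n) (χ : BallAlg n q) {f : BallAlg n q}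
    (hf : f ∈ finiteFun n q) :
    invInt (act n q (Uq.gen q x) χ * f) = invInt (χ * act n q (Uq.antiGen q x) f) := by
  have hm := fun (a : BallAlg n q) {y : BallAlg n q} (hy : y ∈ finiteFun n q) =>
    mul_mem_finiteFun a hy
  cases x with
  | E k =>
    have h0 := invInt_act_E k (hm χ hf)
    -- The term `K χ · E f` of the Leibniz rule equals `K (χ · K⁻¹ E f)`, and the integral ignores
    -- the outer `K`; this produces `S(E) = -K⁻¹ E`.
    have hK := invInt_act_K k (χ * act n q (Uq.gen q (.L k)) (act n q (Uq.gen q (.E k)) f))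
    have e1 : act n q (Uq.gen q (.E k)) (χ * f) = act n q (Uq.gen q (.E k)) χ * f +
        act n q (Uq.gen q (.K k)) χ * act n q (Uq.gen q (.E k)) f := by
      simp only [act_E, act_K, actE_mul]
    have e2 : act n q (Uq.gen q (.K k))
        (χ * act n q (Uq.gen q (.L k)) (act n q (Uq.gen q (.E k)) f)) =
        act n q (Uq.gen q (.K k)) χ * act n q (Uq.gen q (.E k)) f := by
      conv_rhs => rw [← Uq.KL_apply (act n q) k (act n q (Uq.gen q (.E k)) f)]
      simp only [act_K, map_mul]
    rw [e1, invInt_add (hm _ hf) (hm _ (act_mem _ hf)), ← e2, hK] at h0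
    rw [Uq.antiGen_E, map_smul, LinearMap.smul_apply, mul_smul_comm, invInt_smul, map_mul,
      Module.End.mul_apply]
    linear_combination h0
  | F k =>
    -- The Leibniz rule is used for `χ · K f`, so that its `K⁻¹` restores `f` in one term and the
    -- other contains `F K f`, as in `S(F) = -F K`.
    have hg := act_mem (Uq.gen q (.K k)) hf
    have h0 := invInt_act_F k (hm χ hg)
    have e1 : act n q (Uq.gen q (.F k)) (χ * act n q (Uq.gen q (.K k)) f) =
        act n q (Uq.gen q (.F k)) χ * f +
        χ * act n q (Uq.gen q (.F k)) (act n q (Uq.gen q (.K k)) f) := by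
      conv_rhs => rw [← Uq.LK_apply (act n q) k f]
      simp only [act_F, act_L, actF_mul]
      rw [← act_L, Uq.LK_apply]
    rw [e1, invInt_add (hm _ hf) (hm _ (act_mem _ hg))] at h0
    rw [Uq.antiGen_F, map_smul, LinearMap.smul_apply, mul_smul_comm, invInt_smul, map_mul,
      Module.End.mul_apply]
    linear_combination h0
  | K k =>
    rw [Uq.antiGen_K, ← invInt_act_K k (χ * _)]
    conv_lhs => rw [← Uq.KL_apply (act n q) k f]
    simp only [act_K, map_mul]
  | L k =>
    rw [Uq.antiGen_L, ← invInt_act_L k (χ * _)]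
    conv_lhs => rw [← Uq.LK_apply (act n q) k f]
    simp only [act_L, map_mul]

/-! ### Invariance of the `q`-trace -/

theorem endHolo_K_mul (k : Fin n) (A B : HoloEnd n q) :
    endHolo n q α (Uq.gen q (.K k)) (A * B) =
      endHolo n q α (Uq.gen q (.K k)) A * endHolo n q α (Uq.gen q (.K k)) B := by
  rw [endHolo_K, endHolo_K, endHolo_K]
  refine LinearMap.ext fun v => ?_
  simp only [Module.End.mul_apply, Uq.LK_apply]

theorem endHolo_L_mul (k : Fin n) (A B : HoloEnd n q) :
    endHolo n q α (Uq.gen q (.L k)) (A * B) =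
      endHolo n q α (Uq.gen q (.L k)) A * endHolo n q α (Uq.gen q (.L k)) B := by
  rw [endHolo_L, endHolo_L, endHolo_L]
  refine LinearMap.ext fun v => ?_
  simp only [Module.End.mul_apply, Uq.KL_apply]

/-- Composition makes `End V` a module algebra, with the Leibniz rules of the function algebra. In
`K A K⁻¹ · (K B K⁻¹)` the inner factors cancel, and the mixed terms telescope. -/
theorem endHolo_E_mul (k : Fin n) (A B : HoloEnd n q) :
    endHolo n q α (Uq.gen q (.E k)) (A * B) =
      endHolo n q α (Uq.gen q (.E k)) A * B +
        endHolo n q α (Uq.gen q (.K k)) A * endHolo n q α (Uq.gen q (.E k)) B := by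
  refine LinearMap.ext fun v => add_right_cancel ((endHolo_E k (A * B) v).trans ?_)
  have hA := endHolo_E (α := α) k A (B v)
  have hB := congrArg (endHolo n q α (Uq.gen q (.K k)) A) (endHolo_E (α := α) k B v)
  rw [map_add, endHolo_K] at hB
  simp only [Module.End.mul_apply, Uq.LK_apply] at hB
  rw [LinearMap.add_apply, Module.End.mul_apply, Module.End.mul_apply, Module.End.mul_apply,
    Module.End.mul_apply, endHolo_K, add_assoc, Module.End.mul_apply, Module.End.mul_apply, hB, hA]

theorem endHolo_F_mul (k : Fin n) (A B : HoloEnd n q) :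
    endHolo n q α (Uq.gen q (.F k)) (A * B) =
      endHolo n q α (Uq.gen q (.F k)) A * endHolo n q α (Uq.gen q (.L k)) B +
        A * endHolo n q α (Uq.gen q (.F k)) B := by
  refine LinearMap.ext fun v => add_right_cancel ((endHolo_F k (A * B) v).trans ?_)
  have hA := endHolo_F (α := α) k A (endHolo n q α (Uq.gen q (.L k)) B v)
  have hB := congrArg A (endHolo_F (α := α) k B v)
  rw [map_add] at hB
  rw [endHolo_L] at hA ⊢
  simp only [Module.End.mul_apply, Uq.KL_apply] at hA
  simp only [LinearMap.add_apply, Module.End.mul_apply]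
  rw [add_assoc, hB, hA]

/-- The twisting scalars of `K` and `K⁻¹` cancel, so the same diagonal operator as for functions
appears. In `vacConj_endHolo_F` the scalar remains as a common nonzero factor. -/
theorem vacConj_endHolo_E (k : Fin n) (A : HoloEnd n q) :
    vacConj n q (endHolo n q α (Uq.gen q (.E k)) A) +
      diag (chr (weight q k)) * vacConj n q A * diag (chr (weight q k))⁻¹ *
        vacConj n q (piHolo n q α (Uq.gen q (.E k))) =
      vacConj n q (piHolo n q α (Uq.gen q (.E k))) * vacConj n q A := by
  have h : endHolo n q α (Uq.gen q (.E k)) A + piHolo n q α (Uq.gen q (.K k)) *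
      A * piHolo n q α (Uq.gen q (.L k)) * piHolo n q α (Uq.gen q (.E k)) =
      piHolo n q α (Uq.gen q (.E k)) * A := LinearMap.ext (endHolo_E k A)
  have := congrArg (vacConj n q) h
  rw [map_add] at this
  simp only [vacConj_mul, vacConj_K, vacConj_L, smul_mul_assoc, mul_smul_comm] at this
  rwa [inv_smul_smul₀ (Units.ne_zero _)] at this

theorem vacConj_endHolo_F (k : Fin n) (A : HoloEnd n q) :
    vacConj n q (endHolo n q α (Uq.gen q (.F k)) A) +
      (lastScalar (twist n q α) k : ℂ) • (vacConj n q A *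
        vacConj n q (piHolo n q α (Uq.gen q (.F k))) * diag (chr (weight q k))) =
      (lastScalar (twist n q α) k : ℂ) •
        (vacConj n q (piHolo n q α (Uq.gen q (.F k))) * vacConj n q A * diag (chr (weight q k))) := by
  have h : endHolo n q α (Uq.gen q (.F k)) A +
      A * piHolo n q α (Uq.gen q (.F k)) * piHolo n q α (Uq.gen q (.K k)) =
      piHolo n q α (Uq.gen q (.F k)) * A * piHolo n q α (Uq.gen q (.K k)) :=
    LinearMap.ext (endHolo_F k A)
  have := congrArg (vacConj n q) h
  rw [map_add] at this
  simpa only [vacConj_mul, vacConj_K, smul_mul_assoc, mul_smul_comm] using this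

theorem vacConj_endHolo_K (k : Fin n) (A : HoloEnd n q) :
    vacConj n q (endHolo n q α (Uq.gen q (.K k)) A) =
      diag (chr (weight q k)) * vacConj n q A * diag (chr (weight q k))⁻¹ := by
  rw [endHolo_K]
  simp only [vacConj_mul, vacConj_K, vacConj_L, smul_mul_assoc, mul_smul_comm]
  rw [inv_smul_smul₀ (Units.ne_zero _)]

theorem vacConj_endHolo_L (k : Fin n) (A : HoloEnd n q) :
    vacConj n q (endHolo n q α (Uq.gen q (.L k)) A) =
      diag (chr (weight q k))⁻¹ * vacConj n q A * diag (chr (weight q k)) := by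
  rw [endHolo_L]
  simp only [vacConj_mul, vacConj_K, vacConj_L, smul_mul_assoc, mul_smul_comm]
  rw [smul_inv_smul₀ (Units.ne_zero _)]

theorem finCols_endHolo (x : UGen n) {A : HoloEnd n q} (hA : FinCols (vacConj n q A)) :
    FinCols (vacConj n q (endHolo n q α (Uq.gen q x) A)) := by
  cases x with
  | E k =>
    obtain ⟨b, hb⟩ := exists_isShift_E (q := q) (α := α) k
    exact FinCols.of_add (vacConj_endHolo_E k A)
      (((hA.mul_left _).mul_shift (isShift_diag _)).mul_shift hb) (hA.mul_left _)
  | F k =>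
    obtain ⟨b, hb⟩ := exists_isShift_F (q := q) (α := α) k
    exact FinCols.of_add (vacConj_endHolo_F k A)
      (((hA.mul_shift hb).mul_shift (isShift_diag _)).smul _)
      (((hA.mul_left _).mul_shift (isShift_diag _)).smul _)
  | K k => rw [vacConj_endHolo_K]; exact (hA.mul_left _).mul_shift (isShift_diag _)
  | L k => rw [vacConj_endHolo_L]; exact (hA.mul_left _).mul_shift (isShift_diag _)

section qTrace
variable (hα : 0 < α)
include hα

theorem qTrace_add {A B : HoloEnd n q} (hA : FinCols (vacConj n q A))
    (hB : FinCols (vacConj n q B)) : qTrace α (A + B) = qTrace α A + qTrace α B := by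
  obtain ⟨c, -, hc⟩ := exists_qTrace_eq n q hα
  rw [hc, hc, hc, map_add, wtr_add hA hB, mul_add]

theorem qTrace_smul (c : ℂ) (A : HoloEnd n q) : qTrace α (c • A) = c * qTrace α A := by
  obtain ⟨d, -, hd⟩ := exists_qTrace_eq n q hα
  rw [hd, hd, map_smul, wtr_smul, mul_left_comm]

theorem qTrace_E (k : Fin n) {A : HoloEnd n q} (hA : FinCols (vacConj n q A)) :
    qTrace α (endHolo n q α (Uq.gen q (.E k)) A) = 0 := by
  obtain ⟨c, -, hc⟩ := exists_qTrace_eq n q hα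
  obtain ⟨b, hb⟩ := exists_isShift_E (q := q) (α := α) k
  have e := wtr_commE hb (chr_ne_zero (weight q k)) (modWeight_balance k) hA
  rw [← vacConj_endHolo_E, wtr_add (finCols_endHolo _ hA)
    (((hA.mul_left _).mul_shift (isShift_diag _)).mul_shift hb)] at e
  rw [hc, add_eq_right.1 e, mul_zero]

theorem qTrace_F (k : Fin n) {A : HoloEnd n q} (hA : FinCols (vacConj n q A)) :
    qTrace α (endHolo n q α (Uq.gen q (.F k)) A) = 0 := by
  obtain ⟨c, -, hc⟩ := exists_qTrace_eq n q hα
  obtain ⟨b, hb⟩ := exists_isShift_F (q := q) (α := α) k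
  have e := congrArg ((lastScalar (twist n q α) k : ℂ) * ·)
    (wtr_commF (κ := chr (weight q k)) hb (fun s => (modWeight_balance k s).symm) hA)
  simp only [← wtr_smul] at e
  rw [← vacConj_endHolo_F, wtr_add (finCols_endHolo _ hA)
    (((hA.mul_shift hb).mul_shift (isShift_diag _)).smul _)] at e
  rw [hc, add_eq_right.1 e, mul_zero]

theorem qTrace_K (k : Fin n) (A : HoloEnd n q) :
    qTrace α (endHolo n q α (Uq.gen q (.K k)) A) = qTrace α A := by
  obtain ⟨c, -, hc⟩ := exists_qTrace_eq n q hα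
  rw [hc, hc, vacConj_endHolo_K, wtr_diag_conj (chr_ne_zero _)]

theorem qTrace_L (k : Fin n) (A : HoloEnd n q) :
    qTrace α (endHolo n q α (Uq.gen q (.L k)) A) = qTrace α A := by
  rw [← qTrace_K hα k, Uq.KL_apply]

/-- The operator counterpart of `invInt_act_mul`. `A` is arbitrary: a left factor cannot create new
nonzero columns. -/
theorem qTrace_endHolo_mul (x : UGen n) (A : HoloEnd n q) {T : HoloEnd n q}
    (hT : FinCols (vacConj n q T)) :
    qTrace α (endHolo n q α (Uq.gen q x) A * T) =
      qTrace α (A * endHolo n q α (Uq.antiGen q x) T) := by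
  have hm := fun (A : HoloEnd n q) {T : HoloEnd n q} (hT : FinCols (vacConj n q T)) =>
    show FinCols (vacConj n q (A * T)) from vacConj_mul A T ▸ hT.mul_left _
  cases x with
  | E k =>
    have h0 := qTrace_E hα k (hm A hT)
    have hK := qTrace_K hα k
      (A * endHolo n q α (Uq.gen q (.L k)) (endHolo n q α (Uq.gen q (.E k)) T))
    rw [endHolo_K_mul, Uq.KL_apply] at hK
    rw [endHolo_E_mul, qTrace_add hα (hm _ hT) (hm _ (finCols_endHolo _ hT)), hK] at h0
    rw [Uq.antiGen_E, map_smul, LinearMap.smul_apply, mul_smul_comm, qTrace_smul hα, map_mul,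
      Module.End.mul_apply]
    linear_combination h0
  | F k =>
    have hg := finCols_endHolo (α := α) (.K k) hT
    have h0 := qTrace_F hα k (hm A hg)
    rw [endHolo_F_mul, Uq.LK_apply, qTrace_add hα (hm _ hT) (hm _ (finCols_endHolo _ hg))] at h0
    rw [Uq.antiGen_F, map_smul, LinearMap.smul_apply, mul_smul_comm, qTrace_smul hα, map_mul,
      Module.End.mul_apply]
    linear_combination h0
  | K k =>
    rw [Uq.antiGen_K, ← qTrace_K hα k (A * _), endHolo_K_mul, Uq.KL_apply]
  | L k =>
    rw [Uq.antiGen_L, ← qTrace_L hα k (A * _), endHolo_L_mul, Uq.LK_apply]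

/-- Equivariance of the Toeplitz map, applied to `S(x)`, moves the action from the operator `T_f` to
the function `f`. -/
theorem qTrace_endHolo_mul_toeplitz (x : UGen n) (A : HoloEnd n q) {f : BallAlg n q}
    (hf : f ∈ finiteFun n q) :
    qTrace α (endHolo n q α (Uq.gen q x) A * toeplitz n q hα f) =
      qTrace α (A * toeplitz n q hα (act n q (Uq.antiGen q x) f)) := by
  rw [toeplitz_act, qTrace_endHolo_mul hα x A (finCols_toeplitz hα hf)]

end qTrace

end BallAlg
end QBall

/-! ### Completions and the action on distributions. -/

namespace QBall

open Finsupp (single)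
open BallAlg Fock

section completion
open UniformSpace (Completion)
variable {V W A : Type*} [AddCommGroup V] [UniformSpace V] [IsUniformAddGroup V] [Module ℂ V]
  [UniformContinuousConstSMul ℂ V] [AddCommGroup W] [TopologicalSpace W] [T2Space W]
  [ContinuousAdd W] [Module ℂ W] [ContinuousConstSMul ℂ W] [Semiring A] [Algebra ℂ A]

/-- A continuous map of the completion that is linear on the original space is linear. -/
def linearOfCoe (T : V →ₗ[ℂ] W) (Φ : Completion V → W) (hΦ : Continuous Φ)
    (h : ∀ v : V, Φ v = T v) : Completion V →ₗ[ℂ] W where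
  toFun := Φ
  map_add' ψ χ := by
    induction ψ, χ using Completion.induction_on₂ with
    | hp =>
      exact isClosed_eq (hΦ.comp continuous_add)
        ((hΦ.comp continuous_fst).add (hΦ.comp continuous_snd))
    | ih f g => rw [← Completion.coe_add, h, h, h, map_add]
  map_smul' c ψ := by
    induction ψ using Completion.induction_on with
    | hp =>
      exact isClosed_eq (hΦ.comp (continuous_const_smul c)) (hΦ.const_smul c)
    | ih f => rw [← Completion.coe_smul, h, h, map_smul, RingHom.id_apply]

/-- The extension of a continuous linear operator to the completion. -/
noncomputable def completionEnd (T : Module.End ℂ V) (hT : Continuous T) :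
    Module.End ℂ (Completion V) where
  toFun := Completion.map T
  map_add' ψ χ := by
    have hu : UniformContinuous T := uniformContinuous_addMonoidHom_of_continuous hT
    have hc : Continuous (Completion.map T) := Completion.continuous_map
    induction ψ, χ using Completion.induction_on₂ with
    | hp =>
      exact isClosed_eq (hc.comp continuous_add)
        ((hc.comp continuous_fst).add (hc.comp continuous_snd))
    | ih f g =>
      rw [← Completion.coe_add, Completion.map_coe hu, Completion.map_coe hu,
        Completion.map_coe hu, map_add, Completion.coe_add]
  map_smul' c ψ := by
    have hu : UniformContinuous T := uniformContinuous_addMonoidHom_of_continuous hT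
    have hc : Continuous (Completion.map T) := Completion.continuous_map
    induction ψ using Completion.induction_on with
    | hp =>
      exact isClosed_eq (hc.comp (continuous_const_smul c)) (hc.const_smul c)
    | ih f =>
      rw [← Completion.coe_smul, Completion.map_coe hu, Completion.map_coe hu, map_smul,
        Completion.coe_smul, RingHom.id_apply]

theorem continuous_completionEnd (T : Module.End ℂ V) (hT : Continuous T) :
    Continuous (completionEnd T hT) := Completion.continuous_map

theorem completionEnd_coe (T : Module.End ℂ V) (hT : Continuous T) (v : V) :
    completionEnd T hT (v : Completion V) = (T v : Completion V) :=
  Completion.map_coe (uniformContinuous_addMonoidHom_of_continuous hT) v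

theorem completion_end_ext {S T : Module.End ℂ (Completion V)} (hS : Continuous S)
    (hT : Continuous T) (h : ∀ v : V, S (v : Completion V) = T (v : Completion V)) : S = T :=
  DFunLike.coe_injective (Completion.ext hS hT h)

/-- The extension of a representation by continuous operators to the completion. -/
noncomputable def completionRep (ρ : A →ₐ[ℂ] Module.End ℂ V) (h : ∀ a, Continuous (ρ a)) :
    A →ₐ[ℂ] Module.End ℂ (Completion V) where
  toFun a := completionEnd (ρ a) (h a)
  map_one' := completion_end_ext (continuous_completionEnd _ _) continuous_id fun v => by
    rw [completionEnd_coe, map_one]; rfl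
  map_zero' := completion_end_ext (continuous_completionEnd _ _) continuous_const fun v => by
    rw [completionEnd_coe, map_zero]; rfl
  map_mul' a b := completion_end_ext (continuous_completionEnd _ _)
    ((continuous_completionEnd _ (h a)).comp (continuous_completionEnd _ (h b))) fun v => by
    rw [completionEnd_coe, map_mul, Module.End.mul_apply, Module.End.mul_apply, completionEnd_coe,
      completionEnd_coe]
  map_add' a b := completion_end_ext (continuous_completionEnd _ _)
    ((continuous_completionEnd _ (h a)).add (continuous_completionEnd _ (h b))) fun v => by
    rw [completionEnd_coe, map_add, LinearMap.add_apply, LinearMap.add_apply, completionEnd_coe,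
      completionEnd_coe, Completion.coe_add]
  commutes' c := completion_end_ext (continuous_completionEnd _ _) (continuous_const_smul c)
    fun v => by
    rw [completionEnd_coe, AlgHom.commutes, Module.algebraMap_end_apply,
      Module.algebraMap_end_apply, Completion.coe_smul]

end completion

theorem Uq.continuous_of_gen {n : ℕ} {q : QParam} {V : Type*} [AddCommGroup V] [Module ℂ V]
    [TopologicalSpace V] [ContinuousAdd V] [ContinuousConstSMul ℂ V]
    {ρ : Uq n q →ₐ[ℂ] Module.End ℂ V} (h : ∀ x, Continuous (ρ (gen q x))) (ξ : Uq n q) :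
    Continuous (ρ ξ) := by
  obtain ⟨y, rfl⟩ := RingQuot.mkAlgHom_surjective ℂ (URel n q) ξ
  induction y using FreeAlgebra.induction with
  | grade0 c =>
    rw [AlgHom.commutes, AlgHom.commutes]
    exact continuous_const_smul c
  | grade1 x => exact h x
  | mul a b ha hb => rw [map_mul, map_mul]; exact ha.comp hb
  | add a b ha hb => rw [map_add, map_add]; exact ha.add hb
namespace BallAlg
variable {n : ℕ} {q : QParam} {α : ℝ}

/-! ### Distributions as infinite matrices -/

theorem entries_apply (f : finiteFun n q) (pr : Idx n × Idx n) :
    entries n q f pr = entry (f : BallAlg n q) pr.1 pr.2 := rfl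

theorem isUniformInducing_entries : IsUniformInducing (entries n q) := ⟨rfl⟩

/-- An arbitrary matrix is the entrywise limit of its finite truncations, which are combinations of
matrix units. Hence the completion of the finite functions is the space of all matrices. -/
theorem denseRange_entries : DenseRange (entries n q) := by
  classical
  intro v
  refine mem_closure_of_tendsto (b := Filter.atTop) (f := fun S : Finset (Idx n × Idx n) =>
    entries n q (∑ pr ∈ S, v pr • munit q pr.1 pr.2)) (tendsto_pi_nhds.2 fun pr => ?_)
    (Filter.Eventually.of_forall fun S => ⟨_, rfl⟩)
  -- Each entry of the truncations is eventually constant, from the moment its position belongs to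
  -- `S`.
  refine tendsto_const_nhds.congr' ?_
  filter_upwards [Filter.eventually_ge_atTop {pr}] with S hS
  have hpr : pr ∈ S := hS (Finset.mem_singleton_self pr)
  rw [map_sum, Finset.sum_apply, Finset.sum_eq_single pr]
  · rw [map_smul, Pi.smul_apply, entries_apply, entry_munit, if_pos ⟨rfl, rfl⟩, smul_eq_mul, mul_one]
  · intro b _ hb
    rw [map_smul, Pi.smul_apply, entries_apply, entry_munit, if_neg, smul_zero]
    rintro ⟨h1, h2⟩
    exact hb (Prod.ext h1.symm h2.symm)
  · exact fun h => absurd hpr h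

/-- The space of infinite matrices as a completion of the space of finite functions. -/
noncomputable def matrixPkg (n : ℕ) (q : QParam) : AbstractCompletion (finiteFun n q) where
  space := Idx n × Idx n → ℂ
  coe := entries n q
  uniformStruct := inferInstance
  complete := inferInstance
  separation := inferInstance
  isUniformInducing := isUniformInducing_entries
  dense := denseRange_entries

/-- The matrix of a distribution. -/
noncomputable def distMatrix (n : ℕ) (q : QParam) : Dist n q ≃ᵤ (Idx n × Idx n → ℂ) :=
  UniformSpace.Completion.cPkg.compareEquiv (matrixPkg n q)

theorem distMatrix_coe (f : finiteFun n q) : distMatrix n q (f : Dist n q) = entries n q f :=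
  AbstractCompletion.compare_coe _ _ f

/-- The matrix of a distribution, as a linear map. -/
noncomputable def distMatrixLin (n : ℕ) (q : QParam) : Dist n q →ₗ[ℂ] (Idx n × Idx n → ℂ) :=
  linearOfCoe (V := finiteFun n q) (entries n q) (distMatrix n q) (distMatrix n q).continuous
    distMatrix_coe

/-! ### The action on distributions -/

theorem continuous_entries_iff {X : Type*} [TopologicalSpace X] {g : X → finiteFun n q} :
    Continuous g ↔ ∀ p r, Continuous fun x => entry (g x : BallAlg n q) p r := by
  rw [isUniformInducing_entries.isInducing.continuous_iff, continuous_pi_iff]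
  exact ⟨fun h p r => h (p, r), fun h pr => h pr.1 pr.2⟩

section continuity
variable {X : Type*} [TopologicalSpace X] {g h : X → Module.End ℂ (Fock n)} {u v : Idx n}
  {b : Idx n → ℂ} {B : Module.End ℂ (Fock n)}

/-- An entry of `B X` is zero or a multiple of a single entry of `X`. This is why the generators act
continuously in the topology of entries. -/
theorem continuous_shift_mul (hB : IsShift u v b B)
    (hg : ∀ p r, Continuous fun x => (g x (single r 1)) p) (p r : Idx n) :
    Continuous fun x => ((B * g x) (single r 1)) p := by
  simp only [Module.End.mul_apply]
  by_cases hv : v ≤ p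
  · obtain ⟨s, rfl⟩ : ∃ s, p = s + v := ⟨p - v, (tsub_add_cancel_of_le hv).symm⟩
    simp only [hB.coord_add]
    exact continuous_const.mul (hg _ _)
  · simp only [hB.coord_zero _ hv]
    exact continuous_const

theorem continuous_mul_shift (hB : IsShift u v b B)
    (hg : ∀ p r, Continuous fun x => (g x (single r 1)) p) (p r : Idx n) :
    Continuous fun x => ((g x * B) (single r 1)) p := by
  simp only [Module.End.mul_apply]
  by_cases hu : u ≤ r
  · obtain ⟨s, rfl⟩ : ∃ s, r = s + u := ⟨r - u, (tsub_add_cancel_of_le hu).symm⟩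
    simp only [hB.apply_add, map_smul, Finsupp.smul_apply]
    simp only [smul_eq_mul]
    exact continuous_const.mul (hg _ _)
  · simp only [hB.apply_zero _ hu, map_zero, Finsupp.zero_apply]
    exact continuous_const

theorem continuous_sub_entry (hg : ∀ p r, Continuous fun x => (g x (single r 1)) p)
    (hh : ∀ p r, Continuous fun x => (h x (single r 1)) p) (p r : Idx n) :
    Continuous fun x => ((g x - h x) (single r 1)) p :=
  (hg p r).sub (hh p r)

end continuity

theorem continuous_finAct_gen (x : UGen n) : Continuous (finAct n q (Uq.gen q x)) := by
  have h0 : ∀ p r, Continuous fun f : finiteFun n q => (fock n q (f : BallAlg n q) (single r 1)) p :=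
    continuous_entries_iff.1 continuous_id
  have hd := fun d : Idx n → ℂ => isShift_diag d
  refine continuous_entries_iff.2 ?_
  change ∀ p r, Continuous fun f : finiteFun n q =>
    (fock n q (act n q (Uq.gen q x) (f : BallAlg n q)) (single r 1)) p
  cases x with
  | E k =>
    obtain ⟨b, hb⟩ := exists_isShift_hatE (q := q) k
    simp only [act_E, fock_actE, fock_actK]
    exact continuous_sub_entry (continuous_shift_mul hb h0)
      (continuous_mul_shift hb (continuous_mul_shift (hd _) (continuous_shift_mul (hd _) h0)))
  | F k =>
    obtain ⟨b, hb⟩ := exists_isShift_hatF (q := q) k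
    simp only [act_F, fock_actF]
    exact continuous_mul_shift (hd _) (continuous_sub_entry (continuous_shift_mul hb h0)
      (continuous_mul_shift hb h0))
  | K k =>
    simp only [act_K, fock_actK]
    exact continuous_mul_shift (hd _) (continuous_shift_mul (hd _) h0)
  | L k =>
    simp only [act_L, fock_actL]
    exact continuous_mul_shift (hd _) (continuous_shift_mul (hd _) h0)

theorem continuous_finAct (ξ : Uq n q) : Continuous (finAct n q ξ) :=
  Uq.continuous_of_gen (V := finiteFun n q) continuous_finAct_gen ξ

/-- The action on distributions. -/
noncomputable def distAct (n : ℕ) (q : QParam) : Uq n q →ₐ[ℂ] Module.End ℂ (Dist n q) :=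
  completionRep (V := finiteFun n q) (finAct n q) continuous_finAct

theorem continuous_distAct (ξ : Uq n q) : Continuous (distAct n q ξ) :=
  continuous_completionEnd (V := finiteFun n q) _ (continuous_finAct ξ)

theorem distAct_coe (ξ : Uq n q) (f : finiteFun n q) :
    distAct n q ξ (f : Dist n q) = (finAct n q ξ f : Dist n q) :=
  completionEnd_coe (V := finiteFun n q) _ (continuous_finAct ξ) f

theorem isDistAction : IsDistAction (distAct n q) :=
  fun ξ => ⟨continuous_distAct ξ, distAct_coe ξ⟩

end BallAlg
end QBall

namespace QBall

open Finsupp (single)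
open BallAlg Fock

namespace BallAlg
variable {n : ℕ} {q : QParam} {α : ℝ}

/-! ### The pairing of distributions and finite functions -/

/-- The normalizing factor of the invariant integral. -/
noncomputable def nuConst (n : ℕ) (q : QParam) : ℂ := (exists_invInt_eq n q).choose

theorem nuConst_ne_zero : nuConst n q ≠ 0 := (exists_invInt_eq n q).choose_spec.1

theorem invInt_eq (f : BallAlg n q) :
    invInt f = nuConst n q * wtr (chr (modWeight n q)) (fock n q f) :=
  (exists_invInt_eq n q).choose_spec.2 f

/-- The nonzero columns of a finite function. -/
noncomputable def cols (f : finiteFun n q) : Finset (Idx n) := (finCols_fock f.2).toFinset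

theorem fock_of_notMem_cols {f : finiteFun n q} {p : Idx n} (h : p ∉ cols f) :
    fock n q (f : BallAlg n q) (single p 1) = 0 := by
  by_contra h'
  exact h ((finCols_fock f.2).mem_toFinset.2 h')

/-- The value of the pairing of a distribution and a finite function. -/
noncomputable def pairVal (ψ : Dist n q) (f : finiteFun n q) : ℂ :=
  nuConst n q * ∑ p ∈ cols f, chr (modWeight n q) p *
    (fock n q (f : BallAlg n q) (single p 1)).sum fun r x => x * distMatrix n q ψ (p, r)

/-- The trace of `T(χ) T(f)` involves, for fixed finite `f`, only finitely many entries of `T(χ)`;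
this formula therefore extends continuously to distributions. -/
theorem pairVal_coe (χ f : finiteFun n q) :
    pairVal (χ : Dist n q) f = invInt ((χ : BallAlg n q) * (f : BallAlg n q)) := by
  rw [invInt_eq, pairVal, wtr, finsum_eq_sum_of_support_subset (s := cols f)]
  · congr 1
    refine Finset.sum_congr rfl fun p _ => ?_
    rw [map_mul, Module.End.mul_apply, coord_eq_sum _ _ subset_rfl, distMatrix_coe]
    rfl
  · intro p hp
    by_contra h
    refine hp ?_
    simp only [map_mul, Module.End.mul_apply, fock_of_notMem_cols h, map_zero,
      Finsupp.zero_apply, mul_zero]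

theorem continuous_pairVal (f : finiteFun n q) : Continuous fun ψ : Dist n q => pairVal ψ f := by
  have hc := continuous_pi_iff.1 (distMatrix n q).continuous
  exact continuous_const.mul (continuous_finsetSum _ fun p _ => continuous_const.mul
    (continuous_finsetSum _ fun r _ => continuous_const.mul (hc _)))

/-- The continuous extension supplies the limit, and density of the finite functions makes the
filter nontrivial, so the limit is unique. -/
theorem hasPairing_iff {ψ : Dist n q} {f : finiteFun n q} {I : ℂ} :
    HasPairing ψ f I ↔ I = pairVal ψ f := by
  have h : HasPairing ψ f (pairVal ψ f) := by
    unfold HasPairing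
    simp only [← pairVal_coe]
    exact ((continuous_pairVal f).tendsto ψ).comp Filter.tendsto_comap
  have hne : (Filter.comap (fun χ : finiteFun n q => (χ : Dist n q)) (nhds ψ)).NeBot :=
    UniformSpace.Completion.isDenseInducing_coe.comap_nhds_neBot ψ
  exact ⟨fun h' => tendsto_nhds_unique h' h, fun e => e ▸ h⟩

/-- The factor in front is nonzero, so a distribution is determined by its pairings with matrix
units, and any values of these pairings can be prescribed. -/
theorem pairVal_munit (ψ : Dist n q) (r p : Idx n) : pairVal ψ (munit q r p) =
    nuConst n q * chr (modWeight n q) p * distMatrix n q ψ (p, r) := by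
  rw [pairVal, Finset.sum_eq_single p]
  · rw [fock_munit, if_pos rfl, Finsupp.sum_single_index (zero_mul _), one_mul, mul_assoc]
  · intro m _ hm
    rw [fock_munit, if_neg hm, Finsupp.sum_zero_index, mul_zero]
  · intro hp
    rw [fock_of_notMem_cols hp, Finsupp.sum_zero_index, mul_zero]

/-- Both sides are continuous in `ψ`, so it suffices to treat finite functions, where it is
`invInt_act_mul`. -/
theorem pairVal_distAct (x : UGen n) (ψ : Dist n q) (f : finiteFun n q) :
    pairVal (distAct n q (Uq.gen q x) ψ) f = pairVal ψ (finAct n q (Uq.antiGen q x) f) := by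
  induction ψ using UniformSpace.Completion.induction_on with
  | hp =>
    exact isClosed_eq ((continuous_pairVal f).comp (continuous_distAct _)) (continuous_pairVal _)
  | ih χ =>
    rw [distAct_coe, pairVal_coe, pairVal_coe]
    exact invInt_act_mul x _ f.2

/-- A finite function as a combination of matrix units. -/
theorem apply_eq_sum_munit {ℓ : finiteFun n q →ₗ[ℂ] ℂ}
    (hℓ : ∀ f : finiteFun n q, fock n q (f : BallAlg n q) = 0 → ℓ f = 0) (f : finiteFun n q) :
    ℓ f = ∑ p ∈ cols f, (fock n q (f : BallAlg n q) (single p 1)).sum fun r x =>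
      x * ℓ (munit q r p) := by
  -- `g` has the same matrix as `f`. Equality of `f` and `g` is not claimed; the hypothesis on `ℓ`
  -- makes the equality of their matrices enough.
  set g : finiteFun n q := ∑ p ∈ cols f, (fock n q (f : BallAlg n q) (single p 1)).sum fun r x =>
      x • munit q r p with hg
  have h : fock n q ((f + (-1 : ℂ) • g : finiteFun n q) : BallAlg n q) = 0 := by
    refine end_ext fun m => ?_
    have hgm : fock n q (g : BallAlg n q) (single m 1) =
        fock n q (f : BallAlg n q) (single m 1) := by
      have e : ∀ p, fock n q (((fock n q (f : BallAlg n q) (single p 1)).sum fun r x =>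
          x • munit q r p : finiteFun n q) : BallAlg n q) (single m 1) =
          if m = p then fock n q (f : BallAlg n q) (single p 1) else 0 := fun p => by
        rw [Finsupp.sum, Submodule.coe_sum, map_sum, LinearMap.sum_apply]
        simp only [Submodule.coe_smul, map_smul, LinearMap.smul_apply, fock_munit]
        split_ifs with hm
        · simp only [Finsupp.smul_single, smul_eq_mul, mul_one]
          exact Finsupp.sum_single _
        · simp
      rw [hg, Submodule.coe_sum, map_sum, LinearMap.sum_apply]
      simp only [e]
      rw [Finset.sum_ite_eq]
      split_ifs with hm
      · rfl
      · exact (fock_of_notMem_cols hm).symm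
    rw [Submodule.coe_add, Submodule.coe_smul, map_add, map_smul, LinearMap.add_apply,
      LinearMap.smul_apply, hgm, neg_one_smul, add_neg_cancel, LinearMap.zero_apply]
  have h' := hℓ _ h
  rw [map_add, map_smul] at h'
  have : ℓ f = ℓ g := by simpa [add_neg_eq_zero] using h'
  rw [this, hg, map_sum]
  refine Finset.sum_congr rfl fun p _ => ?_
  rw [Finsupp.sum, map_sum]
  simp only [map_smul, smul_eq_mul]
  rfl

/-! ### Covariant symbols -/

section symbol
variable (hα : 0 < α)

theorem finCols_mul_toeplitz (A : HoloEnd n q) (f : finiteFun n q) :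
    FinCols (vacConj n q (A * toeplitz n q hα (f : BallAlg n q))) := by
  rw [vacConj_mul]
  exact (finCols_toeplitz hα f.2).mul_left _

/-- The bilinear form `Tr_q (A T_f)`. -/
noncomputable def tracePair (n : ℕ) (q : QParam) {α : ℝ} (hα : 0 < α) :
    finiteFun n q →ₗ[ℂ] HoloEnd n q →ₗ[ℂ] ℂ :=
  LinearMap.mk₂ ℂ (fun f A => qTrace α (A * toeplitz n q hα (f : BallAlg n q)))
    (fun f g A => by
      rw [Submodule.coe_add, map_add, mul_add,
        qTrace_add hα (finCols_mul_toeplitz hα A f) (finCols_mul_toeplitz hα A g)])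
    (fun c f A => by
      rw [Submodule.coe_smul, map_smul, mul_smul_comm, qTrace_smul hα, smul_eq_mul])
    (fun f A B => by
      rw [add_mul, qTrace_add hα (finCols_mul_toeplitz hα A f) (finCols_mul_toeplitz hα B f)])
    (fun c f A => by rw [smul_mul_assoc, qTrace_smul hα, smul_eq_mul])

theorem tracePair_apply (f : finiteFun n q) (A : HoloEnd n q) :
    tracePair n q hα f A = qTrace α (A * toeplitz n q hα (f : BallAlg n q)) := rfl

/-- The form factors through `T(f)`, as required by `apply_eq_sum_munit`. -/
theorem tracePair_eq_zero {f : finiteFun n q} (h : fock n q (f : BallAlg n q) = 0)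
    (A : HoloEnd n q) : tracePair n q hα f A = 0 := by
  obtain ⟨c, -, hc⟩ := exists_qTrace_eq n q hα
  have hT : vacConj n q (toeplitz n q hα (f : BallAlg n q)) = 0 := end_ext fun m => by
    rw [vacConj_single, toeplitz_eq_zero_of_forall hα (fun s => by rw [h, LinearMap.zero_apply]),
      map_zero, LinearMap.zero_apply]
  rw [tracePair_apply, hc, vacConj_mul, hT, mul_zero]
  simp [wtr]

/-- The space of distributions as the space of infinite matrices. -/
noncomputable def distEquiv (n : ℕ) (q : QParam) : Dist n q ≃ₗ[ℂ] (Idx n × Idx n → ℂ) :=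
  LinearEquiv.ofBijective (distMatrixLin n q) (distMatrix n q).bijective

/-- The covariant symbol map. -/
noncomputable def symbol (n : ℕ) (q : QParam) {α : ℝ} (hα : 0 < α) :
    HoloEnd n q →ₗ[ℂ] Dist n q :=
  (distEquiv n q).symm.toLinearMap.comp (LinearMap.pi fun pr =>
    (nuConst n q * chr (modWeight n q) pr.1)⁻¹ • tracePair n q hα (munit q pr.2 pr.1))

theorem distMatrix_symbol (A : HoloEnd n q) (pr : Idx n × Idx n) :
    distMatrix n q (symbol n q hα A) pr =
      (nuConst n q * chr (modWeight n q) pr.1)⁻¹ *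
        tracePair n q hα (munit q pr.2 pr.1) A :=
  congrFun ((distEquiv n q).apply_symm_apply _) pr

/-- The entries of `symbol` are chosen so that this holds for matrix units, and both sides expand in
the same way in the matrix of `f`. -/
theorem pairVal_symbol (A : HoloEnd n q) (f : finiteFun n q) :
    pairVal (symbol n q hα A) f = tracePair n q hα f A := by
  have h := apply_eq_sum_munit (ℓ := (tracePair n q hα).flip A)
    (fun f hf => tracePair_eq_zero hα hf A) f
  simp only [LinearMap.flip_apply] at h
  rw [h, pairVal, Finset.mul_sum]
  refine Finset.sum_congr rfl fun p _ => ?_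
  rw [← mul_assoc, Finsupp.sum, Finsupp.sum, Finset.mul_sum]
  refine Finset.sum_congr rfl fun r _ => ?_
  have h1 := nuConst_ne_zero (n := n) (q := q)
  have h2 := chr_ne_zero (modWeight n q) p
  rw [distMatrix_symbol]
  field_simp

theorem eq_symbol_iff {A : HoloEnd n q} {ψ : Dist n q} :
    (∀ f, pairVal ψ f = tracePair n q hα f A) ↔ ψ = symbol n q hα A := by
  refine ⟨fun h => (distMatrix n q).injective (funext fun pr => ?_), fun h f => ?_⟩
  · have e := (h (munit q pr.2 pr.1)).trans (pairVal_symbol hα A (munit q pr.2 pr.1)).symm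
    rw [pairVal_munit, pairVal_munit] at e
    exact mul_left_cancel₀ (mul_ne_zero nuConst_ne_zero (chr_ne_zero _ _)) e
  · rw [h, pairVal_symbol]

theorem isCovariantSymbol_iff {A : HoloEnd n q} {ψ : Dist n q} :
    IsCovariantSymbol α A ψ ↔ ψ = symbol n q hα A := by
  rw [← eq_symbol_iff hα]
  refine ⟨fun h f => ?_, fun h f Tf hT => ?_⟩
  · exact (hasPairing_iff.1 (h f _ ((isToeplitz_iff hα).2 rfl))).symm
  · rw [hasPairing_iff, (isToeplitz_iff hα).1 hT, h, tracePair_apply]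

/-- For a generator, pair `x(σ(A))` with `f`: the antipode of `x` passes to `f`, then through the
Toeplitz map and the `q`-trace back to `A`. Uniqueness of the symbol identifies the two
distributions. -/
theorem symbol_endHolo (ξ : Uq n q) (A : HoloEnd n q) :
    symbol n q hα (endHolo n q α ξ A) = distAct n q ξ (symbol n q hα A) := by
  refine Uq.intertwine (fun x A => ?_) ξ A
  refine ((eq_symbol_iff hα).1 fun f => ?_).symm
  rw [pairVal_distAct, pairVal_symbol, tracePair_apply, tracePair_apply,
    qTrace_endHolo_mul_toeplitz hα x A f.2]
  rfl

end symbol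
end BallAlg
end QBall

theorem proposition3p8 (n : ℕ) (hn : 1 ≤ n) (q : QBall.QParam) (α : ℝ) (hα : 0 < α) :
    ∃ (δ : QBall.Uq n q →ₐ[ℂ] Module.End ℂ (QBall.Dist n q))
      (toep : QBall.BallAlg n q →ₗ[ℂ] QBall.HoloEnd n q)
      (σ : QBall.HoloEnd n q →ₗ[ℂ] QBall.Dist n q)
      (B : QBall.FiniteFun n q →ₗ[ℂ] QBall.Dist n q),
      QBall.IsDistAction δ ∧
      (∀ f A, QBall.IsToeplitz α f A ↔ A = toep f) ∧
      (∀ A ψ, QBall.IsCovariantSymbol α A ψ ↔ ψ = σ A) ∧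
      (∀ f : QBall.FiniteFun n q, B f = σ (toep (f : QBall.BallAlg n q))) ∧
      (∀ ξ f, toep (QBall.act n q ξ f) = QBall.endAct n q α ξ (toep f)) ∧
      (∀ ξ (A : QBall.HoloEnd n q), σ (QBall.endAct n q α ξ A) = δ ξ (σ A)) ∧
      (∀ ξ f, B (QBall.finAct n q ξ f) = δ ξ (B f)) := by
  refine ⟨QBall.BallAlg.distAct n q, QBall.BallAlg.toeplitz n q hα, QBall.BallAlg.symbol n q hα,
    (QBall.BallAlg.symbol n q hα).comp
      ((QBall.BallAlg.toeplitz n q hα).comp (QBall.BallAlg.finiteFun n q).subtype),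
    QBall.BallAlg.isDistAction, fun f A => QBall.BallAlg.isToeplitz_iff hα,
    fun A ψ => QBall.BallAlg.isCovariantSymbol_iff hα, fun f => rfl,
    fun ξ f => QBall.BallAlg.toeplitz_act hα ξ f, fun ξ A => QBall.BallAlg.symbol_endHolo hα ξ A,
    fun ξ f => ?_⟩
  refine Eq.trans ?_ (QBall.BallAlg.symbol_endHolo hα ξ (QBall.BallAlg.toeplitz n q hα f))
  rw [← QBall.BallAlg.toeplitz_act]
  rfl
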